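/- Let $N\ge 1$, let $S_2(N)$ be the space of cusp forms of weight $2$ for $\Gamma_0(N)$ with the Petersson inner product, and let $\mathbb{T}$ be the abstract Hecke algebra of $\Gamma_0(N)$, that is, the free $\mathbb{Z}$-module on the double cosets $\Gamma_0(N)\alpha\Gamma_0(N)$, where $\alpha$ runs through the integral matrices $\begin{pmatrix}a&b\\c&d\end{pmatrix}$ of positive determinant with $N\mid c$ and $\gcd(a,N)=1$, acting on $S_2(N)$ by the usual double coset operators. Let $G\in S_2(N)$ be a normalized newform, that is, $G$ is orthogonal to all oldforms, is an eigenform of all $T\in\mathbb{T}$, and has first Fourier coefficient $1$. Let $K\subset\mathbb{C}$ be the field generated over $\mathbb{Q}$ by the eigenvalues of all $T\in\mathbb{T}$ on $G$. Then there is an element $t\in\mathbb{T}\otimes_{\mathbb{Z}}K$ such that the corresponding operator on $S_2(N)$ is the orthogonal projection onto $\mathbb{C}G$. Moreover, $t$ can be chosen as follows: there are finitely many primes $p_1,\dots,p_r$ not dividing $N$ such that, if $\lambda_i\in K$ denotes the eigenvalue of $T_{p_i}$ on $G$ and the characteristic polynomial of $T_{p_i}$ on the finite-dimensional space $S_2(N)$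 is written as $(X-\lambda_i)^{\mu_i}Q_i(X)$ with $Q_i\in K[X]$ and $Q_i(\lambda_i)\neq 0$, then $t$ acts on $S_2(N)$ as $$\prod_{i=1}^{r}\frac{Q_i(T_{p_i})}{Q_i(\lambda_i)}.$$ -/

import Mathlib

noncomputable section

open scoped MatrixGroups ModularForm Modular TensorProduct
open UpperHalfPlane Matrix.SpecialLinearGroup MeasureTheory

namespace HeckeProj

/-- The congruence subgroup `Γ₀(N)` as a subgroup of `GL₂(ℝ)`. -/
abbrev Γ₀ (N : ℕ) : Subgroup (GL (Fin 2) ℝ) :=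
  (CongruenceSubgroup.Gamma0 N).map (mapGL ℝ)

/-- The space `S₂(N)` of cusp forms of weight `2` for `Γ₀(N)`. -/
abbrev S₂ (N : ℕ) : Type := CuspForm (Γ₀ N) 2

/-! ### The abstract Hecke algebra of `Γ₀(N)` -/

/-- The monoid `Δ₀(N)` of integral matrices `(a b; c d)` of positive determinant with `N ∣ c` and
`gcd(a, N) = 1`. -/
def Δ₀ (N : ℕ) : Submonoid (GL (Fin 2) ℝ) where
  carrier := {g | ∃ A : Matrix (Fin 2) (Fin 2) ℤ, g.val = A.map (Int.cast : ℤ → ℝ) ∧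
    0 < A.det ∧ (N : ℤ) ∣ A 1 0 ∧ IsCoprime (A 0 0) (N : ℤ)}
  one_mem' := ⟨1, by simp, by simp, by simp, by simpa using isCoprime_one_left⟩
  mul_mem' := by
    rintro g h ⟨A, hA, hA1, hA2, hA3⟩ ⟨B, hB, hB1, hB2, hB3⟩
    refine ⟨A * B, ?_, ?_, ?_, ?_⟩
    · rw [Units.val_mul, hA, hB]
      exact (Matrix.map_mul (f := Int.castRingHom ℝ)).symm
    · rw [Matrix.det_mul]; positivity
    · rw [Matrix.mul_apply, Fin.sum_univ_two]
      exact dvd_add (hA2.mul_right _) (hB2.mul_left _)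
    · rw [Matrix.mul_apply, Fin.sum_univ_two]
      obtain ⟨c, hc⟩ := hB2
      rw [hc, mul_left_comm]
      exact (hA3.mul_left hB3).add_mul_left_left _

/-- The abstract Hecke algebra `𝕋` of `Γ₀(N)`, as an additive group: the free abelian group on the
double cosets `Γ₀(N) α Γ₀(N)` with `α ∈ Δ₀(N)`. -/
abbrev 𝕋 (N : ℕ) : Type := HeckeRing (Δ₀ N) (Γ₀ N) ℤ

lemma det_pos {N : ℕ} (α : Δ₀ N) : 0 < α.val.det.val := by
  obtain ⟨A, hA, hA1, -, -⟩ := α.2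
  rw [Matrix.GeneralLinearGroup.val_det_apply, hA]
  have := (Int.castRingHom ℝ).map_det A
  simp only [RingHom.mapMatrix_apply, Int.coe_castRingHom] at this
  rw [← this]
  exact_mod_cast hA1

open ConjAct Pointwise in
lemma mem_conj_iff {N : ℕ} (α x : GL (Fin 2) ℝ) :
    x ∈ toConjAct α⁻¹ • Γ₀ N ↔ α * x * α⁻¹ ∈ Γ₀ N := by
  rw [map_inv, Subgroup.mem_inv_pointwise_smul_iff, toConjAct_smul]

open ConjAct Pointwise in
lemma isArithmetic_conj {N : ℕ} [NeZero N] (α : Δ₀ N) :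
    (toConjAct α.val⁻¹ • Γ₀ N).IsArithmetic := by
  obtain ⟨A, hA, hA1, -, -⟩ := α.2
  have hdet : (A.map (Int.cast : ℤ → ℚ)).det ≠ 0 := by
    have := (Int.castRingHom ℚ).map_det A
    simp only [RingHom.mapMatrix_apply, Int.coe_castRingHom] at this
    rw [← this]
    exact_mod_cast hA1.ne'
  have key : (Matrix.GeneralLinearGroup.mkOfDetNeZero _ hdet).map (Rat.castHom ℝ) = α.val := by
    apply Units.ext
    rw [hA]
    ext i j
    simp [Matrix.GeneralLinearGroup.mkOfDetNeZero]
  have := Subgroup.IsArithmetic.conj (Γ₀ N) (Matrix.GeneralLinearGroup.mkOfDetNeZero _ hdet)⁻¹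
  rwa [map_inv, key] at this

open ConjAct Pointwise in
instance {N : ℕ} [NeZero N] (α : Δ₀ N) :
    (toConjAct α.val⁻¹ • Γ₀ N).IsFiniteRelIndex (Γ₀ N) :=
  ⟨((isArithmetic_conj α).is_commensurable.trans
    (Subgroup.IsArithmetic.is_commensurable (𝒢 := Γ₀ N)).symm).1⟩

open ConjAct Pointwise in
lemma trace_apply {N : ℕ} [NeZero N] (α : Δ₀ N) (f : S₂ N) :
    (CuspForm.trace (Γ₀ N) (CuspForm.translate f α.val) : ℍ → ℂ) =
      ∑ᶠ q : Γ₀ N ⧸ (toConjAct α.val⁻¹ • Γ₀ N).subgroupOf (Γ₀ N),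
        (f : ℍ → ℂ) ∣[(2 : ℤ)] (α.val * (q.out : GL (Fin 2) ℝ)⁻¹) := by
  let := Fintype.ofFinite (Γ₀ N ⧸ (toConjAct α.val⁻¹ • Γ₀ N).subgroupOf (Γ₀ N))
  rw [CuspForm.coe_trace, finsum_eq_sum_of_fintype]
  refine Finset.sum_congr (by congr!) fun q _ ↦ ?_
  conv_lhs => rw [← q.out_eq']
  rw [SlashAction.slash_mul]
  rfl

/-- The operator `f ↦ ∑ f ∣[2] α h⁻¹`, `h ∈ Γ₀(N) / (Γ₀(N) ∩ α⁻¹ Γ₀(N) α)`, on `S₂(N)`: here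
`α h⁻¹` runs through representatives of `Γ₀(N) \ Γ₀(N) α Γ₀(N)`. Recall
`(f ∣[2] g) τ = det g · (c τ + d)⁻² · f (g τ)` if `det g > 0`. -/
def cosetOp {N : ℕ} [NeZero N] (α : Δ₀ N) : S₂ N →ₗ[ℂ] S₂ N where
  toFun f := CuspForm.trace (Γ₀ N) (CuspForm.translate f α.val)
  map_add' f g := by
    apply DFunLike.coe_injective
    rw [FunLike.coe_add, trace_apply, trace_apply, trace_apply,
      ← finsum_add_distrib (Set.toFinite _) (Set.toFinite _)]
    simp [SlashAction.add_slash]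
  map_smul' c f := by
    apply DFunLike.coe_injective
    rw [RingHom.id_apply, FunLike.coe_smul, trace_apply, trace_apply, smul_finsum' _ (Set.toFinite _)]
    refine finsum_congr fun q ↦ ?_
    have hdet : 0 < (α.val * (q.out : GL (Fin 2) ℝ)⁻¹).det.val := by
      obtain ⟨h, -, h2⟩ := q.out.2
      rw [← h2, map_mul, map_inv, det_mapGL]
      simpa using det_pos α
    rw [FunLike.coe_smul, ModularForm.smul_slash, σ, if_pos hdet]
    rfl

open ConjAct Pointwise in
lemma cosetOp_eq {N : ℕ} [NeZero N] (α : Δ₀ N) (f : S₂ N) :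
    (cosetOp α f : ℍ → ℂ) =
      ∑ᶠ y ∈ {y : Quotient (QuotientGroup.rightRel (Γ₀ N)) |
          ∃ g ∈ DoubleCoset.doubleCoset α.val (Γ₀ N : Set (GL (Fin 2) ℝ)) (Γ₀ N),
            Quotient.mk _ g = y},
        (f : ℍ → ℂ) ∣[(2 : ℤ)] y.out := by
  rw [cosetOp, LinearMap.coe_mk, AddHom.coe_mk, trace_apply, ← finsum_mem_univ]
  have hinv {g h : GL (Fin 2) ℝ} (hgh : h * g⁻¹ ∈ Γ₀ N) :
      (f : ℍ → ℂ) ∣[(2 : ℤ)] g = (f : ℍ → ℂ) ∣[(2 : ℤ)] h := by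
    have := congr_arg (· ∣[(2 : ℤ)] g) (SlashInvariantFormClass.slash_action_eq f _ hgh)
    simpa [← SlashAction.slash_mul] using this.symm
  refine finsum_mem_eq_of_bijOn
    (fun q ↦ Quotient.mk (QuotientGroup.rightRel (Γ₀ N)) (α.val * (q.out : GL (Fin 2) ℝ)⁻¹))
    ⟨?_, ?_, ?_⟩ ?_
  · intro q _
    exact ⟨_, DoubleCoset.mem_doubleCoset.mpr ⟨1, one_mem _, _, inv_mem q.out.2, by simp⟩, rfl⟩
  · intro q _ r _ hqr
    rw [← q.out_eq', ← r.out_eq']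
    have h1 := QuotientGroup.rightRel_apply.mp (Quotient.exact hqr)
    refine QuotientGroup.eq.mpr ?_
    rw [Subgroup.mem_subgroupOf, mem_conj_iff, ← inv_mem_iff]
    convert h1 using 1
    simp [mul_assoc]
  · rintro _ ⟨g, hg, rfl⟩
    obtain ⟨x, hx, y, hy, rfl⟩ := DoubleCoset.mem_doubleCoset.mp hg
    refine ⟨QuotientGroup.mk ⟨y⁻¹, inv_mem hy⟩, trivial, ?_⟩
    refine Quotient.sound (QuotientGroup.rightRel_apply.mpr ?_)
    obtain ⟨k, hk⟩ := QuotientGroup.mk_out_eq_mul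
      ((toConjAct α.val⁻¹ • Γ₀ N).subgroupOf (Γ₀ N)) ⟨y⁻¹, inv_mem hy⟩
    have h2 := k.2
    rw [Subgroup.mem_subgroupOf, mem_conj_iff] at h2
    simp only [hk]
    convert mul_mem hx h2 using 1
    simp [mul_assoc]
  · intro q _
    refine hinv ?_
    rw [← inv_mem_iff]
    simpa using QuotientGroup.rightRel_apply.mp
      (Quotient.mk_out (s := QuotientGroup.rightRel (Γ₀ N)) (α.val * (q.out : GL (Fin 2) ℝ)⁻¹))

/-- The double coset operator on `S₂(N)`. -/
def doubleCosetOp {N : ℕ} [NeZero N] (D : HeckeCoset (Δ₀ N) (Γ₀ N) (Γ₀ N)) : S₂ N →ₗ[ℂ] S₂ N :=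
  Quotient.liftOn D cosetOp fun α β h ↦ by
    ext f : 1
    apply DFunLike.coe_injective
    rw [cosetOp_eq, cosetOp_eq, show DoubleCoset.doubleCoset α.val _ _ = _ from h]

/-- The action of the abstract Hecke algebra on `S₂(N)`. -/
def heckeAct (N : ℕ) [NeZero N] : 𝕋 N →+ Module.End ℂ (S₂ N) where
  toFun T := (HeckeCosetModule.of.symm T).sum fun D n ↦ n • doubleCosetOp D
  map_zero' := Finsupp.sum_zero_index
  map_add' _ _ := Finsupp.sum_add_index' (fun _ ↦ zero_smul _ _) fun _ _ _ ↦ add_smul _ _ _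

/-- The action of `𝕋 ⊗ K` on `S₂(N)` for a subfield `K` of `ℂ`: `T ⊗ c` acts as `c T`. -/
def heckeActTensor (N : ℕ) [NeZero N] (K : IntermediateField ℚ ℂ) :
    𝕋 N ⊗[ℤ] K →ₗ[ℤ] Module.End ℂ (S₂ N) :=
  TensorProduct.lift <| LinearMap.mk₂ ℤ (fun T c ↦ (c : ℂ) • heckeAct N T)
    (fun _ _ _ ↦ by rw [map_add, smul_add]) (fun _ _ _ ↦ by rw [map_zsmul, smul_comm])
    (fun _ _ _ ↦ add_smul _ _ _) (fun n T c ↦ by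
      rw [← smul_assoc]; congr 1)

/-- The Hecke operator `T_p`, the double coset of `diag(1, p)`, as an element of `𝕋`. -/
def heckeT (N : ℕ) (p : Nat.Primes) : 𝕋 N :=
  HeckeCosetModule.of <| Finsupp.single (HeckeCoset.mk (Γ₀ N) (Γ₀ N)
    ⟨Matrix.GeneralLinearGroup.mkOfDetNeZero !![1, 0; 0, (p : ℝ)] (by simp [p.2.ne_zero]),
      !![1, 0; 0, (p : ℤ)], by ext i j; fin_cases i <;> fin_cases j <;>
        simp [Matrix.GeneralLinearGroup.mkOfDetNeZero], by simp [p.2.pos], by simp,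
      by simpa using isCoprime_one_left⟩) 1

/-! ### The Petersson product and newforms -/

/-- The Petersson product `∫ conj(f) g y² dx dy / y²` over `Γ₀(N) \ ℍ`, conjugate linear in `f`.
The integral over `Γ₀(N) \ ℍ` is the integral over the standard fundamental domain `𝒟` of `SL₂(ℤ)`
of the sum over the translates by representatives `q` of the cosets `SL₂(ℤ) / Γ₀(N)`. -/
def pet {N : ℕ} (f g : S₂ N) : ℂ :=
  ∫ τ in 𝒟, ∑ᶠ q : SL(2, ℤ) ⧸ CongruenceSubgroup.Gamma0 N, petersson 2 f g (q.out⁻¹ • τ)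

/-- The space of oldforms in `S₂(N)`: the span of the forms `τ ↦ f (d τ)` with `f ∈ S₂(M)` for a
proper divisor `M` of `N` and `d ∣ N / M`. -/
def oldforms (N : ℕ) : Submodule ℂ (S₂ N) :=
  Submodule.span ℂ {g | ∃ M d : ℕ, M ≠ N ∧ M * d ∣ N ∧
    ∃ f : S₂ M, ∀ τ τ' : ℍ, (τ' : ℂ) = d * τ → g τ = f τ'}

/-- `G` is a (normalized) newform in `S₂(N)`: it is orthogonal to the oldforms, an eigenform of the
whole Hecke algebra, and has first Fourier coefficient `1`. -/
structure IsNewform {N : ℕ} [NeZero N] (G : S₂ N) : Prop where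
  pet_eq_zero : ∀ f ∈ oldforms N, pet f G = 0
  eigenform : ∀ T : 𝕋 N, ∃ c : ℂ, heckeAct N T G = c • G
  normalized : (qExpansion 1 G).coeff 1 = 1

/-- The field generated over `ℚ` by the eigenvalues of the Hecke algebra on `G`. -/
def heckeField {N : ℕ} [NeZero N] (G : S₂ N) : IntermediateField ℚ ℂ :=
  IntermediateField.adjoin ℚ {c | ∃ T : 𝕋 N, heckeAct N T G = c • G}

/-- `P` is the orthogonal projection of `S₂(N)` onto the line `ℂ G`. -/
def IsOrthogonalProjection {N : ℕ} (P : Module.End ℂ (S₂ N)) (G : S₂ N) : Prop :=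
  ∀ f : S₂ N, P f ∈ Submodule.span ℂ {G} ∧ pet G (f - P f) = 0

end HeckeProj

end

open scoped TensorProduct Polynomial
open HeckeProj

/-!
For a prime `p` not dividing `N`, the operator `T_p` is self-adjoint for the Petersson product
(`pet_heckeOp`), so its eigenvalue `λ_p` on `G` is real and its generalized eigenspaces are
eigenspaces. If the characteristic polynomial of `T_p` is `(X - λ_p) ^ μ * Q_p`, then by
Cayley-Hamilton `Q_p(T_p)` maps into the kernel of `T_p - λ_p` (`sub_mul_aeval_eq_zero`), and
`Q_p(T_p) / Q_p(λ_p)` preserves the product with `G` (`pet_aeval_eq`). As the `T_p` commute, the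
product of these operators over a finite set of primes maps into the intersection of the kernels.
For a suitable set this is the space of all forms with the eigenvalues of `G`, because `S₂(N)` has
finite dimension (`exists_list_eigenforms`). By multiplicity one this space is the line of `G`,
and so the product is the orthogonal projection onto it. It remains to see where the ingredients
come from.

*Adjoints.* The Petersson product is an integral against a weight function on `ℍ` whose translates
under `Γ₀(N)` have constant sum. The integral of an invariant function does not depend on the
weight function (`IsWeight.integral_eq`), and this replaces changes of fundamental domains.
Unfolding a double coset operator (`exists_pet_cosetOp_eq`) shows that the operators of a matrix
and of its adjugate are adjoint (`pet_cosetOp_adjoint`); for `p ∤ N` the matrix `diag(1, p)` and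
its adjugate have the same double coset.

*Rationality.* That `Q_p` has coefficients in `K` follows from the rationality of the
characteristic polynomial (`exists_charpoly_heckeOp_eq`): a complex number fixed by all
automorphisms of `ℂ` is rational, and automorphisms of `ℂ` act on `S₂(N)` through Fourier
coefficients, compatibly with `T_p` (`coeff_heckeOp`). That the image of a cusp form is again one
(`exists_conj`) is shown by reduction to level one, where Eisenstein series and the discriminant
have rational coefficients. The form `s(τ) = N³ E₄(N τ)` has distinct conjugates under `Γ₀(N) \
SL₂(ℤ)`. By Lagrange interpolation `f · P'(s)`, with `P = ∏ (X - s ∣ q)`, is a polynomial in `s`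
whose coefficients are level one forms, namely polynomials in the coefficients of `P` and the
traces of `f sˡ`. So the action is defined on `f · P'(s)` and on `P'(s)`. The quotient of the
images is integral over the level one forms, hence holomorphic. The same formula shows that
`S₂(N)` embeds into a finite product of spaces of level one forms, hence has finite dimension.

*Multiplicity one* (`eigenforms_le_span`). A cusp form whose Fourier coefficients of index prime
to `N` vanish is an oldform (`mem_oldforms_of_coeff_eq_zero`): removing one prime of the level at
a time, one subtracts oldforms obtained from traces to lower level. Hence an eigenform of the
`T_p` with vanishing first coefficient is old. A nonzero old eigenform forces the same eigenvalues
to occur at a lower level (`exists_eigenforms_ne_bot`, by adjoints of the degeneracy maps). At the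
lowest level where they occur there is an eigenform with first coefficient one. Comparing it with
`G` shows that `G` is old, a contradiction, unless every eigenform with the eigenvalues of `G` is
a multiple of `G`.

*The Hecke algebra.* A double coset operator comes from a finite formal sum of cosets invariant
under `Γ₀(N)`, and conversely such sums come from `𝕋` (`exists_heckeAct_eq`). So the operators of
`𝕋 ⊗ K` are closed under products (`heckeSubalgebra`) and contain polynomials in `T_p` with
coefficients in `K`.
-/

noncomputable section
open scoped MatrixGroups ModularForm Modular TensorProduct
open UpperHalfPlane Matrix.SpecialLinearGroup MeasureTheory
open scoped TensorProduct Polynomial Manifold Topology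
open HeckeProj

namespace HeckeProj

/-! ### Expansions in powers of `q` -/

/-- The function `φ` on the upper half plane is given everywhere by the convergent expansion
`∑ sₙ qⁿ`, where `q = exp (2 π i τ)`. -/
def HasQExp (φ : ℍ → ℂ) (s : PowerSeries ℂ) : Prop :=
  ∀ τ : ℍ, HasSum (fun n : ℕ ↦ s.coeff n * Function.Periodic.qParam 1 τ ^ n) (φ τ)

lemma one_mem_strictPeriods_Γ₀ (N : ℕ) : (1 : ℝ) ∈ (Γ₀ N).strictPeriods := by
  simp [Γ₀, CongruenceSubgroup.strictPeriods_Gamma0]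

section

variable {𝒢 : Subgroup (GL (Fin 2) ℝ)} {k : ℤ} {F : Type*} [FunLike F ℍ ℂ] {φ ψ : ℍ → ℂ}
  {s t : PowerSeries ℂ}

lemma hasQExp_qExpansion [ModularFormClass F 𝒢 k] (h1 : (1 : ℝ) ∈ 𝒢.strictPeriods) (f : F) :
    HasQExp f (qExpansion 1 f) := fun τ ↦
  have : Fact (IsCusp OnePoint.infty 𝒢) := ⟨𝒢.isCusp_of_mem_strictPeriods one_pos h1⟩
  ModularForm.hasSum_qExpansion f one_pos h1 τ

lemma HasQExp.eq_qExpansion [ModularFormClass F 𝒢 k] (h1 : (1 : ℝ) ∈ 𝒢.strictPeriods) {f : F}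
    (h : HasQExp f s) : s = qExpansion 1 f := by
  ext n
  exact ModularFormClass.qExpansion_coeff_unique (c := fun n ↦ s.coeff n) one_pos h1
    (fun τ ↦ by simpa using h τ) n

lemma HasQExp.ext (hφ : HasQExp φ s) (hψ : HasQExp ψ s) : φ = ψ :=
  funext fun τ ↦ (hφ τ).unique (hψ τ)

lemma HasQExp.add (hφ : HasQExp φ s) (hψ : HasQExp ψ t) : HasQExp (φ + ψ) (s + t) := fun τ ↦ by
  simpa [add_mul] using! (hφ τ).add (hψ τ)

lemma HasQExp.smul (c : ℂ) (hφ : HasQExp φ s) : HasQExp (c • φ) (c • s) := fun τ ↦ by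
  simpa [mul_assoc] using! (hφ τ).mul_left c

lemma HasQExp.neg (hφ : HasQExp φ s) : HasQExp (-φ) (-s) := by
  simpa using hφ.smul (-1)

lemma HasQExp.sub (hφ : HasQExp φ s) (hψ : HasQExp ψ t) : HasQExp (φ - ψ) (s - t) := by
  simpa [sub_eq_add_neg] using hφ.add hψ.neg

lemma HasQExp.zero : HasQExp 0 0 := fun τ ↦ by simp [hasSum_zero]

lemma HasQExp.one : HasQExp 1 1 := fun τ ↦ by
  refine (hasSum_ite_eq (0 : ℕ) (1 : ℂ)).congr_fun fun n ↦ ?_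
  by_cases h : n = 0 <;> simp [PowerSeries.coeff_one, h]

lemma HasQExp.mul (hφ : HasQExp φ s) (hψ : HasQExp ψ t) : HasQExp (φ * ψ) (s * t) := fun τ ↦ by
  have h1 := (hφ τ).summable.norm
  have h2 := (hψ τ).summable.norm
  have h := (summable_norm_sum_mul_antidiagonal_of_summable_norm h1 h2).of_norm.hasSum
  rw [← tsum_mul_tsum_eq_tsum_sum_antidiagonal_of_summable_norm h1 h2, (hφ τ).tsum_eq,
    (hψ τ).tsum_eq] at h
  refine h.congr_fun fun n ↦ ?_
  rw [PowerSeries.coeff_mul, Finset.sum_mul]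
  refine Finset.sum_congr rfl fun x hx ↦ ?_
  rw [← Finset.HasAntidiagonal.mem_antidiagonal.mp hx, pow_add]
  ring

lemma HasQExp.pow (hφ : HasQExp φ s) (n : ℕ) : HasQExp (φ ^ n) (s ^ n) := by
  induction n with
  | zero => simpa using HasQExp.one
  | succ n ih => simpa [pow_succ] using ih.mul hφ

end

/-! ### Matrices and the slash action in weight two -/

/-- The invertible real matrix with rows `(a, b)` and `(c, d)`. -/
def glMk (a b c d : ℝ) (h : a * d - b * c ≠ 0) : GL (Fin 2) ℝ :=
  Matrix.GeneralLinearGroup.mkOfDetNeZero !![a, b; c, d] (by simpa using h)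

@[simp] lemma glMk_val (a b c d : ℝ) (h) : (glMk a b c d h).val = !![a, b; c, d] := rfl

lemma mem_Γ₀_iff {N : ℕ} {g : GL (Fin 2) ℝ} :
    g ∈ Γ₀ N ↔ ∃ a b c d : ℤ, a * d - b * c = 1 ∧ (N : ℤ) ∣ c ∧
      g.val = !![(a : ℝ), b; c, d] := by
  constructor
  · rintro ⟨γ, hγ, rfl⟩
    refine ⟨γ 0 0, γ 0 1, γ 1 0, γ 1 1, ?_, ?_, ?_⟩
    · rw [← Matrix.det_fin_two, γ.2]
    · exact (ZMod.intCast_zmod_eq_zero_iff_dvd _ _).mp (CongruenceSubgroup.Gamma0_mem.mp hγ)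
    · ext i j; fin_cases i <;> fin_cases j <;> simp
  · rintro ⟨a, b, c, d, h1, h2, h3⟩
    refine ⟨⟨!![a, b; c, d], by simpa using h1⟩, ?_, ?_⟩
    · exact CongruenceSubgroup.Gamma0_mem.mpr ((ZMod.intCast_zmod_eq_zero_iff_dvd _ _).mpr h2)
    · apply Units.ext
      rw [h3]
      ext i j; fin_cases i <;> fin_cases j <;> rfl

lemma slash_upper (f : ℍ → ℂ) {a b d : ℝ} (ha : 0 < a) (hd : 0 < d) (h) {τ τ' : ℍ}
    (hτ : (τ' : ℂ) = (a * τ + b) / d) : (f ∣[(2 : ℤ)] glMk a b 0 d h) τ = a / d * f τ' := by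
  have hdet : 0 < (glMk a b 0 d h).det.val := by
    rw [Matrix.GeneralLinearGroup.val_det_apply]; simp; positivity
  have : glMk a b 0 d h • τ = τ' := by
    apply UpperHalfPlane.ext
    rw [coe_smul_of_det_pos hdet, hτ]
    simp [num, denom]
  rw [ModularForm.slash_apply, this, σ, if_pos hdet, abs_of_pos hdet,
    Matrix.GeneralLinearGroup.val_det_apply]
  have hd' : (d : ℂ) ≠ 0 := by exact_mod_cast hd.ne'
  simp [denom]
  field_simp

/-! ### Conjugating the Fourier coefficients of level one forms -/

lemma E_qExpansion_map (σ : ℂ →+* ℂ) {k : ℕ} (hk : 3 ≤ k) (hk2 : Even k) :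
    (qExpansion 1 (ModularForm.E hk)).map σ = qExpansion 1 (ModularForm.E hk) := by
  ext m
  rw [PowerSeries.coeff_map, EisensteinSeries.E_qExpansion_coeff hk hk2]
  split_ifs <;> simp [map_ofNat]

lemma discriminant_qExpansion_map (σ : ℂ →+* ℂ) :
    (qExpansion 1 CuspForm.discriminant).map σ = qExpansion 1 CuspForm.discriminant := by
  have h4 := hasQExp_qExpansion one_mem_strictPeriods_SL ModularForm.E₄
  have h6 := hasQExp_qExpansion one_mem_strictPeriods_SL ModularForm.E₆
  have h : HasQExp CuspForm.discriminant ((1728 : ℂ)⁻¹ •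
      (qExpansion 1 ModularForm.E₄ ^ 3 - qExpansion 1 ModularForm.E₆ ^ 2)) := by
    convert ((h4.pow 3).sub (h6.pow 2)).smul (1728 : ℂ)⁻¹ using 1
    ext τ
    have := ModularForm.discriminant_eq_E₄_cube_sub_E₆_sq τ
    simp only [CuspForm.coe_discriminant, Pi.smul_apply, Pi.sub_apply, Pi.pow_apply, smul_eq_mul]
    rw [this]; ring
  rw [← h.eq_qExpansion one_mem_strictPeriods_SL, PowerSeries.smul_eq_C_mul, map_mul, map_sub,
    map_pow, map_pow, E_qExpansion_map σ _ ⟨2, rfl⟩, E_qExpansion_map σ _ ⟨3, rfl⟩,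
    PowerSeries.map_C]
  simp [map_ofNat]

/-- The space of level one forms of a given weight is stable under the action of ring
endomorphisms of `ℂ` on Fourier coefficients: it is spanned by products of Eisenstein series
and powers of the discriminant, which have rational coefficients. -/
lemma exists_levelOne_conj (σ : ℂ →+* ℂ) {k : ℤ} (f : ModularForm 𝒮ℒ k) :
    ∃ f' : ModularForm 𝒮ℒ k, qExpansion 1 f' = (qExpansion 1 f).map σ := by
  obtain ⟨n, hn⟩ : ∃ n : ℕ, k < n := ⟨(k + 1).toNat, by omega⟩
  induction n using Nat.strong_induction_on generalizing k with | _ n ih =>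
  have zero (h : f = 0) : ∃ f' : ModularForm 𝒮ℒ k, qExpansion 1 f' = (qExpansion 1 f).map σ :=
    ⟨0, by simp [h, qExpansion_zero]⟩
  rcases lt_or_ge k 0 with hk0 | hk0
  · exact zero (rank_zero_iff_forall_zero.mp (ModularForm.levelOne_neg_weight_rank_zero hk0) f)
  rcases Int.even_or_odd k with he | ho
  swap
  · exact zero (ModularForm.levelOne_odd_weight_eq_zero ho f)
  lift k to ℕ using hk0
  rcases lt_or_ge k 3 with hk3 | hk3
  · interval_cases k
    · obtain ⟨c, hc⟩ := ModularFormClass.levelOne_weight_zero_const f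
      have key (c : ℂ) : HasQExp (Function.const ℍ c) (PowerSeries.C c) := by
        convert HasQExp.one.smul c using 1
        · ext; simp
        · simp [PowerSeries.smul_eq_C_mul]
      refine ⟨ModularForm.const (σ c), ?_⟩
      have h1 : HasQExp f (PowerSeries.C c) := hc ▸ key c
      have h2 : HasQExp (ModularForm.const (σ c) : ModularForm 𝒮ℒ 0) (PowerSeries.C (σ c)) := key _
      rw [← h1.eq_qExpansion one_mem_strictPeriods_SL, PowerSeries.map_C]
      exact (h2.eq_qExpansion one_mem_strictPeriods_SL).symm
    · simp at he
    · exact zero (rank_zero_iff_forall_zero.mp ModularForm.levelOne_weight_two_rank_zero f)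
  -- Subtract a multiple of `E_k` to reach a cusp form, and divide it by `Δ`.
  have he' : Even k := by exact_mod_cast he
  set a := (qExpansion 1 f).coeff 0
  let g : ModularForm 𝒮ℒ k := f - a • ModularForm.E hk3
  have hg : qExpansion 1 g = qExpansion 1 f - a • qExpansion 1 (ModularForm.E hk3) := by
    refine (HasQExp.eq_qExpansion one_mem_strictPeriods_SL ?_).symm
    exact (hasQExp_qExpansion one_mem_strictPeriods_SL f).sub
      ((hasQExp_qExpansion one_mem_strictPeriods_SL (ModularForm.E hk3)).smul a)
  have hg0 : (qExpansion 1 g).coeff 0 = 0 := by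
    rw [hg, map_sub, PowerSeries.coeff_smul,
      EisensteinSeries.E_qExpansion_coeff_zero hk3 he']
    simp [a]
  obtain ⟨h', hh'⟩ := ih (n - 1) (by omega)
    (CuspForm.discriminantEquiv (ModularForm.toCuspForm g hg0)) (by omega)
  have hΔ := hasQExp_qExpansion one_mem_strictPeriods_SL CuspForm.discriminant
  refine ⟨σ a • ModularForm.E hk3 + (CuspForm.ofMulDiscriminant h' : ModularForm 𝒮ℒ k), ?_⟩
  refine (HasQExp.eq_qExpansion one_mem_strictPeriods_SL (k := (k : ℤ)) ?_).symm
  have hf : qExpansion 1 f = a • qExpansion 1 (ModularForm.E hk3) + qExpansion 1 g := by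
    rw [hg]; abel
  rw [hf, ModularForm.qExpansion_eq_qExpansion_discriminant_mul g hg0, map_add, map_mul, ← hh',
    ← CuspForm.coe_discriminant, discriminant_qExpansion_map, PowerSeries.smul_eq_C_mul, map_mul,
    PowerSeries.map_C, E_qExpansion_map σ hk3 he', ← PowerSeries.smul_eq_C_mul]
  exact ((hasQExp_qExpansion one_mem_strictPeriods_SL (ModularForm.E hk3)).smul (σ a)).add
    (hΔ.mul (hasQExp_qExpansion one_mem_strictPeriods_SL h'))

/-! ### Symmetric functions of the conjugates of a modular form -/

/-- A modular form for a group, viewed as a modular form for a subgroup. -/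
def restrict {𝒢 ℋ : Subgroup (GL (Fin 2) ℝ)} (h : 𝒢 ≤ ℋ) {k : ℤ} (f : ModularForm ℋ k) :
    ModularForm 𝒢 k where
  toFun := f
  slash_action_eq' γ hγ := f.slash_action_eq' γ (h hγ)
  holo' := f.holo'
  bdd_at_cusps' hc := f.bdd_at_cusps' (hc.mono h)

lemma Γ₀_le_SL (N : ℕ) : Γ₀ N ≤ 𝒮ℒ := by
  rintro _ ⟨γ, -, rfl⟩
  exact ⟨γ, rfl⟩

/-- The function `φ` is a level one modular form of weight `k`. -/
def IsLevelOne (k : ℤ) (φ : ℍ → ℂ) : Prop := ∃ f : ModularForm 𝒮ℒ k, ⇑f = φ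

lemma IsLevelOne.add {k : ℤ} {φ ψ : ℍ → ℂ} (hφ : IsLevelOne k φ) (hψ : IsLevelOne k ψ) :
    IsLevelOne k (φ + ψ) := by
  obtain ⟨f, rfl⟩ := hφ; obtain ⟨g, rfl⟩ := hψ
  exact ⟨f + g, rfl⟩

lemma IsLevelOne.smul {k : ℤ} {φ : ℍ → ℂ} (c : ℂ) (hφ : IsLevelOne k φ) :
    IsLevelOne k (c • φ) := by
  obtain ⟨f, rfl⟩ := hφ
  exact ⟨c • f, rfl⟩

lemma IsLevelOne.sum {k : ℤ} {ι : Type*} (S : Finset ι) {φ : ι → ℍ → ℂ}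
    (h : ∀ i ∈ S, IsLevelOne k (φ i)) : IsLevelOne k (∑ i ∈ S, φ i) := by
  classical
  induction S using Finset.induction_on with
  | empty => exact ⟨0, by simp⟩
  | insert i S hi ih =>
    rw [Finset.sum_insert hi]
    exact (h i (by simp)).add (ih fun j hj ↦ h j (by simp [hj]))

lemma IsLevelOne.mul {k l m : ℤ} {φ ψ : ℍ → ℂ} (hφ : IsLevelOne k φ) (hψ : IsLevelOne l ψ)
    (h : k + l = m) : IsLevelOne m (φ * ψ) := by
  subst h
  obtain ⟨f, rfl⟩ := hφ; obtain ⟨g, rfl⟩ := hψ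
  exact ⟨f.mul g, rfl⟩

variable {N : ℕ}

/-- The cosets of `Γ₀(N)` in `SL₂(ℤ)`, which index the conjugates of a modular form. -/
abbrev Cosets (N : ℕ) : Type := 𝒮ℒ ⧸ (Γ₀ N).subgroupOf 𝒮ℒ

instance [NeZero N] : Fintype (Cosets N) := Fintype.ofFinite _

/-- The conjugate of a modular form for `Γ₀(N)` under a coset of `Γ₀(N)` in `SL₂(ℤ)`. -/
def conj {k : ℤ} (f : ModularForm (Γ₀ N) k) (q : Cosets N) : ℍ → ℂ :=
  SlashInvariantForm.quotientFunc (ℋ := 𝒮ℒ) f q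

lemma conj_mk {k : ℤ} (f : ModularForm (Γ₀ N) k) (h : 𝒮ℒ) :
    conj f (QuotientGroup.mk h) = (f : ℍ → ℂ) ∣[k] h.val⁻¹ := rfl

lemma conj_one {k : ℤ} (f : ModularForm (Γ₀ N) k) : conj f (QuotientGroup.mk 1) = f := by
  simp [conj_mk]

lemma conj_mul {k l : ℤ} (f : ModularForm (Γ₀ N) k) (g : ModularForm (Γ₀ N) l) (q : Cosets N) :
    conj (f.mul g) q = conj f q * conj g q := by
  induction q using Quotient.inductionOn with | _ h => ?_
  have := Subgroup.HasDetPlusMinusOne.abs_det (inv_mem h.2)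
  exact (ModularForm.mul_slash _ _ _ _ _).trans (by rw [this, one_smul]; rfl)

lemma pow_slash {k : ℤ} (φ : ℍ → ℂ) (n : ℕ) {g : GL (Fin 2) ℝ} (hg : |g.det.val| = 1)
    (hg' : 0 < g.det.val) : (φ ^ n) ∣[n * k] g = (φ ∣[k] g) ^ n := by
  induction n with
  | zero =>
    have : g.det.val = 1 := by rwa [abs_of_pos hg'] at hg
    ext τ
    simp [ModularForm.slash_apply, σ, this]
  | succ n ih =>
    have := ModularForm.mul_slash (n * k) k g (φ ^ n) φ
    rw [hg, one_smul, ih] at this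
    rw [pow_succ, pow_succ, ← this]
    congr 1
    push_cast; ring

lemma det_of_mem_SL {g : GL (Fin 2) ℝ} (hg : g ∈ 𝒮ℒ) : g.det.val = 1 := by
  obtain ⟨γ, rfl⟩ := hg
  simp

lemma conj_pow {k : ℤ} (f : ModularForm (Γ₀ N) k) (n : ℕ) (q : Cosets N) :
    conj (f.pow n) q = conj f q ^ n := by
  induction q using Quotient.inductionOn with | _ h => ?_
  have hdet := det_of_mem_SL (inv_mem h.2)
  change (⇑(f.pow n)) ∣[(n * k : ℤ)] h.val⁻¹ = ((f : ℍ → ℂ) ∣[k] h.val⁻¹) ^ n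
  rw [ModularForm.coe_pow, pow_slash _ _ (by rw [hdet, abs_one]) (by rw [hdet]; exact one_pos)]

lemma isLevelOne_sum_conj [NeZero N] {k : ℤ} (f : ModularForm (Γ₀ N) k) :
    IsLevelOne k (∑ q, conj f q) := by
  refine ⟨ModularForm.trace 𝒮ℒ f, ?_⟩
  rw [ModularForm.coe_trace]
  rfl

lemma mdifferentiable_conj {k : ℤ} (f : ModularForm (Γ₀ N) k) (q : Cosets N) :
    MDiff (conj f q) := by
  induction q using Quotient.inductionOn with | _ h => ?_
  exact (ModularForm.translate f h.val⁻¹).holo'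

lemma isLevelOne_psum [NeZero N] {k : ℤ} (f : ModularForm (Γ₀ N) k) (n : ℕ) :
    IsLevelOne (n * k) (fun τ ↦ MvPolynomial.aeval (fun q ↦ conj f q τ)
      (MvPolynomial.psum (Cosets N) ℂ n)) := by
  convert isLevelOne_sum_conj (f.pow n) using 1
  ext τ
  simp [MvPolynomial.psum, conj_pow]

lemma isLevelOne_const (c : ℂ) : IsLevelOne 0 (fun _ ↦ c) := ⟨ModularForm.const c, rfl⟩

/-- The elementary symmetric functions of the conjugates of a modular form for `Γ₀(N)` are level
one modular forms: by Newton's identities they are polynomials in the power sums, which are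
traces. -/
lemma isLevelOne_esymm [NeZero N] {k : ℤ} (f : ModularForm (Γ₀ N) k) (n : ℕ) :
    IsLevelOne (n * k) (fun τ ↦ MvPolynomial.aeval (fun q ↦ conj f q τ)
      (MvPolynomial.esymm (Cosets N) ℂ n)) := by
  induction n using Nat.strong_induction_on with | _ n ih =>
  rcases n.eq_zero_or_pos with rfl | hn
  · simpa using isLevelOne_const 1
  have hn' : (n : ℂ) ≠ 0 := by exact_mod_cast hn.ne'
  have key : IsLevelOne (n * k) (∑ a ∈ Finset.HasAntidiagonal.antidiagonal n with a.1 < n,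
      ((n : ℂ)⁻¹ * (-1) ^ (n + 1) * (-1) ^ a.1) •
      ((fun τ ↦ MvPolynomial.aeval (fun q ↦ conj f q τ)
        (MvPolynomial.esymm (Cosets N) ℂ a.1)) *
      (fun τ ↦ MvPolynomial.aeval (fun q ↦ conj f q τ)
        (MvPolynomial.psum (Cosets N) ℂ a.2)))) := by
    refine IsLevelOne.sum _ fun a ha ↦ ?_
    rw [Finset.mem_filter, Finset.HasAntidiagonal.mem_antidiagonal] at ha
    refine ((ih a.1 ha.2).mul (isLevelOne_psum f a.2) ?_).smul _
    rw [← ha.1]; push_cast; ring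
  convert key using 1
  ext τ
  have := congr_arg (MvPolynomial.aeval (fun q ↦ conj f q τ))
    (MvPolynomial.mul_esymm_eq_sum (Cosets N) ℂ n)
  rw [map_mul, map_mul, map_sum, map_natCast] at this
  rw [Finset.sum_apply, ← mul_right_inj' hn', this, Finset.mul_sum, Finset.mul_sum]
  refine Finset.sum_congr rfl fun a _ ↦ ?_
  simp
  field_simp

/-- The polynomial whose roots are the values at `τ` of the conjugates of `f`. -/
def conjPoly [NeZero N] {k : ℤ} (f : ModularForm (Γ₀ N) k) (τ : ℍ) : ℂ[X] :=
  ∏ q, (Polynomial.X - Polynomial.C (conj f q τ))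

lemma natDegree_conjPoly [NeZero N] {k : ℤ} (f : ModularForm (Γ₀ N) k) (τ : ℍ) :
    (conjPoly f τ).natDegree = Fintype.card (Cosets N) := by
  simp [conjPoly]

lemma conjPoly_monic [NeZero N] {k : ℤ} (f : ModularForm (Γ₀ N) k) (τ : ℍ) :
    (conjPoly f τ).Monic := Polynomial.monic_prod_X_sub_C _ _

lemma conjPoly_eval [NeZero N] {k : ℤ} (f : ModularForm (Γ₀ N) k) (τ : ℍ) :
    (conjPoly f τ).eval (f τ) = 0 := by
  rw [conjPoly, Polynomial.eval_prod]
  refine Finset.prod_eq_zero (Finset.mem_univ (QuotientGroup.mk 1)) ?_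
  simp [conj_one]

lemma isLevelOne_coeff_conjPoly [NeZero N] {k : ℤ} (f : ModularForm (Γ₀ N) k) {j : ℕ}
    (hj : j ≤ Fintype.card (Cosets N)) :
    IsLevelOne ((Fintype.card (Cosets N) - j : ℕ) * k) (fun τ ↦ (conjPoly f τ).coeff j) := by
  convert (isLevelOne_esymm f (Fintype.card (Cosets N) - j)).smul
    ((-1) ^ (Fintype.card (Cosets N) - j)) using 1
  ext τ
  have := Multiset.prod_X_sub_C_coeff (Finset.univ.val.map fun q ↦ conj f q τ) (k := j)
    (by simpa using hj)
  rw [Multiset.map_map] at this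
  simp only [Multiset.card_map] at this
  rw [Pi.smul_apply, MvPolynomial.aeval_esymm_eq_multiset_esymm]
  exact this

/-- Lagrange interpolation: the value `y q₀` times the derivative of `P = ∏ (X - x q)` at `x q₀` is
a polynomial expression in `x q₀`, whose coefficients are polynomials in the coefficients of `P`
and the sums `∑ y q (x q)ˡ`. -/
lemma mul_derivative_eval {ι : Type*} [Fintype ι] (x y : ι → ℂ) (q₀ : ι) (P : ℂ[X])
    (hP : P = ∏ q, (Polynomial.X - Polynomial.C (x q))) :
    y q₀ * P.derivative.eval (x q₀) = ∑ j ∈ Finset.range (P.natDegree + 1),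
      ∑ i ∈ Finset.range j, P.coeff j * (∑ q, y q * x q ^ (j - 1 - i)) * x q₀ ^ i := by
  classical
  have root (q : ι) : P.eval (x q) = 0 := by
    rw [hP, Polynomial.eval_prod]
    exact Finset.prod_eq_zero (Finset.mem_univ q) (by simp)
  -- `(P(x q₀) - P(x q)) / (x q₀ - x q)` vanishes for `x q ≠ x q₀`; when `x q = x q₀` it stands for
  -- `P'(x q₀)`, which vanishes if `q ≠ q₀`, since `x q₀` is then a double root.
  have key (q : ι) : (∑ j ∈ Finset.range (P.natDegree + 1), P.coeff j *
      ∑ i ∈ Finset.range j, x q₀ ^ i * x q ^ (j - 1 - i)) =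
      if q = q₀ then P.derivative.eval (x q₀) else 0 := by
    rcases eq_or_ne (x q₀) (x q) with h | h
    · have : (∑ j ∈ Finset.range (P.natDegree + 1), P.coeff j *
          ∑ i ∈ Finset.range j, x q₀ ^ i * x q ^ (j - 1 - i)) =
          P.derivative.eval (x q₀) := by
        rw [Polynomial.derivative_eval, Polynomial.sum_over_range _ (by simp)]
        refine Finset.sum_congr rfl fun j _ ↦ ?_
        rw [← h, mul_assoc]
        congr 1
        rw [Finset.sum_congr rfl (g := fun _ ↦ x q₀ ^ (j - 1))]
        · simp
        · intro i hi
          rw [← pow_add]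
          congr 1
          have := Finset.mem_range.mp hi
          omega
      rw [this]
      split_ifs with hq
      · rfl
      · rw [hP, Polynomial.derivative_prod_finset, Polynomial.eval_finsetSum]
        refine Finset.sum_eq_zero fun i _ ↦ ?_
        rw [Polynomial.eval_mul, Polynomial.eval_prod]
        rcases eq_or_ne q₀ i with rfl | hi
        · rw [Finset.prod_eq_zero (i := q) (by simp [hq]) (by simp [h]), zero_mul]
        · rw [Finset.prod_eq_zero (i := q₀) (by simp [hi]) (by simp), zero_mul]
    · rw [if_neg (fun hq ↦ h (by rw [hq]))]
      rw [← mul_left_inj' (sub_ne_zero.mpr h), zero_mul, Finset.sum_mul]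
      calc _ = ∑ j ∈ Finset.range (P.natDegree + 1),
              (P.coeff j * x q₀ ^ j - P.coeff j * x q ^ j) := by
            refine Finset.sum_congr rfl fun j _ ↦ ?_
            rw [mul_assoc, geom_sum₂_mul, mul_sub]
        _ = 0 := by
          rw [Finset.sum_sub_distrib, ← Polynomial.eval_eq_sum_range,
            ← Polynomial.eval_eq_sum_range, root, root, sub_zero]
  have : ∑ q, y q * (∑ j ∈ Finset.range (P.natDegree + 1), P.coeff j *
      ∑ i ∈ Finset.range j, x q₀ ^ i * x q ^ (j - 1 - i)) =
      y q₀ * P.derivative.eval (x q₀) := by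
    simp [key]
  rw [← this]
  simp_rw [Finset.mul_sum, Finset.sum_mul]
  rw [Finset.sum_comm]
  refine Finset.sum_congr rfl fun j _ ↦ ?_
  rw [Finset.sum_comm]
  refine Finset.sum_congr rfl fun j _ ↦ Finset.sum_congr rfl fun q _ ↦ ?_
  ring

/-! ### Quotients of holomorphic functions -/

lemma norm_pow_le_of_root {n : ℕ} (a : ℕ → ℂ) (y : ℂ) {C : ℝ}
    (ha : ∀ j < n, ‖a j‖ ≤ C) (h : y ^ n + ∑ j ∈ Finset.range n, a j * y ^ j = 0) :
    ‖y‖ ^ n ≤ n * C * max 1 ‖y‖ ^ (n - 1) := by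
  rw [← norm_pow, eq_neg_of_add_eq_zero_left h, norm_neg]
  refine (norm_sum_le _ _).trans ?_
  calc ∑ j ∈ Finset.range n, ‖a j * y ^ j‖
      ≤ ∑ j ∈ Finset.range n, C * max 1 ‖y‖ ^ (n - 1) := by
        refine Finset.sum_le_sum fun j hj ↦ ?_
        have hj := Finset.mem_range.mp hj
        rw [norm_mul, norm_pow]
        refine mul_le_mul (ha j hj) ?_ (by positivity) ((norm_nonneg _).trans (ha j hj))
        calc ‖y‖ ^ j ≤ max 1 ‖y‖ ^ j := by gcongr; exact le_max_right _ _
          _ ≤ _ := pow_le_pow_right₀ (le_max_left _ _) (by omega)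
    _ = _ := by simp [mul_assoc]

lemma norm_le_of_root {n : ℕ} (hn : n ≠ 0) (a : ℕ → ℂ) (y : ℂ) {C : ℝ}
    (ha : ∀ j < n, ‖a j‖ ≤ C) (h : y ^ n + ∑ j ∈ Finset.range n, a j * y ^ j = 0) :
    ‖y‖ ≤ max 1 (n * C) := by
  have := norm_pow_le_of_root a y ha h
  rcases le_total ‖y‖ 1 with h1 | h1
  · exact h1.trans (le_max_left _ _)
  · rw [max_eq_right h1] at this
    refine le_trans ?_ (le_max_right _ _)
    obtain ⟨m, rfl⟩ := Nat.exists_eq_succ_of_ne_zero hn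
    rw [pow_succ', Nat.succ_eq_add_one, Nat.add_sub_cancel] at this
    exact le_of_mul_le_mul_right this (by positivity)

lemma norm_pow_le_of_root_of_lt_one {n : ℕ} (hn : n ≠ 0) (a : ℕ → ℂ) (y : ℂ) {C : ℝ}
    (ha : ∀ j < n, ‖a j‖ ≤ C) (h : y ^ n + ∑ j ∈ Finset.range n, a j * y ^ j = 0)
    (hC : n * C ≤ 1) : ‖y‖ ^ n ≤ n * C := by
  have h1 := norm_le_of_root hn a y ha h
  rw [max_eq_left hC] at h1
  have := norm_pow_le_of_root a y ha h
  rwa [max_eq_left h1, one_pow, mul_one] at this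

/-- A locally bounded quotient of holomorphic functions is holomorphic. -/
lemma exists_quotient_of_bounded {U : Set ℂ} (hU : IsOpen U) {H D : ℂ → ℂ}
    (hH : DifferentiableOn ℂ H U) (hD : DifferentiableOn ℂ D U)
    (hD0 : ∀ z ∈ U, ∀ᶠ w in 𝓝[≠] z, D w ≠ 0)
    (hb : ∀ z ∈ U, ∃ C, ∀ᶠ w in 𝓝[≠] z, ‖H w / D w‖ ≤ C) :
    ∃ F : ℂ → ℂ, DifferentiableOn ℂ F U ∧ ∀ z ∈ U, H z = F z * D z := by
  set R : ℂ → ℂ := fun w ↦ H w / D w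
  -- the limits remove the singularities of the quotient, by Riemann's theorem
  set F : ℂ → ℂ := fun z ↦ Filter.limUnder (𝓝[≠] z) R
  have key : ∀ z ∈ U, DifferentiableAt ℂ F z ∧ ∀ᶠ w in 𝓝[≠] z, F w = R w := by
    intro z hz
    obtain ⟨C, hC⟩ := hb z hz
    have h1 := (hD0 z hz).and (hC.and (eventually_nhdsWithin_of_eventually_nhds (hU.mem_nhds hz)))
    obtain ⟨s, hs, hso, hzs⟩ := eventually_nhds_iff.mp (eventually_nhdsWithin_iff.mp h1)
    have hR : ∀ w ∈ s \ {z}, DifferentiableAt ℂ R w := fun w hw ↦ by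
      have := hs w hw.1 hw.2
      exact (hH.differentiableAt (hU.mem_nhds this.2.2)).div
        (hD.differentiableAt (hU.mem_nhds this.2.2)) this.1
    have h2 := Complex.differentiableOn_update_limUnder_of_bddAbove (hso.mem_nhds hzs) (f := R)
      (fun w hw ↦ (hR w hw).differentiableWithinAt)
      ⟨C, by rintro _ ⟨w, hw, rfl⟩; exact (hs w hw.1 hw.2).2.1⟩
    have h3 : ∀ w ∈ s, F w = Function.update R z (Filter.limUnder (𝓝[≠] z) R) w := by
      intro w hw
      rcases eq_or_ne w z with rfl | hwz
      · simp [F]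
      · rw [Function.update_of_ne hwz]
        exact ((hR w ⟨hw, hwz⟩).continuousAt.tendsto.mono_left nhdsWithin_le_nhds).limUnder_eq
    refine ⟨?_, ?_⟩
    · exact (h2.differentiableAt (hso.mem_nhds hzs)).congr_of_eventuallyEq
        (Filter.eventually_of_mem (hso.mem_nhds hzs) h3)
    · rw [eventually_nhdsWithin_iff]
      filter_upwards [hso.mem_nhds hzs] with w hw hwz
      rw [h3 w hw, Function.update_of_ne hwz]
  refine ⟨F, fun z hz ↦ (key z hz).1.differentiableWithinAt, fun z hz ↦ ?_⟩
  have h1 : Filter.Tendsto H (𝓝[≠] z) (𝓝 (H z)) :=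
    ((hH.differentiableAt (hU.mem_nhds hz)).continuousAt.tendsto).mono_left nhdsWithin_le_nhds
  have h2 : Filter.Tendsto (fun w ↦ F w * D w) (𝓝[≠] z) (𝓝 (F z * D z)) :=
    (((key z hz).1.continuousAt.mul
      (hD.differentiableAt (hU.mem_nhds hz)).continuousAt).tendsto).mono_left nhdsWithin_le_nhds
  refine tendsto_nhds_unique h1 (h2.congr' ?_)
  filter_upwards [(key z hz).2, hD0 z hz] with w hw hw'
  rw [hw, div_mul_cancel₀ _ hw']

/-- If `H / D` satisfies a monic equation with holomorphic coefficients, it is holomorphic. -/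
lemma exists_quotient_of_root {n : ℕ} (hn : n ≠ 0) {H D : ℍ → ℂ} (a : ℕ → ℍ → ℂ)
    (hH : MDiff H) (hD : MDiff D) (hD0 : D ≠ 0) (ha : ∀ j < n, MDiff (a j))
    (h : ∀ τ, H τ ^ n + ∑ j ∈ Finset.range n, a j τ * H τ ^ j * D τ ^ (n - j) = 0) :
    ∃ F : ℍ → ℂ, MDiff F ∧ H = F * D := by
  -- the zeros of `D` are isolated
  have hD0' (τ : ℍ) : ∀ᶠ w in 𝓝[≠] (τ : ℂ), D (ofComplex w) ≠ 0 := by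
    have : ∀ᶠ w in 𝓝[≠] τ, D w ≠ 0 := by
      by_contra h
      exact hD0 (eq_zero_of_frequently hD (τ := τ) (fun h' ↦ h h'))
    rw [eventually_nhdsWithin_iff] at this ⊢
    rw [← isOpenEmbedding_coe.map_nhds_eq, Filter.eventually_map]
    filter_upwards [this] with w hw hw'
    rw [ofComplex_apply]
    exact hw fun h ↦ hw' (by rw [h]; rfl)
  obtain ⟨F, hF1, hF2⟩ := exists_quotient_of_bounded isOpen_upperHalfPlaneSet
    (UpperHalfPlane.mdifferentiable_iff.mp hH) (UpperHalfPlane.mdifferentiable_iff.mp hD)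
    (fun z hz ↦ hD0' ⟨z, hz⟩) (fun z hz ↦ by
      have hc (j : ℕ) (hj : j < n) : ∃ C, ∀ᶠ w in 𝓝 z, ‖a j (ofComplex w)‖ ≤ C := by
        have := ((UpperHalfPlane.mdifferentiable_iff.mp (ha j hj)).differentiableAt
          (isOpen_upperHalfPlaneSet.mem_nhds hz)).continuousAt.norm
        exact ⟨_, (this.eventually_lt continuousAt_const (lt_add_one _)).mono fun _ h ↦ h.le⟩
      choose! C hC using hc
      refine ⟨max 1 (n * ∑ j ∈ Finset.range n, |C j|), ?_⟩
      have hC' := eventually_nhdsWithin_of_eventually_nhds (s := {z}ᶜ)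
        ((Filter.eventually_all_finset (Finset.range n)).mpr
        fun j hj ↦ hC j (Finset.mem_range.mp hj))
      filter_upwards [hC', hD0' ⟨z, hz⟩] with w hw hw'
      -- `H / D` is a root of a monic equation with bounded coefficients
      refine norm_le_of_root hn (fun j ↦ a j (ofComplex w)) _ (fun j hj ↦ ?_) ?_
      · refine (hw j (Finset.mem_range.mpr hj)).trans ((le_abs_self _).trans ?_)
        exact Finset.single_le_sum (f := fun j ↦ |C j|) (fun _ _ ↦ abs_nonneg _)
          (Finset.mem_range.mpr hj)
      · have h0 := h (ofComplex w)
        rw [← mul_left_inj' (pow_ne_zero n hw'), zero_mul, ← h0, add_mul, Finset.sum_mul]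
        simp only [Function.comp_apply, div_pow]
        congr 1
        · field_simp
        · refine Finset.sum_congr rfl fun j hj ↦ ?_
          have := (Finset.mem_range.mp hj)
          obtain ⟨m, rfl⟩ := Nat.exists_eq_add_of_le this.le
          rw [Nat.add_sub_cancel_left, pow_add]
          field_simp)
  refine ⟨fun τ ↦ F τ, UpperHalfPlane.mdifferentiable_iff.mpr (hF1.congr fun z hz ↦ ?_), ?_⟩
  · simp [ofComplex_apply_of_im_pos hz]
  · ext τ
    simpa using hF2 τ τ.2

/-! ### A modular form for `Γ₀(N)` with distinct conjugates -/

lemma tendsto_atImInfty {𝒢 : Subgroup (GL (Fin 2) ℝ)} {k : ℤ} {F : Type*} [FunLike F ℍ ℂ]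
    [ModularFormClass F 𝒢 k] (h1 : (1 : ℝ) ∈ 𝒢.strictPeriods) (f : F) :
    Filter.Tendsto f atImInfty (𝓝 ((qExpansion 1 f).coeff 0)) := by
  have : Fact (IsCusp OnePoint.infty 𝒢) := ⟨𝒢.isCusp_of_mem_strictPeriods one_pos h1⟩
  have hper := SlashInvariantFormClass.periodic_comp_ofComplex f h1
  have han := analyticAt_cuspFunction_zero one_pos hper (ModularFormClass.holo f)
    (ModularFormClass.bdd_at_infty f)
  have h := han.continuousAt.tendsto.comp (qParam_tendsto_atImInfty one_pos)
  rw [qExpansion_coeff_zero one_pos han hper, ← cuspFunction_apply_zero one_pos han hper]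
  refine h.congr fun τ ↦ ?_
  simpa using eq_cuspFunction τ one_ne_zero hper

/-- The point `(a τ + b) / d` of the upper half plane. -/
lemma exists_affine (τ : ℍ) {a d : ℝ} (ha : 0 < a) (hd : 0 < d) (b : ℝ) :
    ∃ τ' : ℍ, (τ' : ℂ) = (a * τ + b) / d ∧ τ'.im = a * τ.im / d := by
  have him : ((a * (τ : ℂ) + b) / d).im = a * τ.im / d := by
    rw [Complex.div_ofReal_im]; simp
  refine ⟨⟨(a * τ + b) / d, ?_⟩, rfl, him⟩
  rw [him]
  have := τ.im_pos
  positivity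

lemma slash_upper_weight (f : ℍ → ℂ) (k : ℤ) {a b d : ℝ} (ha : 0 < a) (hd : 0 < d) (h)
    {τ τ' : ℍ} (hτ : (τ' : ℂ) = (a * τ + b) / d) :
    (f ∣[k] glMk a b 0 d h) τ = (a * d) ^ (k - 1) * d ^ (-k) * f τ' := by
  have hdet : 0 < (glMk a b 0 d h).det.val := by
    rw [Matrix.GeneralLinearGroup.val_det_apply]; simp; positivity
  have : glMk a b 0 d h • τ = τ' := by
    apply UpperHalfPlane.ext
    rw [coe_smul_of_det_pos hdet, hτ]
    simp [num, denom]
  rw [ModularForm.slash_apply, this, σ, if_pos hdet, abs_of_pos hdet,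
    Matrix.GeneralLinearGroup.val_det_apply]
  simp [denom]
  ring

/-- The substitution `q ↦ q ^ d` in a power series. -/
def dilate (d : ℕ) (s : PowerSeries ℂ) : PowerSeries ℂ :=
  PowerSeries.mk fun n ↦ if d ∣ n then s.coeff (n / d) else 0

lemma HasQExp.dilate {φ ψ : ℍ → ℂ} {s : PowerSeries ℂ} (h : HasQExp φ s) {d : ℕ} (hd : 0 < d)
    (hψ : ∀ τ τ' : ℍ, (τ' : ℂ) = d * τ → ψ τ = φ τ') : HasQExp ψ (dilate d s) := by
  intro τ
  obtain ⟨τ', h1, -⟩ := exists_affine τ (a := d) (d := 1) (by positivity) one_pos 0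
  have h1 : (τ' : ℂ) = d * τ := by simpa using h1
  rw [hψ τ τ' h1]
  have hinj : Function.Injective (fun n : ℕ ↦ d * n) := fun m n h ↦ Nat.eq_of_mul_eq_mul_left hd h
  rw [← hinj.hasSum_iff]
  · refine (h τ').congr_fun fun n ↦ ?_
    simp only [Function.comp_apply, HeckeProj.dilate, PowerSeries.coeff_mk, dvd_mul_right, if_true,
      Nat.mul_div_cancel_left _ hd, Function.Periodic.qParam, h1]
    rw [← Complex.exp_nat_mul, ← Complex.exp_nat_mul]
    congr 2
    push_cast; ring
  · intro n hn
    have : ¬ d ∣ n := fun ⟨m, hm⟩ ↦ hn ⟨m, hm.symm⟩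
    simp [HeckeProj.dilate, this]

lemma dilate_map (σ : ℂ →+* ℂ) (d : ℕ) (s : PowerSeries ℂ) :
    (dilate d s).map σ = dilate d (s.map σ) := by
  ext n
  simp only [PowerSeries.coeff_map, dilate, PowerSeries.coeff_mk]
  split_ifs <;> simp

section

variable {N : ℕ} [NeZero N]

lemma natCast_pos_of_neZero (N : ℕ) [NeZero N] : (0 : ℝ) < N := by
  exact_mod_cast Nat.pos_of_ne_zero (NeZero.ne N)

/-- The matrix `diag(N, 1)`. -/
def diagN (N : ℕ) [NeZero N] : GL (Fin 2) ℝ :=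
  glMk N 0 0 1 (by simpa using NeZero.ne N)

lemma diagN_conj_val {a b c d : ℝ} {β : GL (Fin 2) ℝ} (hβ : β.val = !![a, b; c, d]) :
    (diagN N * β * (diagN N)⁻¹).val = !![a, N * b; c / N, d] := by
  have hN := (natCast_pos_of_neZero N).ne'
  have : (diagN N)⁻¹ = glMk (N : ℝ)⁻¹ 0 0 1 (by simpa using NeZero.ne N) := by
    rw [inv_eq_iff_mul_eq_one]
    apply Units.ext
    ext i j; fin_cases i <;> fin_cases j <;> simp [diagN, hN]
  rw [this]
  ext i j; fin_cases i <;> fin_cases j <;> simp [diagN, hβ] <;> field_simp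

lemma mapGL_mk_val {a b c d : ℤ} (h) : (mapGL ℝ (⟨!![a, b; c, d], h⟩ : SL(2, ℤ))).val =
    !![(a : ℝ), b; c, d] := by
  ext i j; fin_cases i <;> fin_cases j <;> rfl

open ConjAct Pointwise in
/-- The modular form `N³ E₄(N τ)` for `Γ₀(N)`. -/
def sepForm (N : ℕ) [NeZero N] : ModularForm (Γ₀ N) 4 :=
  restrict (ℋ := toConjAct (diagN N)⁻¹ • 𝒮ℒ) (by
    intro γ hγ
    obtain ⟨a, b, c, d, h1, ⟨e, rfl⟩, h⟩ := mem_Γ₀_iff.mp hγ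
    have hN := (natCast_pos_of_neZero N).ne'
    rw [map_inv, Subgroup.mem_inv_pointwise_smul_iff, toConjAct_smul]
    refine ⟨⟨!![a, N * b; e, d], by rw [Matrix.det_fin_two_of]; linarith⟩, ?_⟩
    apply Units.ext
    rw [diagN_conj_val h]
    rw [mapGL_mk_val]
    ext i j; fin_cases i <;> fin_cases j <;> simp [hN])
    (ModularForm.translate ModularForm.E₄ (diagN N))

lemma coe_sepForm : (sepForm N : ℍ → ℂ) = (ModularForm.E₄ : ℍ → ℂ) ∣[(4 : ℤ)] diagN N := rfl

lemma sepForm_qExp : HasQExp (sepForm N)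
    (((N : ℂ) ^ 3) • dilate N (qExpansion 1 ModularForm.E₄)) := by
  have hN := natCast_pos_of_neZero N
  have hN' : (N : ℂ) ≠ 0 := by exact_mod_cast hN.ne'
  have key := ((hasQExp_qExpansion one_mem_strictPeriods_SL ModularForm.E₄).dilate
    (Nat.pos_of_ne_zero (NeZero.ne N)) (ψ := ((N : ℂ) ^ 3)⁻¹ • ⇑(sepForm N)) ?_).smul ((N : ℂ) ^ 3)
  · rwa [smul_smul, mul_inv_cancel₀ (pow_ne_zero 3 hN'), one_smul] at key
  · intro τ τ' h
    rw [Pi.smul_apply, coe_sepForm, diagN, slash_upper_weight (τ' := τ') _ _ hN one_pos]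
    · simp
      norm_cast
      field_simp
    · simpa using h

/-- If `E₄(N τ)` is invariant under `β ∈ SL₂(ℤ)`, then `β ∈ Γ₀(N)`: the value at `i ∞` of `E₄ ∣ γ`,
for a rational matrix `γ` of determinant one, determines `γ` up to `SL₂(ℤ)` and translations. -/
lemma mem_Γ₀_of_slash_sepForm {β : GL (Fin 2) ℝ} (hβ : β ∈ 𝒮ℒ)
    (h : (sepForm N : ℍ → ℂ) ∣[(4 : ℤ)] β = sepForm N) : β ∈ Γ₀ N := by
  have hN := natCast_pos_of_neZero N
  obtain ⟨γ, rfl⟩ := hβ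
  set a := γ 0 0; set b := γ 0 1; set c := γ 1 0; set d := γ 1 1
  have hdet : a * d - b * c = 1 := by rw [← Matrix.det_fin_two, γ.2]
  have hval : (mapGL ℝ γ).val = !![(a : ℝ), b; c, d] := by
    ext i j; fin_cases i <;> fin_cases j <;> simp [a, b, c, d]
  -- `A = diag(N, 1) β diag(N, 1)⁻¹` fixes `E₄`.
  set A := diagN N * mapGL ℝ γ * (diagN N)⁻¹
  have hA : A.val = !![(a : ℝ), N * b; c / N, d] := diagN_conj_val hval
  have hEA : (ModularForm.E₄ : ℍ → ℂ) ∣[(4 : ℤ)] A = ModularForm.E₄ := by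
    rw [coe_sepForm] at h
    rw [SlashAction.slash_mul, SlashAction.slash_mul, h, ← SlashAction.slash_mul, mul_inv_cancel,
      SlashAction.slash_one]
  -- `A = δ u` with `δ ∈ SL₂(ℤ)`, whose first column is that of `A` made primitive, and `u` upper
  -- triangular with diagonal `(g / N, N / g)`.
  set g : ℤ := ((Int.gcd (N * a) c : ℕ) : ℤ) with hgdef
  have hg : 0 < g := by
    have : g ≠ 0 := by
      intro h0
      rw [hgdef, Int.natCast_eq_zero, Int.gcd_eq_zero_iff] at h0
      obtain ⟨h1, h2⟩ := h0
      have : a = 0 := by simpa [NeZero.ne N] using h1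
      rw [this, h2] at hdet
      simp at hdet
    positivity
  obtain ⟨x, hx⟩ : g ∣ N * a := Int.gcd_dvd_left _ _
  obtain ⟨z, hz⟩ : g ∣ c := Int.gcd_dvd_right _ _
  obtain ⟨u, v, huv⟩ : ∃ u v : ℤ, x * u + z * v = 1 := by
    have := Int.gcd_eq_gcd_ab (N * a) c
    refine ⟨Int.gcdA (N * a) c, Int.gcdB (N * a) c, ?_⟩
    have h2 : g * 1 = g * (x * Int.gcdA (N * a) c + z * Int.gcdB (N * a) c) := by
      rw [mul_one, mul_add, ← mul_assoc, ← mul_assoc, ← hx, ← hz]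
      exact this
    exact (mul_left_cancel₀ hg.ne' h2).symm
  let δ : SL(2, ℤ) := ⟨!![x, -v; z, u], by rw [Matrix.det_fin_two_of]; linarith⟩
  have hgR : (0 : ℝ) < g := by exact_mod_cast hg
  have hxR : (N : ℝ) * a = g * x := by exact_mod_cast hx
  have hzR : (c : ℝ) = g * z := by exact_mod_cast hz
  have huvR : (x : ℝ) * u + z * v = 1 := by exact_mod_cast huv
  have hdetR : (a : ℝ) * d - b * c = 1 := by exact_mod_cast hdet
  have hne : (g / N : ℝ) * (N / g) - (u * (N * b) + v * d) * 0 ≠ 0 := by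
    field_simp; norm_num
  have hprod : A = mapGL ℝ δ * glMk (g / N) (u * (N * b) + v * d) 0 (N / g) hne := by
    refine Units.ext (hA.trans ?_)
    rw [Units.val_mul]
    have ha : (a : ℝ) = x * (g / N) := by field_simp; linarith
    have hx1 : (N / g : ℝ) = x * d - z * (N * b) := by
      rw [div_eq_iff hgR.ne']
      linear_combination (-N : ℝ) * hdetR + d * hxR - N * b * hzR
    rw [mapGL_mk_val, glMk_val, hx1]
    ext i j; fin_cases i <;> fin_cases j
    · simp [Matrix.mul_apply, Fin.sum_univ_two, ha]
    · simp [Matrix.mul_apply, Fin.sum_univ_two]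
      linear_combination (-N * b : ℝ) * huvR
    · simp [Matrix.mul_apply, Fin.sum_univ_two, hzR]
      ring
    · simp [Matrix.mul_apply, Fin.sum_univ_two]
      linear_combination (-d : ℝ) * huvR
  have hEδ : (ModularForm.E₄ : ℍ → ℂ) ∣[(4 : ℤ)] (mapGL ℝ δ)⁻¹ = ModularForm.E₄ :=
    SlashInvariantFormClass.slash_action_eq ModularForm.E₄ _ (inv_mem ⟨δ, rfl⟩)
  have hEu : (ModularForm.E₄ : ℍ → ℂ) ∣[(4 : ℤ)]
      glMk (g / N) (u * (N * b) + v * d) 0 (N / g) hne = ModularForm.E₄ := by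
    rw [← inv_mul_eq_iff_eq_mul.mpr hprod, SlashAction.slash_mul, hEδ, hEA]
  -- As `u` fixes `E₄`, comparing the values at `i ∞` gives `(N / g)⁴ = 1`.
  have hD : (N / g : ℝ) = 1 := by
    have hlim := tendsto_atImInfty one_mem_strictPeriods_SL ModularForm.E₄
    rw [EisensteinSeries.E_qExpansion_coeff_zero _ ⟨2, rfl⟩] at hlim
    choose T hT hT' using fun τ : ℍ ↦ exists_affine τ (a := g / N) (d := N / g)
      (by positivity) (by positivity) (u * (N * b) + v * d)
    have hT2 : Filter.Tendsto T atImInfty atImInfty := by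
      rw [atImInfty, Filter.tendsto_comap_iff]
      have : im ∘ T = fun τ : ℍ ↦ (g / N : ℝ) / (N / g) * τ.im := by
        ext τ; simp only [Function.comp_apply, hT']; ring
      rw [this]
      exact Filter.tendsto_comap.const_mul_atTop (by positivity)
    have h2 := (hlim.comp hT2).const_mul (((N / g : ℝ) : ℂ) ^ (-4 : ℤ))
    have h3 : (fun τ ↦ (((N / g : ℝ) : ℂ) ^ (-4 : ℤ)) * ((ModularForm.E₄ : ℍ → ℂ) ∘ T) τ) =
        ModularForm.E₄ := by
      ext τ
      have hτ := congr_fun hEu τ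
      rw [slash_upper_weight _ _ (by positivity) (by positivity) _ (τ' := T τ) ?_] at hτ
      · rw [← hτ]
        have hn : (g : ℂ) / N * (N / g) = 1 := by
          have h1 : (g : ℂ) ≠ 0 := by exact_mod_cast hg.ne'
          have h2 : (N : ℂ) ≠ 0 := by exact_mod_cast hN.ne'
          field_simp
        push_cast
        rw [hn, one_zpow, one_mul]
        simp
      · simpa using hT τ
    rw [h3, mul_one] at h2
    have h4 := tendsto_nhds_unique hlim h2
    have h5 : (N / g : ℝ) ^ 4 = 1 := by
      have : (((N / g : ℝ) : ℂ) ^ 4) = 1 := by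
        rw [zpow_neg, eq_comm, inv_eq_one] at h4
        exact_mod_cast h4
      exact_mod_cast this
    exact (pow_eq_one_iff_of_nonneg (by positivity) (by norm_num)).mp h5
  rw [div_eq_one_iff_eq hgR.ne'] at hD
  refine mem_Γ₀_iff.mpr ⟨a, b, c, d, hdet, ⟨z, ?_⟩, hval⟩
  have : (c : ℝ) = N * z := by rw [hzR, hD]
  exact_mod_cast this

lemma conj_sepForm_ne {q : Cosets N} (hq : q ≠ QuotientGroup.mk 1) :
    conj (sepForm N) q ≠ sepForm N := by
  induction q using Quotient.inductionOn with | _ h => ?_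
  intro he
  refine hq ?_
  have h1 := mem_Γ₀_of_slash_sepForm (inv_mem h.2) he
  refine (QuotientGroup.eq.mpr ?_ : (QuotientGroup.mk h : Cosets N) = QuotientGroup.mk 1)
  rw [mul_one]
  exact h1

/-- The derivative of the polynomial `∏ (X - N³ E₄(N τ) ∣ q)` at `N³ E₄(N τ)` does not vanish
identically, since `E₄(N τ)` is different from its other conjugates. -/
lemma derivative_conjPoly_sepForm_ne_zero :
    (fun τ ↦ (conjPoly (sepForm N) τ).derivative.eval (sepForm N τ)) ≠ 0 := by
  classical
  have h1 : (fun τ ↦ (conjPoly (sepForm N) τ).derivative.eval (sepForm N τ)) =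
      ∏ q ∈ Finset.univ.erase (QuotientGroup.mk 1), (⇑(sepForm N) - conj (sepForm N) q) := by
    ext τ
    rw [conjPoly, Polynomial.derivative_prod_finset, Polynomial.eval_finsetSum,
      Finset.sum_eq_single (QuotientGroup.mk 1)]
    · simp [Polynomial.eval_prod]
    · intro q _ hq
      rw [Polynomial.eval_mul, Polynomial.eval_prod]
      rw [Finset.prod_eq_zero (i := QuotientGroup.mk 1) (by simp [hq.symm]) (by simp [conj_one]),
        zero_mul]
    · simp
  rw [h1, ne_eq, prod_eq_zero_iff]
  · rintro ⟨q, hq, h⟩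
    exact conj_sepForm_ne (Finset.ne_of_mem_erase hq) (sub_eq_zero.mp h).symm
  · intro q _
    exact (sepForm N).holo'.sub (mdifferentiable_conj _ _)

end

/-! ### Conjugating the Fourier coefficients of cusp forms -/

section

variable {N : ℕ}

/-- The functions `φ` and `φ'` are modular forms of weight `k` for `Γ₀(N)`, and the Fourier
coefficients of `φ'` are the images of those of `φ` under `σ`. -/
def ConjForm (N : ℕ) (σ : ℂ →+* ℂ) (k : ℤ) (φ φ' : ℍ → ℂ) : Prop :=
  ∃ f f' : ModularForm (Γ₀ N) k, ⇑f = φ ∧ ⇑f' = φ' ∧ qExpansion 1 f' = (qExpansion 1 f).map σ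

variable {σ : ℂ →+* ℂ} {k l m : ℤ} {φ φ' ψ ψ' : ℍ → ℂ}

lemma ConjForm.of_hasQExp (f f' : ModularForm (Γ₀ N) k) (s : PowerSeries ℂ) (h : HasQExp f s)
    (h' : HasQExp f' (s.map σ)) : ConjForm N σ k f f' :=
  ⟨f, f', rfl, rfl, by rw [← h.eq_qExpansion (one_mem_strictPeriods_Γ₀ N),
    ← h'.eq_qExpansion (one_mem_strictPeriods_Γ₀ N)]⟩

lemma ConjForm.add (h : ConjForm N σ k φ φ') (h' : ConjForm N σ k ψ ψ') :
    ConjForm N σ k (φ + ψ) (φ' + ψ') := by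
  obtain ⟨f, f', rfl, rfl, h⟩ := h
  obtain ⟨g, g', rfl, rfl, h'⟩ := h'
  refine ConjForm.of_hasQExp (f + g) (f' + g') (qExpansion 1 f + qExpansion 1 g)
    ((hasQExp_qExpansion (one_mem_strictPeriods_Γ₀ N) f).add
      (hasQExp_qExpansion (one_mem_strictPeriods_Γ₀ N) g)) ?_
  rw [map_add, ← h, ← h']
  exact (hasQExp_qExpansion (one_mem_strictPeriods_Γ₀ N) f').add
      (hasQExp_qExpansion (one_mem_strictPeriods_Γ₀ N) g')

lemma ConjForm.mul (h : ConjForm N σ k φ φ') (h' : ConjForm N σ l ψ ψ') (hm : k + l = m) :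
    ConjForm N σ m (φ * ψ) (φ' * ψ') := by
  subst hm
  obtain ⟨f, f', rfl, rfl, h⟩ := h
  obtain ⟨g, g', rfl, rfl, h'⟩ := h'
  refine ConjForm.of_hasQExp (f.mul g) (f'.mul g') (qExpansion 1 f * qExpansion 1 g)
    ((hasQExp_qExpansion (one_mem_strictPeriods_Γ₀ N) f).mul
      (hasQExp_qExpansion (one_mem_strictPeriods_Γ₀ N) g)) ?_
  rw [map_mul, ← h, ← h']
  exact (hasQExp_qExpansion (one_mem_strictPeriods_Γ₀ N) f').mul
      (hasQExp_qExpansion (one_mem_strictPeriods_Γ₀ N) g')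

lemma ConjForm.const (c : ℂ) : ConjForm N σ 0 (fun _ ↦ c) (fun _ ↦ σ c) := by
  have key (c : ℂ) : HasQExp (fun _ ↦ c) (PowerSeries.C c) := by
    convert HasQExp.one.smul c using 1
    · ext; simp
    · simp [PowerSeries.smul_eq_C_mul]
  refine ConjForm.of_hasQExp (ModularForm.const c) (ModularForm.const (σ c)) (PowerSeries.C c)
    (key c) ?_
  rw [PowerSeries.map_C]
  exact key _

lemma ConjForm.pow (h : ConjForm N σ k φ φ') (n : ℕ) (hm : n * k = m) :
    ConjForm N σ m (φ ^ n) (φ' ^ n) := by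
  subst hm
  induction n with
  | zero => simpa using! ConjForm.const (N := N) (σ := σ) 1
  | succ n ih =>
    rw [pow_succ, pow_succ]
    exact ih.mul h (by push_cast; ring)

lemma ConjForm.sum {ι : Type*} (S : Finset ι) {φ φ' : ι → ℍ → ℂ}
    (h : ∀ i ∈ S, ConjForm N σ k (φ i) (φ' i)) :
    ConjForm N σ k (∑ i ∈ S, φ i) (∑ i ∈ S, φ' i) := by
  classical
  induction S using Finset.induction_on with
  | empty => exact ConjForm.of_hasQExp 0 0 0 HasQExp.zero (by simpa using! HasQExp.zero)
  | insert i S hi ih =>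
    rw [Finset.sum_insert hi, Finset.sum_insert hi]
    exact (h i (by simp)).add (ih fun j hj ↦ h j (by simp [hj]))

lemma ConjForm.eq_zero_iff (h : ConjForm N σ k φ φ') : φ' = 0 ↔ φ = 0 := by
  obtain ⟨f, f', rfl, rfl, h⟩ := h
  have key (f : ModularForm (Γ₀ N) k) : (f : ℍ → ℂ) = 0 ↔ qExpansion 1 f = 0 := by
    constructor
    · intro hf
      refine (HasQExp.eq_qExpansion (one_mem_strictPeriods_Γ₀ N) (f := f) ?_).symm
      rw [hf]
      exact HasQExp.zero
    · intro hf
      refine (hasQExp_qExpansion (one_mem_strictPeriods_Γ₀ N) f).ext ?_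
      rw [hf]
      exact HasQExp.zero
  rw [key, key, h]
  exact map_eq_zero_iff _ (PowerSeries.map_injective _ σ.injective)

lemma ConjForm.exists_of_isLevelOne (h : IsLevelOne k φ) : ∃ φ', ConjForm N σ k φ φ' ∧
    IsLevelOne k φ' := by
  obtain ⟨f, rfl⟩ := h
  obtain ⟨f', h⟩ := exists_levelOne_conj σ f
  exact ⟨f', ⟨restrict (Γ₀_le_SL N) f, restrict (Γ₀_le_SL N) f', rfl, rfl, h⟩, f', rfl⟩

lemma ConjForm.sepForm [NeZero N] : ConjForm N σ 4 (sepForm N) (sepForm N) := by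
  refine ConjForm.of_hasQExp _ _ _ sepForm_qExp ?_
  have := sepForm_qExp (N := N)
  rw [PowerSeries.smul_eq_C_mul] at this ⊢
  rw [map_mul, PowerSeries.map_C, dilate_map, E_qExpansion_map σ _ ⟨2, rfl⟩]
  simpa using this

lemma ConjForm.mdifferentiable (h : ConjForm N σ k φ φ') : MDiff φ ∧ MDiff φ' := by
  obtain ⟨f, f', rfl, rfl, -⟩ := h
  exact ⟨f.holo', f'.holo'⟩

/-- A cusp form viewed as a modular form. -/
abbrev toMod (f : S₂ N) : ModularForm (Γ₀ N) 2 := (f : ModularForm (Γ₀ N) 2)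

/-- The trace to level one of `f · sˡ`, where `s` is the form `N³ E₄(N τ)`. -/
def traceMulSep [NeZero N] (f : S₂ N) (l : ℕ) : ModularForm 𝒮ℒ (2 + l * 4) :=
  ModularForm.trace 𝒮ℒ ((toMod f).mul ((sepForm N).pow l))

lemma traceMulSep_apply [NeZero N] (f : S₂ N) (l : ℕ) (τ : ℍ) :
    traceMulSep f l τ = ∑ q, conj (toMod f) q τ * conj (sepForm N) q τ ^ l := by
  rw [traceMulSep, ModularForm.coe_trace, Finset.sum_apply]
  refine Finset.sum_congr rfl fun q _ ↦ ?_
  have := conj_mul (toMod f) ((sepForm N).pow l) q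
  rw [conj_pow] at this
  exact congr_fun this τ

/-- Lagrange interpolation expresses `f`, up to the factor `sepDeriv`, by `sepForm` and level one
forms. -/
lemma mul_derivative_conjPoly [NeZero N] (f : S₂ N) (τ : ℍ) :
    f τ * (conjPoly (sepForm N) τ).derivative.eval (sepForm N τ) =
      ∑ j ∈ Finset.range (Fintype.card (Cosets N) + 1), ∑ i ∈ Finset.range j,
        (conjPoly (sepForm N) τ).coeff j * traceMulSep f (j - 1 - i) τ * sepForm N τ ^ i := by
  have := mul_derivative_eval (fun q ↦ conj (sepForm N) q τ) (fun q ↦ conj (toMod f) q τ)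
    (QuotientGroup.mk 1) (conjPoly (sepForm N) τ) rfl
  rw [natDegree_conjPoly, conj_one, conj_one] at this
  simp_rw [traceMulSep_apply]
  exact this

/-- The derivative of `∏ (X - s ∣ q)` at `s = N³ E₄(N τ)`, as a function of `τ`. -/
def sepDeriv (N : ℕ) [NeZero N] (τ : ℍ) : ℂ :=
  (conjPoly (sepForm N) τ).derivative.eval (sepForm N τ)

lemma exists_conjForm_sepDeriv [NeZero N] (σ : ℂ →+* ℂ) :
    ∃ D', ConjForm N σ ((Fintype.card (Cosets N) - 1 : ℕ) * 4) (sepDeriv N) D' := by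
  set n := Fintype.card (Cosets N)
  have h1 (j : ℕ) (hj : j ≤ n) := ConjForm.exists_of_isLevelOne (N := N) (σ := σ)
    (isLevelOne_coeff_conjPoly (sepForm N) hj)
  choose! p' hp' _h using h1
  refine ⟨∑ j ∈ Finset.range n, p' (j + 1) * (fun _ ↦ σ (j + 1 : ℕ)) * ⇑(sepForm N) ^ j, ?_⟩
  have : sepDeriv N = ∑ j ∈ Finset.range n, (fun τ ↦ (conjPoly (sepForm N) τ).coeff (j + 1)) *
      (fun _ ↦ ((j + 1 : ℕ) : ℂ)) * ⇑(sepForm N) ^ j := by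
    ext τ
    rw [sepDeriv, Polynomial.derivative_eval, Polynomial.sum_over_range _ (by simp),
      natDegree_conjPoly, Finset.sum_range_succ', Finset.sum_apply]
    simp [n]
  rw [this]
  refine ConjForm.sum _ fun j hj ↦ ?_
  have hj := Finset.mem_range.mp hj
  refine ((hp' (j + 1) (by omega)).mul (ConjForm.const _) (add_zero _)).mul
    (ConjForm.sepForm.pow j rfl) ?_
  rw [← add_mul]
  congr 1
  norm_cast
  omega

lemma exists_conjForm_mul_sepDeriv [NeZero N] (σ : ℂ →+* ℂ) (f : S₂ N) :
    ∃ H', ConjForm N σ (2 + (Fintype.card (Cosets N) - 1 : ℕ) * 4) (f * sepDeriv N) H' := by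
  set n := Fintype.card (Cosets N)
  have h1 (j : ℕ) (hj : j ≤ n) := ConjForm.exists_of_isLevelOne (N := N) (σ := σ)
    (isLevelOne_coeff_conjPoly (sepForm N) hj)
  choose! p' hp' _h using h1
  have h2 (l : ℕ) := ConjForm.exists_of_isLevelOne (N := N) (σ := σ) ⟨traceMulSep f l, rfl⟩
  choose c' hc' _h using h2
  refine ⟨∑ j ∈ Finset.range (n + 1), ∑ i ∈ Finset.range j,
    p' j * c' (j - 1 - i) * ⇑(sepForm N) ^ i, ?_⟩
  have : (f : ℍ → ℂ) * sepDeriv N = ∑ j ∈ Finset.range (n + 1), ∑ i ∈ Finset.range j,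
      (fun τ ↦ (conjPoly (sepForm N) τ).coeff j) * ⇑(traceMulSep f (j - 1 - i)) *
        ⇑(sepForm N) ^ i := by
    ext τ
    refine (mul_derivative_conjPoly f τ).trans ?_
    simp [n]
  rw [this]
  refine ConjForm.sum _ fun j hj ↦ ConjForm.sum _ fun i hi ↦ ?_
  have hj := Finset.mem_range.mp hj
  have hi := Finset.mem_range.mp hi
  refine ((hp' j (by omega)).mul (hc' _) rfl).mul (ConjForm.sepForm.pow i rfl) ?_
  have : ((n - j : ℕ) : ℤ) + (j - 1 - i : ℕ) + i = (n - 1 : ℕ) := by omega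
  linear_combination 4 * this

lemma sepDeriv_ne_zero [NeZero N] : sepDeriv N ≠ 0 := derivative_conjPoly_sepForm_ne_zero

/-- A cusp form is determined by finitely many level one forms, its traces against powers of
`sepForm`. -/
lemma eq_zero_of_traceMulSep [NeZero N] (f : S₂ N)
    (h : ∀ l < Fintype.card (Cosets N), traceMulSep f l = 0) : f = 0 := by
  have h1 : (f : ℍ → ℂ) * sepDeriv N = 0 := by
    ext τ
    rw [Pi.mul_apply, sepDeriv, mul_derivative_conjPoly]
    refine Finset.sum_eq_zero fun j hj ↦ Finset.sum_eq_zero fun i hi ↦ ?_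
    have hj := Finset.mem_range.mp hj
    have hi := Finset.mem_range.mp hi
    rw [h _ (by omega)]
    simp
  apply DFunLike.coe_injective
  by_contra hf
  obtain ⟨D', hD'⟩ := exists_conjForm_sepDeriv (N := N) (RingHom.id ℂ)
  exact ((mul_eq_zero_iff f.holo' hD'.mdifferentiable.1).mp h1).elim hf sepDeriv_ne_zero

instance finiteDimensional_S₂ [NeZero N] : FiniteDimensional ℂ (S₂ N) := by
  let L : S₂ N →ₗ[ℂ] ((l : Fin (Fintype.card (Cosets N))) → ModularForm 𝒮ℒ (2 + (l : ℕ) * 4)) :=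
    { toFun f l := traceMulSep f l
      map_add' f g := by
        ext l τ
        have this : ∀ q, conj (toMod (f + g)) q τ = conj (toMod f) q τ + conj (toMod g) q τ := by
          intro q
          induction q using Quotient.inductionOn with | _ h => ?_
          exact congr_fun (SlashAction.add_slash _ _ (f : ℍ → ℂ) g) τ
        simp [traceMulSep_apply, this, add_mul, Finset.sum_add_distrib]
      map_smul' c f := by
        ext l τ
        have this : ∀ q, conj (toMod (c • f)) q τ = c * conj (toMod f) q τ := by
          intro q
          induction q using Quotient.inductionOn with | _ h => ?_
          have := congr_fun (ModularForm.smul_slash 2 h.val⁻¹ (f : ℍ → ℂ) c) τ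
          rw [UpperHalfPlane.σ, if_pos (by rw [det_of_mem_SL (inv_mem h.2)]; exact one_pos)] at this
          exact this
        simp [traceMulSep_apply, this, Finset.mul_sum, mul_assoc] }
  have hL : Function.Injective L := by
    rw [injective_iff_map_eq_zero]
    intro f hf
    exact eq_zero_of_traceMulSep f fun l hl ↦ congr_fun hf ⟨l, hl⟩
  exact Module.Finite.of_injective L hL

lemma mdifferentiable_sum {ι : Type*} (S : Finset ι) {φ : ι → ℍ → ℂ}
    (h : ∀ i ∈ S, MDiff (φ i)) : MDiff (∑ i ∈ S, φ i) := by
  classical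
  induction S using Finset.induction_on with
  | empty => exact mdifferentiable_const (c := (0 : ℂ))
  | insert i S hi ih =>
    rw [Finset.sum_insert hi]
    exact (h i (by simp)).add (ih fun j hj ↦ h j (by simp [hj]))

lemma mdifferentiable_pow {φ : ℍ → ℂ} (h : MDiff φ) (n : ℕ) : MDiff (φ ^ n) := by
  induction n with
  | zero => exact mdifferentiable_const (c := (1 : ℂ))
  | succ n ih => rw [pow_succ]; exact ih.mul h

/-- The lower coefficients of the polynomial whose roots are the conjugates of a cusp form vanish at
`i ∞`. -/
lemma tendsto_coeff_conjPoly [NeZero N] (f : S₂ N) {j : ℕ} (hj : j < Fintype.card (Cosets N)) :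
    Filter.Tendsto (fun τ ↦ (conjPoly (toMod f) τ).coeff j) atImInfty (𝓝 0) := by
  have h0 : Filter.Tendsto (fun τ q ↦ conj (toMod f) q τ) atImInfty (𝓝 0) := by
    rw [tendsto_pi_nhds]
    intro q
    induction q using Quotient.inductionOn with | _ h => ?_
    obtain ⟨γ, hγ⟩ := inv_mem h.2
    have := CuspFormClass.zero_at_infty_slash f γ
    rw [ModularForm.SL_slash] at this
    exact (congr_arg (fun g ↦ IsZeroAtImInfty ((f : ℍ → ℂ) ∣[(2 : ℤ)] g)) hγ).mp this
  have h1 := ((MvPolynomial.continuous_eval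
    (MvPolynomial.esymm (Cosets N) ℂ (Fintype.card (Cosets N) - j))).tendsto 0).comp h0
  have h2 := h1.const_mul ((-1) ^ (Fintype.card (Cosets N) - j))
  have h3 : MvPolynomial.eval 0
      (MvPolynomial.esymm (Cosets N) ℂ (Fintype.card (Cosets N) - j)) = 0 := by
    rw [MvPolynomial.esymm, map_sum]
    refine Finset.sum_eq_zero fun s hs ↦ ?_
    have hs := (Finset.mem_powersetCard.mp hs).2
    obtain ⟨i, hi⟩ : s.Nonempty := Finset.card_pos.mp (by omega)
    rw [map_prod]
    exact Finset.prod_eq_zero hi (by simp)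
  rw [h3, mul_zero] at h2
  refine h2.congr fun τ ↦ ?_
  have := Multiset.prod_X_sub_C_coeff (Finset.univ.val.map fun q ↦ conj (toMod f) q τ) (k := j)
    (by simpa using hj.le)
  rw [Multiset.map_map] at this
  simp only [Multiset.card_map] at this
  rw [Function.comp_apply, ← MvPolynomial.coe_aeval_eq_eval, RingHom.coe_coe,
    MvPolynomial.aeval_esymm_eq_multiset_esymm]
  exact this.symm

end

lemma conjPoly_root {N : ℕ} [NeZero N] {k : ℤ} (f : ModularForm (Γ₀ N) k) (τ : ℍ) :
    f τ ^ Fintype.card (Cosets N) +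
      ∑ j ∈ Finset.range (Fintype.card (Cosets N)), (conjPoly f τ).coeff j * f τ ^ j = 0 := by
  have h := conjPoly_eval f τ
  rw [Polynomial.eval_eq_sum_range, natDegree_conjPoly, Finset.sum_range_succ, add_comm] at h
  have h1 : (conjPoly f τ).coeff (Fintype.card (Cosets N)) = 1 := by
    rw [← natDegree_conjPoly f τ]
    exact (conjPoly_monic f τ).coeff_natDegree
  rwa [h1, one_mul] at h

/-- A root of a monic equation whose lower coefficients tend to zero tends to zero. -/
lemma isZeroAtImInfty_of_root {n : ℕ} (hn : n ≠ 0) (a : ℕ → ℍ → ℂ) (φ : ℍ → ℂ)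
    (ha : ∀ j < n, Filter.Tendsto (a j) atImInfty (𝓝 0))
    (h : ∀ τ, φ τ ^ n + ∑ j ∈ Finset.range n, a j τ * φ τ ^ j = 0) : IsZeroAtImInfty φ := by
  rw [IsZeroAtImInfty, Filter.ZeroAtFilter, Metric.tendsto_nhds]
  intro ε hε
  set C : ℝ := min 1 ((ε / 2) ^ n) / n
  have hn' : (0 : ℝ) < n := by exact_mod_cast Nat.pos_of_ne_zero hn
  have hC : 0 < C := by positivity
  have hnC : n * C = min 1 ((ε / 2) ^ n) := by simp only [C]; field_simp
  have hev := (Filter.eventually_all_finset (Finset.range n)).mpr fun j hj ↦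
    (Metric.tendsto_nhds.mp (ha j (Finset.mem_range.mp hj)) C hC)
  filter_upwards [hev] with τ hτ
  rw [dist_zero_right]
  have := norm_pow_le_of_root_of_lt_one hn (fun j ↦ a j τ) (φ τ) (C := C)
    (fun j hj ↦ by simpa using (hτ j (Finset.mem_range.mpr hj)).le) (h τ)
    (hnC.le.trans (min_le_left _ _))
  rw [hnC] at this
  have := lt_of_le_of_lt (le_of_pow_le_pow_left₀ hn (by positivity)
    (this.trans (min_le_right _ _))) (half_lt_self hε)
  exact this

/-- The space `S₂(N)` is stable under the action of ring endomorphisms of `ℂ` on Fourier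
coefficients. Write `f = H / D` with `D` the derivative `sepDeriv`. The action of `σ` is defined on
`H` and `D`, which are polynomials in level one forms and `E₄(N τ)`, and the quotient of the images
is integral over the ring of level one forms, as `f` is. Hence it is holomorphic, also at the
cusps. -/
lemma exists_conj {N : ℕ} [NeZero N] (σ : ℂ →+* ℂ) (f : S₂ N) :
    ∃ f' : S₂ N, qExpansion 1 f' = (qExpansion 1 f).map σ := by
  obtain ⟨D', hD⟩ := exists_conjForm_sepDeriv (N := N) σ
  obtain ⟨H', hH⟩ := exists_conjForm_mul_sepDeriv σ f
  set n := Fintype.card (Cosets N) with hn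
  set D := sepDeriv N
  have hn0 : n ≠ 0 := Fintype.card_ne_zero
  have h1 (j : ℕ) (hj : j ≤ n) := ConjForm.exists_of_isLevelOne (N := N) (σ := σ)
    (isLevelOne_coeff_conjPoly (toMod f) hj)
  choose! a' ha' hL using h1
  have hD0 : D' ≠ 0 := fun h ↦ sepDeriv_ne_zero (hD.eq_zero_iff.mp h)
  -- `σ` applied to the equation for `f` over level one forms, with the denominators cleared
  have hrel : H' ^ n + ∑ j ∈ Finset.range n, a' j * H' ^ j * D' ^ (n - j) = 0 := by
    have key : ConjForm N σ (n * (2 + (n - 1 : ℕ) * 4))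
        ((f * D) ^ n + ∑ j ∈ Finset.range n,
          (fun τ ↦ (conjPoly (toMod f) τ).coeff j) * (f * D) ^ j * D ^ (n - j))
        (H' ^ n + ∑ j ∈ Finset.range n, a' j * H' ^ j * D' ^ (n - j)) := by
      refine (hH.pow n rfl).add (ConjForm.sum _ fun j hj ↦ ?_)
      have hj := Finset.mem_range.mp hj
      refine ((ha' j hj.le).mul (hH.pow j rfl) rfl).mul (hD.pow (n - j) rfl) ?_
      have : ((n - j : ℕ) : ℤ) = n - j := by omega
      rw [← hn, this]
      ring
    rw [key.eq_zero_iff]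
    ext τ
    have hr := conjPoly_root (toMod f) τ
    rw [← hn] at hr
    simp only [Pi.add_apply, Finset.sum_apply, Pi.mul_apply, Pi.pow_apply, Pi.zero_apply]
    rw [← zero_mul (D τ ^ n), ← hr, add_mul, Finset.sum_mul]
    congr 1
    · rw [mul_pow]; rfl
    · refine Finset.sum_congr rfl fun j hj ↦ ?_
      obtain ⟨m, hm⟩ := Nat.exists_eq_add_of_le (Finset.mem_range.mp hj).le
      rw [hm, Nat.add_sub_cancel_left, pow_add, mul_pow]
      change _ * (f τ ^ j * _) * _ = _ * f τ ^ j * _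
      ring
  obtain ⟨F, hF, hFD⟩ := exists_quotient_of_root hn0 a' hH.mdifferentiable.2
    hD.mdifferentiable.2 hD0 (fun j hj ↦ (ha' j hj.le).mdifferentiable.2)
    (fun τ ↦ by simpa using congr_fun hrel τ)
  have hroot : F ^ n + ∑ j ∈ Finset.range n, a' j * F ^ j = 0 := by
    refine ((mul_eq_zero_iff ((mdifferentiable_pow hF n).add (mdifferentiable_sum _ fun j hj ↦
      (ha' j (Finset.mem_range.mp hj).le).mdifferentiable.2.mul (mdifferentiable_pow hF j)))
      (mdifferentiable_pow hD.mdifferentiable.2 n)).mp ?_).resolve_right (pow_ne_zero n ?_)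
    · rw [← hrel, hFD, add_mul, Finset.sum_mul, mul_pow]
      congr 1
      refine Finset.sum_congr rfl fun j hj ↦ ?_
      obtain ⟨m, hm⟩ := Nat.exists_eq_add_of_le (Finset.mem_range.mp hj).le
      rw [hm, Nat.add_sub_cancel_left, pow_add, mul_pow]
      ring
    · exact hD0
  obtain ⟨DM, DM', hDM, rfl, hDq⟩ := hD
  obtain ⟨HM, HM', hHM, rfl, hHq⟩ := hH
  -- `F` inherits invariance from `H'` and `D'`; at a cusp `γ ∞` the form `F ∣ γ` satisfies the same
  -- equation as `F`, the coefficients being of level one and vanishing at `i ∞`.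
  let f' : S₂ N :=
    { toFun := F
      holo' := hF
      slash_action_eq' := fun γ hγ ↦ by
        have hdet := det_of_mem_SL (Γ₀_le_SL N hγ)
        have h1 := ModularForm.mul_slash 2 ((n - 1 : ℕ) * 4) γ F DM'
        rw [hdet, abs_one, one_smul, ← hFD, SlashInvariantFormClass.slash_action_eq HM' γ hγ,
          SlashInvariantFormClass.slash_action_eq DM' γ hγ] at h1
        have h2 : (F ∣[(2 : ℤ)] γ - F) * DM' = 0 := by rw [sub_mul, ← h1, ← hFD, sub_self]
        exact sub_eq_zero.mp (((mul_eq_zero_iff ((hF.slash 2 γ).sub hF) DM'.holo').mp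
          h2).resolve_right hD0)
      zero_at_cusps' := fun {c} hc ↦ by
        have hc' : IsCusp c 𝒮ℒ := (Subgroup.IsArithmetic.isCusp_iff_isCusp_SL2Z (Γ₀ N)).mp hc
        rw [OnePoint.isZeroAt_iff_forall_SL2Z hc']
        intro γ _
        refine isZeroAtImInfty_of_root hn0 a' _ (fun j hj ↦ ?_) fun τ ↦ ?_
        · obtain ⟨g, g', hg, hg', hq⟩ := ha' j hj.le
          have h1 := tendsto_atImInfty (one_mem_strictPeriods_Γ₀ N) g
          have h2 := tendsto_atImInfty (one_mem_strictPeriods_Γ₀ N) g'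
          have h3 : (qExpansion 1 g).coeff 0 = 0 :=
            tendsto_nhds_unique h1 (by rw [hg]; exact tendsto_coeff_conjPoly f hj)
          rw [hq, PowerSeries.coeff_map, h3, map_zero, hg'] at h2
          exact h2
        · have hw := denom_ne_zero (γ : GL (Fin 2) ℝ) τ
          have ha (j : ℕ) (hj : j < n) : a' j (γ • τ) =
              denom γ τ ^ (2 * (n - j)) * a' j τ := by
            obtain ⟨g, hg⟩ := hL j hj.le
            have h2 := congr_fun (SlashInvariantFormClass.slash_action_eq g
              (mapGL ℝ γ) ⟨γ, rfl⟩) τ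
            change ((g : ℍ → ℂ) ∣[((Fintype.card (Cosets N) - j : ℕ) * 2 : ℤ)] γ) τ = g τ at h2
            rw [ModularForm.SL_slash_apply, hg, zpow_neg,
              mul_inv_eq_iff_eq_mul₀ (zpow_ne_zero _ hw)] at h2
            rw [h2, mul_comm]
            congr 1
            rw [← zpow_natCast]
            congr 1
            push_cast
            rw [← hn, Nat.cast_sub hj.le]
            ring
          have h0 := congr_fun hroot (γ • τ)
          simp only [Pi.add_apply, Pi.pow_apply, Finset.sum_apply, Pi.mul_apply,
            Pi.zero_apply] at h0
          rw [ModularForm.SL_slash_apply]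
          have hpow : denom γ τ ^ (-2 : ℤ) = (denom γ τ ^ 2)⁻¹ := by
            rw [zpow_neg]; rfl
          rw [hpow]
          have hw2 : denom γ τ ^ (2 * n) ≠ 0 := pow_ne_zero _ hw
          rw [← mul_right_inj' hw2, mul_zero, ← h0, mul_add, Finset.mul_sum]
          congr 1
          · rw [mul_pow, inv_pow, ← pow_mul]
            field_simp
          · refine Finset.sum_congr rfl fun j hj ↦ ?_
            have hj := Finset.mem_range.mp hj
            rw [ha j hj, mul_pow, inv_pow, ← pow_mul]
            obtain ⟨m, hm⟩ := Nat.exists_eq_add_of_le hj.le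
            rw [hm, Nat.add_sub_cancel_left, mul_add, pow_add]
            field_simp }
  refine ⟨f', ?_⟩
  have h1 : ∀ g : ModularForm (Γ₀ N) ((n - 1 : ℕ) * 4), (g : ℍ → ℂ) ≠ 0 → qExpansion 1 g ≠ 0 := by
    intro g hg h
    refine hg ((hasQExp_qExpansion (one_mem_strictPeriods_Γ₀ N) g).ext ?_)
    rw [h]
    exact HasQExp.zero
  have h2 := hasQExp_qExpansion (one_mem_strictPeriods_Γ₀ N) f'
  have h3 : HasQExp HM' (qExpansion 1 f' * qExpansion 1 DM') := by
    rw [hFD]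
    exact h2.mul (hasQExp_qExpansion (one_mem_strictPeriods_Γ₀ N) DM')
  have h4 : HasQExp HM (qExpansion 1 f * qExpansion 1 DM) := by
    rw [hHM, ← hDM]
    exact (hasQExp_qExpansion (one_mem_strictPeriods_Γ₀ N) f).mul
      (hasQExp_qExpansion (one_mem_strictPeriods_Γ₀ N) DM)
  have h5 := h3.eq_qExpansion (one_mem_strictPeriods_Γ₀ N)
  rw [hHq, ← h4.eq_qExpansion (one_mem_strictPeriods_Γ₀ N), map_mul, ← hDq] at h5
  exact mul_right_cancel₀ (h1 DM' hD0) h5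

/-! ### The Hecke operators `T_p` -/

/-- The matrix with integral entries `(a, b; c, d)` and determinant one. -/
def slMk (a b c d : ℤ) (h : a * d - b * c = 1) : GL (Fin 2) ℝ :=
  mapGL ℝ (⟨!![a, b; c, d], by rw [Matrix.det_fin_two_of, h]⟩ : SL(2, ℤ))

lemma slMk_val {a b c d : ℤ} (h) : (slMk a b c d h).val = !![(a : ℝ), b; c, d] :=
  mapGL_mk_val _

lemma slMk_inv_val {a b c d : ℤ} (h) : (slMk a b c d h)⁻¹.val = !![(d : ℝ), -b; -c, a] := by
  have h' : (a : ℝ) * d - b * c = 1 := by exact_mod_cast h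
  have : (slMk a b c d h)⁻¹ = slMk d (-b) (-c) a (by linarith) := by
    rw [inv_eq_iff_mul_eq_one]
    apply Units.ext
    rw [Units.val_mul, slMk_val, slMk_val]
    ext i j
    fin_cases i <;> fin_cases j <;> simp [Matrix.mul_apply, Fin.sum_univ_two] <;> linarith
  rw [this, slMk_val]
  simp

lemma slMk_mem {N : ℕ} {a b c d : ℤ} (h) (hc : (N : ℤ) ∣ c) : slMk a b c d h ∈ Γ₀ N :=
  mem_Γ₀_iff.mpr ⟨a, b, c, d, h, hc, slMk_val h⟩

/-- The matrix `diag(1, p)`. -/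
def heckeMat (p : ℕ) [NeZero p] : GL (Fin 2) ℝ :=
  glMk 1 0 0 p (by simpa using NeZero.ne p)

lemma heckeMat_inv_val (p : ℕ) [NeZero p] : (heckeMat p)⁻¹.val = !![1, 0; 0, (p : ℝ)⁻¹] := by
  have hp : (p : ℝ) ≠ 0 := by exact_mod_cast NeZero.ne p
  have : (heckeMat p)⁻¹ = glMk 1 0 0 (p : ℝ)⁻¹ (by simpa using NeZero.ne p) := by
    rw [inv_eq_iff_mul_eq_one]
    apply Units.ext
    ext i j; fin_cases i <;> fin_cases j <;> simp [heckeMat, hp]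
  rw [this]; rfl

lemma heckeMat_mem (N p : ℕ) [NeZero p] : heckeMat p ∈ Δ₀ N := by
  refine ⟨!![1, 0; 0, (p : ℤ)], ?_, ?_, ?_, ?_⟩
  · ext i j; fin_cases i <;> fin_cases j <;> simp [heckeMat]
  · simpa using Nat.pos_of_ne_zero (NeZero.ne p)
  · simp
  · simpa using isCoprime_one_left

lemma heckeMat_conj_val (p : ℕ) [NeZero p] {g : GL (Fin 2) ℝ} {a b c d : ℝ}
    (hg : g.val = !![a, b; c, d]) :
    (heckeMat p * g * (heckeMat p)⁻¹).val = !![a, b / p; p * c, d] := by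
  have hp : (p : ℝ) ≠ 0 := by exact_mod_cast NeZero.ne p
  rw [Units.val_mul, Units.val_mul, heckeMat_inv_val, hg]
  ext i j; fin_cases i <;> fin_cases j <;> simp [heckeMat] <;> field_simp

lemma heckeMat_conj_mem_iff {M N p : ℕ} [NeZero p] (hN : N ∣ p * M) {g : GL (Fin 2) ℝ}
    {a b c d : ℤ} (hdet : a * d - b * c = 1) (hc : (M : ℤ) ∣ c)
    (hg : g.val = !![(a : ℝ), b; c, d]) :
    heckeMat p * g * (heckeMat p)⁻¹ ∈ Γ₀ N ↔ (p : ℤ) ∣ b := by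
  have hp : (p : ℝ) ≠ 0 := by exact_mod_cast NeZero.ne p
  rw [mem_Γ₀_iff, heckeMat_conj_val p hg]
  constructor
  · rintro ⟨a', b', c', d', -, -, h⟩
    have := congr_fun (congr_fun h 0) 1
    simp at this
    refine ⟨b', ?_⟩
    rw [div_eq_iff hp] at this
    have : b = b' * p := by exact_mod_cast this
    rw [this, mul_comm]
  · rintro ⟨b', rfl⟩
    refine ⟨a, b', p * c, d, by linarith, ?_, ?_⟩
    · refine dvd_trans ?_ (mul_dvd_mul_left (p : ℤ) hc)
      exact_mod_cast hN
    · push_cast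
      congr! 3
      field_simp

/-- A family of representatives for the right cosets in `Γ₀(M)` of the subgroup of matrices
`(a, b; c, d)` with `p ∣ b`. -/
def IsCosetReps (M p : ℕ) {ι : Type*} (k : ι → GL (Fin 2) ℝ) : Prop :=
  (∀ i, k i ∈ Γ₀ M) ∧ ∀ h ∈ Γ₀ M, ∃! i, ∃ a b c d : ℤ, a * d - b * c = 1 ∧ (M : ℤ) ∣ c ∧
    (h * (k i)⁻¹).val = !![(a : ℝ), b; c, d] ∧ (p : ℤ) ∣ b

open ConjAct Pointwise in
instance isFiniteRelIndex_conj {N M : ℕ} [NeZero N] [NeZero M] (α : Δ₀ N) :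
    (toConjAct α.val⁻¹ • Γ₀ N).IsFiniteRelIndex (Γ₀ M) :=
  ⟨((isArithmetic_conj α).is_commensurable.trans
    (Subgroup.IsArithmetic.is_commensurable (𝒢 := Γ₀ M)).symm).1⟩

open ConjAct Pointwise in
/-- The trace from `diag(1, p)⁻¹ Γ₀(N) diag(1, p) ∩ Γ₀(M)` to `Γ₀(M)` in terms of explicit coset
representatives. The case `M = N` is the operator `T_p`; for `N = p M` it maps to a lower level. -/
lemma trace_translate_eq_sum {M N p : ℕ} [NeZero N] [NeZero M] [NeZero p] (hN : N ∣ p * M)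
    {ι : Type*} [Fintype ι] {k : ι → GL (Fin 2) ℝ} (hk : IsCosetReps M p k) (f : S₂ N)
    (α : Δ₀ N) (hα : α.val = heckeMat p) :
    (CuspForm.trace (Γ₀ M) (CuspForm.translate f α.val) : ℍ → ℂ) =
      ∑ i, (f : ℍ → ℂ) ∣[(2 : ℤ)] (heckeMat p * k i) := by
  let := Fintype.ofFinite (Γ₀ M ⧸ (toConjAct α.val⁻¹ • Γ₀ N).subgroupOf (Γ₀ M))
  rw [CuspForm.coe_trace]
  symm
  have hmem (h : Γ₀ M) (i : ι) : ((QuotientGroup.mk ⟨(k i)⁻¹, inv_mem (hk.1 i)⟩ :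
      Γ₀ M ⧸ (toConjAct α.val⁻¹ • Γ₀ N).subgroupOf (Γ₀ M)) = QuotientGroup.mk h⁻¹) ↔
      ∃ a b c d : ℤ, a * d - b * c = 1 ∧ (M : ℤ) ∣ c ∧
        (h * (k i)⁻¹).val = !![(a : ℝ), b; c, d] ∧ (p : ℤ) ∣ b := by
    rw [eq_comm, QuotientGroup.eq, Subgroup.mem_subgroupOf, mem_conj_iff, inv_inv, hα]
    change heckeMat p * ((h : GL (Fin 2) ℝ) * (k i)⁻¹) * (heckeMat p)⁻¹ ∈ Γ₀ N ↔ _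
    constructor
    · intro hh
      obtain ⟨a, b, c, d, h1, h2, h3⟩ := mem_Γ₀_iff.mp (mul_mem h.2 (inv_mem (hk.1 i)))
      exact ⟨a, b, c, d, h1, h2, h3, (heckeMat_conj_mem_iff hN h1 h2 h3).mp hh⟩
    · rintro ⟨a, b, c, d, h1, h2, h3, h4⟩
      exact (heckeMat_conj_mem_iff hN h1 h2 h3).mpr h4
  refine Fintype.sum_bijective (fun i ↦ QuotientGroup.mk ⟨(k i)⁻¹, inv_mem (hk.1 i)⟩)
    ⟨?_, ?_⟩ _ _ ?_
  · intro i i' hii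
    obtain ⟨j, -, hj⟩ := hk.2 (k i') (hk.1 i')
    have h1 := hj i ((hmem ⟨k i', hk.1 i'⟩ i).mp hii)
    have h2 := hj i' ((hmem ⟨k i', hk.1 i'⟩ i').mp rfl)
    rw [h1, h2]
  · intro q
    induction q using Quotient.inductionOn with | _ h => ?_
    obtain ⟨i, hi, -⟩ := hk.2 _ (inv_mem h.2)
    refine ⟨i, ((hmem h⁻¹ i).mpr hi).trans ?_⟩
    rw [inv_inv]
  · intro i
    change _ = ((f : ℍ → ℂ) ∣[(2 : ℤ)] α.val) ∣[(2 : ℤ)] ((k i)⁻¹)⁻¹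
    rw [inv_inv, hα, SlashAction.slash_mul]

lemma mul_slMk_inv_iff {M p : ℕ} {h : GL (Fin 2) ℝ} {a b c d x y z w : ℤ}
    (hh : h.val = !![(a : ℝ), b; c, d]) (hdet : a * d - b * c = 1) (hc : (M : ℤ) ∣ c)
    (hxy : x * w - y * z = 1) (hz : (M : ℤ) ∣ z) :
    (∃ a' b' c' d' : ℤ, a' * d' - b' * c' = 1 ∧ (M : ℤ) ∣ c' ∧
      (h * (slMk x y z w hxy)⁻¹).val = !![(a' : ℝ), b'; c', d'] ∧ (p : ℤ) ∣ b') ↔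
      (p : ℤ) ∣ b * x - a * y := by
  have hval : (h * (slMk x y z w hxy)⁻¹).val =
      !![((a * w - b * z : ℤ) : ℝ), (b * x - a * y : ℤ); (c * w - d * z : ℤ),
        (d * x - c * y : ℤ)] := by
    rw [Units.val_mul, slMk_inv_val, hh]
    ext i j
    fin_cases i <;> fin_cases j <;> simp [Matrix.mul_apply, Fin.sum_univ_two] <;> ring
  rw [hval]
  constructor
  · rintro ⟨a', b', c', d', -, -, h, hb⟩
    have := congr_fun (congr_fun h 0) 1
    simp only [Matrix.of_apply, Matrix.cons_val_one, Matrix.cons_val_zero,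
      Matrix.cons_val_fin_one, Int.cast_inj] at this
    rwa [this]
  · intro hb
    refine ⟨_, _, _, _, ?_, ?_, rfl, hb⟩
    · linear_combination (x * w - y * z) * hdet + hxy
    · exact dvd_sub (hc.mul_right _) (hz.mul_left _)

lemma existsUnique_fin {p : ℕ} (hp : p.Prime) {a : ℤ} (ha : ¬ (p : ℤ) ∣ a) (b : ℤ) :
    ∃! j : Fin p, (p : ℤ) ∣ b * 1 - a * j := by
  have hp' := Nat.prime_iff_prime_int.mp hp
  obtain ⟨u, v, h⟩ : IsCoprime a p := ((hp'.coprime_iff_not_dvd).mpr ha).symm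
  have hp0 : (0 : ℤ) < p := by exact_mod_cast hp.pos
  have h1 := Int.emod_nonneg (u * b) hp0.ne'
  have h2 := Int.emod_lt_of_pos (u * b) hp0
  refine ⟨⟨((u * b) % p).toNat, by omega⟩, ?_, ?_⟩
  · change (p : ℤ) ∣ b * 1 - a * ((u * b % p).toNat : ℕ)
    rw [Int.toNat_of_nonneg h1]
    have := Int.emod_add_mul_ediv (u * b) p
    refine ⟨v * b + a * (u * b / p), ?_⟩
    linear_combination (-b) * h - a * this
  · intro j hj
    have h3 : (p : ℤ) ∣ a * (j - u * b) := by
      have : (p : ℤ) ∣ (b * 1 - a * j) - p * (v * b) := dvd_sub hj (dvd_mul_right _ _)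
      have heq : -(a * (j - u * b)) = (b * 1 - a * j) - p * (v * b) := by
        linear_combination b * h
      rwa [← dvd_neg, heq]
    have h4 := (hp'.dvd_or_dvd h3).resolve_left ha
    apply Fin.ext
    change (j : ℕ) = ((u * b) % p).toNat
    have h6 : (j : ℤ) % p = (u * b) % p := (Int.modEq_iff_dvd.mpr h4).symm
    rw [Int.emod_eq_of_lt (by omega) (by have := j.2; omega)] at h6
    omega

lemma isCosetReps_of_dvd {M p : ℕ} (hp : p.Prime) (hpM : p ∣ M) :
    IsCosetReps M p (fun j : Fin p ↦ slMk 1 j 0 1 (by simp)) := by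
  refine ⟨fun j ↦ slMk_mem _ (dvd_zero _), fun h hh ↦ ?_⟩
  obtain ⟨a, b, c, d, hdet, hc, hval⟩ := mem_Γ₀_iff.mp hh
  simp only [mul_slMk_inv_iff hval hdet hc _ (dvd_zero _)]
  refine existsUnique_fin hp (fun ha ↦ ?_) b
  have hpc : (p : ℤ) ∣ c := (Int.natCast_dvd_natCast.mpr hpM).trans hc
  have := dvd_sub (ha.mul_right d) (hpc.mul_left b)
  rw [hdet] at this
  exact (Nat.prime_iff_prime_int.mp hp).not_isUnit (isUnit_of_dvd_one this)

/-- For `p` prime to `M`, one more representative is needed than for `p ∣ M`: it is the one for the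
matrices with `p ∣ a`. -/
lemma isCosetReps_of_not_dvd {M p : ℕ} (hp : p.Prime) {s : ℤ}
    (hs : (p : ℤ) ∣ 1 + s * M ^ 2) :
    IsCosetReps M p (fun j : Option (Fin p) ↦ j.elim (slMk (1 + s * M ^ 2) s (M ^ 2) 1 (by ring))
      (fun j ↦ slMk 1 j 0 1 (by simp))) := by
  have hp' := Nat.prime_iff_prime_int.mp hp
  have hMM : (M : ℤ) ∣ M ^ 2 := dvd_pow_self _ two_ne_zero
  have hps : ¬ (p : ℤ) ∣ s := fun h ↦ hp'.not_isUnit (isUnit_of_dvd_one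
    ((dvd_add_left (h.mul_right _)).mp hs))
  refine ⟨fun j ↦ ?_, fun h hh ↦ ?_⟩
  · cases j with
    | none => exact slMk_mem (by ring) hMM
    | some j => exact slMk_mem (by simp) (dvd_zero _)
  obtain ⟨a, b, c, d, hdet, hc, hval⟩ := mem_Γ₀_iff.mp hh
  have hnone := mul_slMk_inv_iff (p := p) hval hdet hc (x := 1 + s * M ^ 2) (y := s) (z := M ^ 2)
    (w := 1) (by ring) hMM
  have hsome (j : Fin p) := mul_slMk_inv_iff (p := p) hval hdet hc (x := 1) (y := j) (z := 0)
    (w := 1) (by simp) (dvd_zero _)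
  by_cases ha : (p : ℤ) ∣ a
  · refine ⟨none, hnone.mpr (dvd_sub (hs.mul_left _) (ha.mul_right _)), fun j hj ↦ ?_⟩
    cases j with
    | none => rfl
    | some j =>
      exfalso
      have h1 := (hsome j).mp hj
      rw [mul_one] at h1
      have h2 : (p : ℤ) ∣ b := (dvd_sub_left (ha.mul_right _)).mp h1
      have := dvd_sub (ha.mul_right d) (h2.mul_right c)
      rw [hdet] at this
      exact hp'.not_isUnit (isUnit_of_dvd_one this)
  · obtain ⟨j, hj, hju⟩ := existsUnique_fin hp ha b
    refine ⟨some j, (hsome j).mpr hj, fun i hi ↦ ?_⟩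
    cases i with
    | none =>
      exfalso
      have h1 := (dvd_sub_right (hs.mul_left _)).mp (hnone.mp hi)
      exact (hp'.dvd_or_dvd h1).elim ha hps
    | some i => rw [hju i ((hsome i).mp hi)]

lemma exists_dvd_one_add {M p : ℕ} (hp : p.Prime) (hpM : ¬ p ∣ M) :
    ∃ s : ℤ, (p : ℤ) ∣ 1 + s * M ^ 2 := by
  have : IsCoprime (p : ℤ) (M ^ 2) :=
    ((Nat.isCoprime_iff_coprime.mpr ((Nat.Prime.coprime_iff_not_dvd hp).mpr hpM))).pow_right
  obtain ⟨u, v, h⟩ := this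
  exact ⟨-v, u, by linarith⟩

/-- The average over the translates by `j / m` picks out the exponents divisible by `m`. -/
lemma sum_exp_mul_div {m : ℕ} (hm : m ≠ 0) (n : ℤ) :
    ∑ j ∈ Finset.range m, Complex.exp (2 * Real.pi * Complex.I * (n * j / m)) =
      if (m : ℤ) ∣ n then (m : ℂ) else 0 := by
  have hm' : (m : ℂ) ≠ 0 := by exact_mod_cast hm
  have hζ := Complex.isPrimitiveRoot_exp m hm
  set ζ := Complex.exp (2 * Real.pi * Complex.I / m)
  have h1 (j : ℕ) : Complex.exp (2 * Real.pi * Complex.I * (n * j / m)) = (ζ ^ n) ^ j := by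
    rw [← zpow_natCast, ← zpow_mul, ← Complex.exp_int_mul]
    congr 1
    push_cast; ring
  simp_rw [h1]
  split_ifs with h
  · rw [(hζ.zpow_eq_one_iff_dvd n).mpr h]; simp
  · have hne : ζ ^ n ≠ 1 := fun h' ↦ h ((hζ.zpow_eq_one_iff_dvd n).mp h')
    rw [geom_sum_eq hne, ← zpow_natCast, ← zpow_mul, mul_comm, zpow_mul, zpow_natCast,
      hζ.pow_eq_one]
    simp

/-- The operator `U_m` on power series, sending `∑ aₙ qⁿ` to `∑ a_{mn} qⁿ`. -/
def contract (m : ℕ) (s : PowerSeries ℂ) : PowerSeries ℂ :=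
  PowerSeries.mk fun n ↦ s.coeff (m * n)

lemma HasQExp.contract {φ : ℍ → ℂ} {s : PowerSeries ℂ} (h : HasQExp φ s) {m : ℕ} (hm : 0 < m)
    {T : ℕ → ℍ → ℍ} (hT : ∀ j τ, (T j τ : ℂ) = (τ + j) / m) :
    HasQExp (fun τ ↦ (m : ℂ)⁻¹ * ∑ j ∈ Finset.range m, φ (T j τ)) (contract m s) := by
  intro τ
  have hm' : (m : ℂ) ≠ 0 := by exact_mod_cast hm.ne'
  have h1 := (hasSum_sum fun j (_ : j ∈ Finset.range m) ↦ h (T j τ)).mul_left ((m : ℂ)⁻¹)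
  have hinj : Function.Injective (fun n : ℕ ↦ m * n) := fun a b h ↦ Nat.eq_of_mul_eq_mul_left hm h
  -- orthogonality of the `m`-th roots of unity
  have hterm (n : ℕ) : (m : ℂ)⁻¹ * ∑ j ∈ Finset.range m,
      s.coeff n * Function.Periodic.qParam 1 (T j τ) ^ n =
      s.coeff n * Complex.exp (2 * Real.pi * Complex.I * (n * τ / m)) *
        (if (m : ℤ) ∣ n then 1 else 0) := by
    have : ∀ j ∈ Finset.range m, s.coeff n * Function.Periodic.qParam 1 (T j τ) ^ n =
        s.coeff n * Complex.exp (2 * Real.pi * Complex.I * (n * τ / m)) *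
        Complex.exp (2 * Real.pi * Complex.I * ((n : ℤ) * j / m)) := by
      intro j _
      rw [mul_assoc, ← Complex.exp_add, Function.Periodic.qParam, ← Complex.exp_nat_mul, hT]
      congr 2
      push_cast
      field_simp
    rw [Finset.sum_congr rfl this, ← Finset.mul_sum, sum_exp_mul_div hm.ne']
    split_ifs
    · field_simp
    · simp
  simp_rw [hterm] at h1
  rw [← hinj.hasSum_iff] at h1
  · refine h1.congr_fun fun n ↦ ?_
    simp only [Function.comp_apply, HeckeProj.contract, PowerSeries.coeff_mk,
      Function.Periodic.qParam]
    rw [if_pos (by push_cast; exact dvd_mul_right _ _), mul_one, ← Complex.exp_nat_mul]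
    congr 2
    push_cast
    field_simp
  · intro n hn
    have : ¬ (m : ℤ) ∣ n := fun h ↦ by
      obtain ⟨k, hk⟩ := Int.natCast_dvd_natCast.mp h
      exact hn ⟨k, hk.symm⟩
    simp [this]

section

variable {N : ℕ} {p : ℕ} [NeZero p]

/-- The Hecke operator `T_p`, given by the double coset of `diag(1, p)`. -/
def heckeOp (N p : ℕ) [NeZero N] [NeZero p] : S₂ N →ₗ[ℂ] S₂ N :=
  cosetOp ⟨heckeMat p, heckeMat_mem N p⟩

instance (p : Nat.Primes) : NeZero (p : ℕ) := ⟨p.2.ne_zero⟩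

lemma heckeAct_heckeT [NeZero N] (p : Nat.Primes) : heckeAct N (heckeT N p) = heckeOp N p := by
  exact (Finsupp.sum_single_index (h := fun (D : HeckeCoset (Δ₀ N) (Γ₀ N) (Γ₀ N)) (n : ℤ) ↦
    n • doubleCosetOp D) (zero_smul ℤ _)).trans (one_smul ℤ _)

lemma heckeMat_mul_eq {s : ℤ} {u : ℤ} (hs : 1 + s * N ^ 2 = p * u) :
    heckeMat p * slMk (1 + s * N ^ 2) s (N ^ 2) 1 (by ring) =
      slMk u s (N ^ 2) p (by linarith) * glMk p 0 0 1 (by simpa using NeZero.ne p) := by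
  apply Units.ext
  have : (1 + s * N ^ 2 : ℝ) = p * u := by exact_mod_cast hs
  rw [Units.val_mul, Units.val_mul, slMk_val, slMk_val]
  ext i j
  fin_cases i <;> fin_cases j <;> simp [heckeMat, this, mul_comm]

lemma heckeMat_mul_translation (j : ℤ) :
    heckeMat p * slMk 1 j 0 1 (by simp) = glMk 1 j 0 p (by simpa using NeZero.ne p) := by
  apply Units.ext
  rw [Units.val_mul, slMk_val]
  ext i j
  fin_cases i <;> fin_cases j <;> simp [heckeMat]

lemma heckeOp_apply [NeZero N] (hp : p.Prime) (hpN : ¬ p ∣ N) (f : S₂ N) {τ : ℍ} {T : ℕ → ℍ}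
    {τ' : ℍ} (hT : ∀ j, (T j : ℂ) = (τ + j) / p) (hτ' : (τ' : ℂ) = p * τ) :
    heckeOp N p f τ = (p : ℂ)⁻¹ * ∑ j ∈ Finset.range p, f (T j) + p * f τ' := by
  have hp0 : (0 : ℝ) < p := by exact_mod_cast hp.pos
  obtain ⟨s, u, hs⟩ := exists_dvd_one_add hp hpN
  have h := trace_translate_eq_sum (Dvd.intro_left p rfl) (isCosetReps_of_not_dvd hp ⟨u, hs⟩) f
    ⟨heckeMat p, heckeMat_mem N p⟩ rfl
  have h' := congr_fun h τ
  rw [Finset.sum_apply, Fintype.sum_option] at h'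
  refine h'.trans ?_
  rw [add_comm]
  congr 1
  · rw [Finset.mul_sum, ← Fin.sum_univ_eq_sum_range (fun j ↦ (p : ℂ)⁻¹ * f (T j))]
    refine Finset.sum_congr rfl fun j _ ↦ ?_
    simp only [Option.elim]
    rw [heckeMat_mul_translation, slash_upper _ one_pos hp0 _ (τ' := T j)]
    · simp
    · rw [hT]; simp
  · simp only [Option.elim]
    rw [heckeMat_mul_eq hs, SlashAction.slash_mul,
      SlashInvariantFormClass.slash_action_eq f _ (slMk_mem _ (dvd_pow_self _ two_ne_zero)),
      slash_upper _ hp0 one_pos _ (τ' := τ')]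
    · simp
    · rw [hτ']; simp

/-- The effect of `T_p` on Fourier coefficients. -/
lemma qExpansion_heckeOp [NeZero N] (hp : p.Prime) (hpN : ¬ p ∣ N) (f : S₂ N) :
    qExpansion 1 (heckeOp N p f) =
      contract p (qExpansion 1 f) + (p : ℂ) • dilate p (qExpansion 1 f) := by
  have hp0 : (0 : ℝ) < p := by exact_mod_cast hp.pos
  choose T hT _h using fun (j : ℕ) (τ : ℍ) ↦ exists_affine τ one_pos hp0 j
  choose T' hT' _h using fun (τ : ℍ) ↦ exists_affine τ hp0 one_pos 0
  have hT (j : ℕ) (τ : ℍ) : (T j τ : ℂ) = (τ + j) / p := by rw [hT]; simp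
  have hT' (τ : ℍ) : (T' τ : ℂ) = p * τ := by rw [hT']; simp
  have hf := hasQExp_qExpansion (one_mem_strictPeriods_Γ₀ N) f
  refine (HasQExp.eq_qExpansion (one_mem_strictPeriods_Γ₀ N) ?_).symm
  have h2 := ((hf.contract hp.pos hT).add ((hf.dilate hp.pos (ψ := f ∘ T') fun τ τ' h ↦ ?_).smul
    (p : ℂ)))
  · convert h2 using 1
    ext τ
    exact heckeOp_apply hp hpN f (fun j ↦ hT j τ) (hT' τ)
  · rw [Function.comp_apply]
    congr 1
    apply UpperHalfPlane.ext
    rw [h, hT']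

lemma coeff_heckeOp [NeZero N] (hp : p.Prime) (hpN : ¬ p ∣ N) (f : S₂ N) (n : ℕ) :
    (qExpansion 1 (heckeOp N p f)).coeff n = (qExpansion 1 f).coeff (p * n) +
      p * (if p ∣ n then (qExpansion 1 f).coeff (n / p) else 0) := by
  rw [qExpansion_heckeOp hp hpN]
  simp [contract, dilate]

end

/-- Cusp forms are determined by their Fourier coefficients. -/
lemma eq_of_qExpansion_eq {N : ℕ} {f g : S₂ N} (h : qExpansion 1 f = qExpansion 1 g) : f = g := by
  apply DFunLike.coe_injective
  refine (hasQExp_qExpansion (one_mem_strictPeriods_Γ₀ N) f).ext ?_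
  rw [h]
  exact hasQExp_qExpansion (one_mem_strictPeriods_Γ₀ N) g

lemma dilate_dilate (p d : ℕ) (s : PowerSeries ℂ) : dilate p (dilate d s) = dilate (p * d) s := by
  rcases p.eq_zero_or_pos with rfl | hp
  · ext n
    by_cases h : n = 0 <;> simp [dilate, h]
  ext n
  simp only [dilate, PowerSeries.coeff_mk]
  by_cases h : p ∣ n
  · obtain ⟨m, rfl⟩ := h
    simp [Nat.mul_div_cancel_left _ hp, Nat.mul_dvd_mul_iff_left hp,
      Nat.mul_div_mul_left _ _ hp]
  · have h' : ¬ p * d ∣ n := fun h' ↦ h ((dvd_mul_right p d).trans h')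
    simp [h, h']

lemma contract_dilate {p d : ℕ} (h : p.Coprime d) (s : PowerSeries ℂ) :
    contract p (dilate d s) = dilate d (contract p s) := by
  ext n
  simp only [dilate, contract, PowerSeries.coeff_mk, h.symm.dvd_mul_left]
  split_ifs with h1
  · rw [Nat.mul_div_assoc _ h1]
  · rfl

lemma contract_contract (p r : ℕ) (s : PowerSeries ℂ) :
    contract p (contract r s) = contract (r * p) s := by
  ext n
  simp [contract, mul_assoc]

lemma contract_add_smul (p : ℕ) (c : ℂ) (s t : PowerSeries ℂ) :
    contract p (s + c • t) = contract p s + c • contract p t := by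
  ext n; simp [contract]

lemma dilate_add_smul (p : ℕ) (c : ℂ) (s t : PowerSeries ℂ) :
    dilate p (s + c • t) = dilate p s + c • dilate p t := by
  ext n
  simp only [dilate, map_add, PowerSeries.coeff_smul, PowerSeries.coeff_mk]
  split_ifs <;> simp

lemma heckeOp_comm {N p r : ℕ} [NeZero N] [NeZero p] [NeZero r] (hp : p.Prime) (hr : r.Prime)
    (hpN : ¬ p ∣ N) (hrN : ¬ r ∣ N) : Commute (heckeOp N p) (heckeOp N r) := by
  ext f : 1
  apply eq_of_qExpansion_eq
  rcases eq_or_ne p r with rfl | hpr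
  · rfl
  have hcop : Nat.Coprime p r := (Nat.coprime_primes hp hr).mpr hpr
  simp only [Module.End.mul_apply, qExpansion_heckeOp hp hpN, qExpansion_heckeOp hr hrN,
    contract_add_smul, dilate_add_smul, contract_dilate hcop, contract_dilate hcop.symm,
    contract_contract, dilate_dilate, smul_add, smul_smul]
  rw [mul_comm r p, mul_comm (r : ℂ) p]
  abel

/-! ### Oldforms -/

/-- A cusp form for a group, viewed as a cusp form for a subgroup. -/
def restrictCusp {𝒢 ℋ : Subgroup (GL (Fin 2) ℝ)} (h : 𝒢 ≤ ℋ) {k : ℤ} (f : CuspForm ℋ k) :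
    CuspForm 𝒢 k where
  toFun := f
  slash_action_eq' γ hγ := f.slash_action_eq' γ (h hγ)
  holo' := f.holo'
  zero_at_cusps' hc := f.zero_at_cusps' (hc.mono h)

section

variable {M N d : ℕ}

open ConjAct Pointwise in
lemma Γ₀_le_conj_diagN [NeZero d] (h : M * d ∣ N) : Γ₀ N ≤ toConjAct (diagN d)⁻¹ • Γ₀ M := by
  intro γ hγ
  have hd := (natCast_pos_of_neZero d).ne'
  obtain ⟨a, b, c, e, h1, hc, hv⟩ := mem_Γ₀_iff.mp hγ
  obtain ⟨c', rfl⟩ : (M : ℤ) * d ∣ c := dvd_trans (by exact_mod_cast h) hc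
  rw [map_inv, Subgroup.mem_inv_pointwise_smul_iff, toConjAct_smul]
  refine mem_Γ₀_iff.mpr ⟨a, d * b, M * c', e, by linarith, dvd_mul_right _ _, ?_⟩
  rw [diagN_conj_val hv]
  push_cast
  congr! 3
  field_simp

/-- The map `f(τ) ↦ f(d τ)` from `S₂(M)` to `S₂(N)`, for `M d ∣ N`. -/
def oldMap [NeZero d] (h : M * d ∣ N) : S₂ M →ₗ[ℂ] S₂ N where
  toFun f := (d : ℂ)⁻¹ • restrictCusp (Γ₀_le_conj_diagN h) (CuspForm.translate f (diagN d))
  map_add' f g := by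
    ext τ
    have := congr_fun (SlashAction.add_slash (2 : ℤ) (diagN d) (f : ℍ → ℂ) g) τ
    change (d : ℂ)⁻¹ * (((f : ℍ → ℂ) + g) ∣[(2 : ℤ)] diagN d) τ =
      (d : ℂ)⁻¹ * ((f : ℍ → ℂ) ∣[(2 : ℤ)] diagN d) τ +
        (d : ℂ)⁻¹ * ((g : ℍ → ℂ) ∣[(2 : ℤ)] diagN d) τ
    rw [this, Pi.add_apply, mul_add]
  map_smul' c f := by
    ext τ
    have := congr_fun (ModularForm.smul_slash 2 (diagN d) (f : ℍ → ℂ) c) τ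
    have hdet : 0 < (diagN d).det.val := by
      rw [Matrix.GeneralLinearGroup.val_det_apply]
      simpa [diagN] using Nat.pos_of_ne_zero (NeZero.ne d)
    rw [UpperHalfPlane.σ, if_pos hdet] at this
    change (d : ℂ)⁻¹ * ((c • (f : ℍ → ℂ)) ∣[(2 : ℤ)] diagN d) τ =
      c * ((d : ℂ)⁻¹ * ((f : ℍ → ℂ) ∣[(2 : ℤ)] diagN d) τ)
    rw [this]
    simp
    ring

lemma oldMap_apply [NeZero d] (h : M * d ∣ N) (f : S₂ M) {τ τ' : ℍ} (hτ : (τ' : ℂ) = d * τ) :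
    oldMap h f τ = f τ' := by
  have hd := natCast_pos_of_neZero d
  change (d : ℂ)⁻¹ * ((f : ℍ → ℂ) ∣[(2 : ℤ)] diagN d) τ = _
  rw [diagN, slash_upper _ hd one_pos _ (τ' := τ') (by rw [hτ]; simp)]
  have hd' : (d : ℂ) ≠ 0 := by exact_mod_cast hd.ne'
  simp
  field_simp

lemma qExpansion_oldMap [NeZero d] (h : M * d ∣ N) (f : S₂ M) :
    qExpansion 1 (oldMap h f) = dilate d (qExpansion 1 f) :=
  (HasQExp.eq_qExpansion (one_mem_strictPeriods_Γ₀ N)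
    ((hasQExp_qExpansion (one_mem_strictPeriods_Γ₀ M) f).dilate
      (Nat.pos_of_ne_zero (NeZero.ne d)) fun _ _ hτ ↦ oldMap_apply h f hτ)).symm

lemma heckeOp_oldMap [NeZero N] [NeZero M] [NeZero d] (h : M * d ∣ N) (f : S₂ M) {p : ℕ}
    [NeZero p] (hp : p.Prime) (hpN : ¬ p ∣ N) :
    heckeOp N p (oldMap h f) = oldMap h (heckeOp M p f) := by
  apply eq_of_qExpansion_eq
  have hpM : ¬ p ∣ M := fun h' ↦ hpN (h'.trans ((dvd_mul_right M d).trans h))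
  have hpd : p.Coprime d := (Nat.Prime.coprime_iff_not_dvd hp).mpr
    fun h' ↦ hpN (h'.trans ((dvd_mul_left d M).trans h))
  rw [qExpansion_heckeOp hp hpN, qExpansion_oldMap, qExpansion_oldMap, qExpansion_heckeOp hp hpM,
    dilate_add_smul, contract_dilate hpd, dilate_dilate, dilate_dilate, mul_comm p d]

lemma oldMap_mem_oldforms [NeZero d] (h : M * d ∣ N) (hM : M ≠ N) (f : S₂ M) :
    oldMap h f ∈ oldforms N :=
  Submodule.subset_span ⟨M, d, hM, h, f, fun _ _ hτ ↦ oldMap_apply h f hτ⟩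

lemma oldforms_le [NeZero N] {W : Submodule ℂ (S₂ N)}
    (hW : ∀ (M d : ℕ) [NeZero M] [NeZero d] (h : M * d ∣ N), M ≠ N → ∀ f, oldMap h f ∈ W) :
    oldforms N ≤ W := by
  refine Submodule.span_le.mpr ?_
  rintro g ⟨M, d, hM, h, f, hg⟩
  have hN := NeZero.ne N
  have : NeZero M := ⟨by rintro rfl; simp at h; exact hN h⟩
  have : NeZero d := ⟨by rintro rfl; simp at h; exact hN h⟩
  have : g = oldMap h f := by
    ext τ
    obtain ⟨τ', hτ, -⟩ := exists_affine τ (natCast_pos_of_neZero d) one_pos 0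
    have hτ : (τ' : ℂ) = d * τ := by simpa using hτ
    rw [hg τ τ' hτ, oldMap_apply h f hτ]
  rw [this]
  exact hW M d h hM f

end

/-! ### Cusp forms supported on exponents dividing the level -/

/-- The translation `τ ↦ τ + y`. -/
def uMat (y : ℝ) : GL (Fin 2) ℝ := glMk 1 y 0 1 (by simp)

/-- The matrix `(1, 0; x, 1)`. -/
def lMat (x : ℝ) : GL (Fin 2) ℝ := glMk 1 0 x 1 (by simp)

lemma uMat_mul (x y : ℝ) : uMat x * uMat y = uMat (x + y) := by
  apply Units.ext
  ext i j; fin_cases i <;> fin_cases j <;> simp [uMat, add_comm]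

lemma slash_uMat (φ : ℍ → ℂ) (y : ℝ) (τ : ℍ) : (φ ∣[(2 : ℤ)] uMat y) τ = φ (y +ᵥ τ) := by
  rw [uMat, slash_upper _ one_pos one_pos _ (τ' := y +ᵥ τ)]
  · simp
  · simp [add_comm]

/-- The linear combination of translates by multiples of `1 / m` which keeps the Fourier
coefficients whose index is prime to `m`. -/
def coprimePart (m : ℕ) (φ : ℍ → ℂ) : ℍ → ℂ :=
  ∑ k ∈ Finset.range m, ((m : ℂ)⁻¹ * ∑ r ∈ Finset.range m with r.Coprime m,
    Complex.exp (2 * Real.pi * Complex.I * (-r * k / m))) • (φ ∣[(2 : ℤ)] uMat (k / m))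

lemma qParam_vadd (y : ℝ) (τ : ℍ) : Function.Periodic.qParam 1 ((y +ᵥ τ : ℍ) : ℂ) =
    Complex.exp (2 * Real.pi * Complex.I * y) * Function.Periodic.qParam 1 τ := by
  rw [Function.Periodic.qParam, Function.Periodic.qParam, ← Complex.exp_add]
  congr 1
  push_cast
  simp
  ring

lemma HasQExp.coprimePart {φ : ℍ → ℂ} {s : PowerSeries ℂ} (h : HasQExp φ s) {m : ℕ} (hm : m ≠ 0) :
    HasQExp (coprimePart m φ) (PowerSeries.mk fun n ↦ if n.Coprime m then s.coeff n else 0) := by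
  intro τ
  have hm' : (m : ℂ) ≠ 0 := by exact_mod_cast hm
  have h1 := hasSum_sum fun k (_ : k ∈ Finset.range m) ↦ (h (((k / m : ℝ)) +ᵥ τ)).mul_left
    ((m : ℂ)⁻¹ * ∑ r ∈ Finset.range m with r.Coprime m,
    Complex.exp (2 * Real.pi * Complex.I * (-r * k / m)))
  have h2 : HeckeProj.coprimePart m φ τ = ∑ k ∈ Finset.range m,
      ((m : ℂ)⁻¹ * ∑ r ∈ Finset.range m with r.Coprime m,
        Complex.exp (2 * Real.pi * Complex.I * (-r * k / m))) * φ ((k / m : ℝ) +ᵥ τ) := by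
    rw [HeckeProj.coprimePart, Finset.sum_apply]
    refine Finset.sum_congr rfl fun k _ ↦ ?_
    rw [Pi.smul_apply, slash_uMat, smul_eq_mul]
  rw [h2]
  refine h1.congr_fun fun n ↦ ?_
  have h3 : ∀ k ∈ Finset.range m, ((m : ℂ)⁻¹ * ∑ r ∈ Finset.range m with r.Coprime m,
      Complex.exp (2 * Real.pi * Complex.I * (-r * k / m))) *
      (s.coeff n * Function.Periodic.qParam 1 (((k / m : ℝ) +ᵥ τ : ℍ) : ℂ) ^ n) =
      (m : ℂ)⁻¹ * (s.coeff n * Function.Periodic.qParam 1 τ ^ n) *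
      ∑ r ∈ Finset.range m with r.Coprime m,
        Complex.exp (2 * Real.pi * Complex.I * ((n - r : ℤ) * k / m)) := by
    intro k _
    rw [qParam_vadd, mul_pow, ← Complex.exp_nat_mul, Finset.mul_sum, Finset.sum_mul,
      Finset.mul_sum]
    refine Finset.sum_congr rfl fun r _ ↦ ?_
    have : Complex.exp (2 * Real.pi * Complex.I * ((n - r : ℤ) * k / m)) =
        Complex.exp (2 * Real.pi * Complex.I * (-r * k / m)) *
        Complex.exp (n * (2 * Real.pi * Complex.I * ((k / m : ℝ) : ℂ))) := by
      rw [← Complex.exp_add]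
      congr 1
      push_cast
      ring
    rw [this]
    ring
  rw [Finset.sum_congr rfl h3, ← Finset.mul_sum, Finset.sum_comm,
    Finset.sum_congr rfl fun (r : ℕ) _ ↦ sum_exp_mul_div hm ((n : ℤ) - r)]
  -- exactly one `r < m` is congruent to `n`
  have h4 : (∑ r ∈ Finset.range m with r.Coprime m, if (m : ℤ) ∣ n - r then (m : ℂ) else 0) =
      if n.Coprime m then (m : ℂ) else 0 := by
    have hmod (r : ℕ) (hr : r < m) : (m : ℤ) ∣ n - r ↔ r = n % m := by
      rw [← Int.modEq_iff_dvd, Int.natCast_modEq_iff, Nat.ModEq, Nat.mod_eq_of_lt hr]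
    have hcop : (n % m).Coprime m ↔ n.Coprime m := by
      rw [Nat.coprime_iff_gcd_eq_one, Nat.coprime_iff_gcd_eq_one, ← Nat.gcd_rec, Nat.gcd_comm]
    split_ifs with hn
    · rw [Finset.sum_eq_single (n % m)]
      · rw [if_pos ((hmod _ (Nat.mod_lt _ (Nat.pos_of_ne_zero hm))).mpr rfl)]
      · intro r hr hne
        exact if_neg fun h ↦ hne ((hmod r (Finset.mem_range.mp (Finset.mem_filter.mp hr).1)).mp h)
      · intro h
        exact absurd (Finset.mem_filter.mpr ⟨Finset.mem_range.mpr
          (Nat.mod_lt _ (Nat.pos_of_ne_zero hm)), hcop.mpr hn⟩) h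
    · refine Finset.sum_eq_zero fun r hr ↦ if_neg fun h ↦ hn ?_
      rw [Finset.mem_filter, Finset.mem_range] at hr
      rw [← hcop, ← (hmod r hr.1).mp h]
      exact hr.2
  rw [h4, PowerSeries.coeff_mk]
  split_ifs
  · field_simp
  · simp

lemma coprimePart_slash {m : ℕ} {φ : ℍ → ℂ} {g : GL (Fin 2) ℝ} (hg : 0 < g.det.val)
    (h : ∀ k : ℕ,
      (φ ∣[(2 : ℤ)] g) ∣[(2 : ℤ)] uMat (k / m) = (φ ∣[(2 : ℤ)] uMat (k / m)) ∣[(2 : ℤ)] g) :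
    coprimePart m (φ ∣[(2 : ℤ)] g) = coprimePart m φ ∣[(2 : ℤ)] g := by
  rw [coprimePart, coprimePart, SlashAction.sum_slash]
  refine Finset.sum_congr rfl fun k _ ↦ ?_
  rw [h, ModularForm.smul_slash, UpperHalfPlane.σ, if_pos hg]
  rfl

lemma coprimePart_sum {m : ℕ} {ι : Type*} (S : Finset ι) (φ : ι → ℍ → ℂ) :
    coprimePart m (∑ i ∈ S, φ i) = ∑ i ∈ S, coprimePart m (φ i) := by
  simp only [coprimePart, SlashAction.sum_slash, Finset.smul_sum]
  rw [Finset.sum_comm]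

/-- Conjugation of the commutator of a translation and a lower triangular matrix. -/
lemma commutator_mem {N : ℕ} {p M m M' k s : ℤ} (hN : (N : ℤ) = p * M) (hM : M = m * M')
    (hm : m ≠ 0) (hp : p ≠ 0) (g : GL (Fin 2) ℝ)
    (hg : g.val = !![(1 + s * M ^ 2 : ℝ), s / p; p * M ^ 2, 1]) :
    ∃ γ ∈ Γ₀ N, g * uMat (k / m) = γ * (uMat (k / m) * g) := by
  have hmR : (m : ℝ) ≠ 0 := by exact_mod_cast hm
  have hpR : (p : ℝ) ≠ 0 := by exact_mod_cast hp
  set w := M * M' * k with hw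
  have hdet : (1 - p * w - s * p * M ^ 2 * w) * (1 + p * w + p ^ 2 * w ^ 2 + s * p * M ^ 2 * w) -
      (p * M' ^ 2 * k ^ 2 + s * (2 * w + p * w ^ 2) + s ^ 2 * M ^ 2 * w) * (-p ^ 2 * M ^ 2 * w) =
      1 := by
    rw [hw]; ring
  refine ⟨slMk _ _ _ _ hdet, slMk_mem hdet ⟨-p * M * w, by rw [hN]; ring⟩, ?_⟩
  apply Units.ext
  rw [Units.val_mul, Units.val_mul, Units.val_mul, slMk_val, hg]
  have hMR : (M : ℝ) = m * M' := by exact_mod_cast hM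
  ext i j
  fin_cases i <;> fin_cases j <;>
    simp [uMat, Matrix.mul_apply, Fin.sum_univ_two, hw, hMR] <;> field_simp <;> ring

/-- The conjugate of a lower triangular matrix by a translation. -/
lemma conj_lower_mem {N : ℕ} {p M m M' k : ℤ} (hN : (N : ℤ) = p * M) (hM : M = m * M')
    (hm : m ≠ 0) :
    ∃ γ ∈ Γ₀ N, uMat (k / m) * lMat (p * M ^ 2) = γ * uMat (k / m) := by
  have hmR : (m : ℝ) ≠ 0 := by exact_mod_cast hm
  have hdet : (1 + p * M * M' * k) * (1 - p * M * M' * k) - (-(p * M' ^ 2 * k ^ 2)) * (p * M ^ 2) =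
      1 := by ring
  refine ⟨slMk _ _ _ _ hdet, slMk_mem hdet ⟨M, by rw [hN]; ring⟩, ?_⟩
  apply Units.ext
  rw [Units.val_mul, Units.val_mul, slMk_val]
  have hMR : (M : ℝ) = m * M' := by exact_mod_cast hM
  ext i j
  fin_cases i <;> fin_cases j <;>
    simp [uMat, lMat, Matrix.mul_apply, Fin.sum_univ_two, hMR] <;> field_simp <;> ring

lemma slash_eq_of_mul {N : ℕ} (f : S₂ N) {g g' γ : GL (Fin 2) ℝ} (hγ : γ ∈ Γ₀ N)
    (h : g = γ * g') : (f : ℍ → ℂ) ∣[(2 : ℤ)] g = (f : ℍ → ℂ) ∣[(2 : ℤ)] g' := by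
  rw [h, SlashAction.slash_mul, SlashInvariantFormClass.slash_action_eq f _ hγ]

/-- A function whose Fourier expansion is supported on the multiples of `p` is invariant under
translation by `1 / p`. -/
lemma HasQExp.slash_uMat_eq {φ : ℍ → ℂ} {s : PowerSeries ℂ} (h : HasQExp φ s) {p : ℕ} (hp : p ≠ 0)
    (hs : ∀ n, ¬ p ∣ n → s.coeff n = 0) (j : ℤ) : φ ∣[(2 : ℤ)] uMat (j / p) = φ := by
  have hp' : (p : ℂ) ≠ 0 := by exact_mod_cast hp
  ext τ
  rw [slash_uMat]
  refine (h _).unique ((h τ).congr_fun fun n ↦ ?_)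
  by_cases hn : p ∣ n
  · obtain ⟨m, rfl⟩ := hn
    rw [qParam_vadd, mul_pow, ← Complex.exp_nat_mul]
    have : Complex.exp (((p * m : ℕ) : ℂ) * (2 * Real.pi * Complex.I * ((j / p : ℝ) : ℂ))) = 1 := by
      rw [Complex.exp_eq_one_iff]
      refine ⟨m * j, ?_⟩
      push_cast
      field_simp
    rw [this, one_mul]
  · simp [hs n hn]

lemma det_glMk_pos {a b c d : ℝ} (h) (hpos : 0 < a * d - b * c) : 0 < (glMk a b c d h).det.val := by
  rw [Matrix.GeneralLinearGroup.val_det_apply]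
  simpa using hpos

lemma det_uMat_pos (y : ℝ) : 0 < (uMat y).det.val := det_glMk_pos _ (by simp)

lemma det_lMat_pos (x : ℝ) : 0 < (lMat x).det.val := det_glMk_pos _ (by simp)

/-- The Fourier expansion as a linear map. -/
def qExpLin (N : ℕ) : S₂ N →ₗ[ℂ] PowerSeries ℂ where
  toFun f := qExpansion 1 f
  map_add' f g := (HasQExp.eq_qExpansion (one_mem_strictPeriods_Γ₀ N) (f := f + g)
    ((hasQExp_qExpansion (one_mem_strictPeriods_Γ₀ N) f).add
      (hasQExp_qExpansion (one_mem_strictPeriods_Γ₀ N) g))).symm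
  map_smul' c f := (HasQExp.eq_qExpansion (one_mem_strictPeriods_Γ₀ N) (f := c • f)
    ((hasQExp_qExpansion (one_mem_strictPeriods_Γ₀ N) f).smul c)).symm

lemma qExpLin_apply {N : ℕ} (f : S₂ N) : qExpLin N f = qExpansion 1 f := rfl

lemma HasQExp.unique {φ : ℍ → ℂ} {s t : PowerSeries ℂ} (hs : HasQExp φ s) (ht : HasQExp φ t) :
    s = t := by
  have h := hs.sub ht
  rw [sub_self] at h
  have h1 := HasQExp.eq_qExpansion (one_mem_strictPeriods_Γ₀ 1) (f := (0 : S₂ 1)) h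
  have h2 := HasQExp.eq_qExpansion (one_mem_strictPeriods_Γ₀ 1) (f := (0 : S₂ 1)) HasQExp.zero
  exact sub_eq_zero.mp (h1.trans h2.symm)

lemma coprimePart_slash_eq {m : ℕ} {φ : ℍ → ℂ} {g : GL (Fin 2) ℝ} (hg : 0 < g.det.val)
    (h : ∀ k : ℕ, (φ ∣[(2 : ℤ)] uMat (k / m)) ∣[(2 : ℤ)] g = φ ∣[(2 : ℤ)] uMat (k / m)) :
    coprimePart m φ ∣[(2 : ℤ)] g = coprimePart m φ := by
  rw [coprimePart, SlashAction.sum_slash]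
  refine Finset.sum_congr rfl fun k _ ↦ ?_
  rw [ModularForm.smul_slash, h, UpperHalfPlane.σ, if_pos hg]
  rfl

lemma coprimePart_smul {m : ℕ} (c : ℂ) (φ : ℍ → ℂ) :
    coprimePart m (c • φ) = c • coprimePart m φ := by
  rw [coprimePart, coprimePart, Finset.smul_sum]
  refine Finset.sum_congr rfl fun k _ ↦ ?_
  rw [ModularForm.smul_slash, UpperHalfPlane.σ, if_pos (det_uMat_pos _), smul_comm]
  rfl

lemma heckeMat_inv (p : ℕ) [NeZero p] :
    (heckeMat p)⁻¹ = glMk 1 0 0 (p : ℝ)⁻¹ (by simpa using NeZero.ne p) :=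
  Units.ext (heckeMat_inv_val p)

section

variable {N : ℕ} [NeZero N]

/-- The inductive step for `mem_oldforms_of_coeff_eq_zero`. The trace `h` of `f ∣ diag(1, p)` to
level `N / p` gives an oldform `h(p τ)`, a sum of forms `f ∣ g`, where `g` is a translation by a
multiple of `1 / p` or a product of such a translation and a lower triangular matrix. On the parts
with Fourier coefficients of index prime to `m`, each `g` acts trivially: translations by `1 / p`
because of the hypothesis on `f`, the lower triangular matrix because its
conjugates by translations by multiples of `1 / m` lie in `Γ₀(N)`. -/
lemma exists_oldform_coprimePart_eq (f : S₂ N) {p m M : ℕ} (hp : p.Prime) (hN : N = p * M)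
    (hm : m ∣ M) (hf : ∀ n, n.Coprime m → ¬ p ∣ n → (qExpansion 1 f).coeff n = 0) :
    ∃ g ∈ oldforms N, ∀ n, n.Coprime m →
      (qExpansion 1 g).coeff n = (qExpansion 1 f).coeff n := by
  have hN0 := NeZero.ne N
  have hM0 : M ≠ 0 := by rintro rfl; exact hN0 (by simp [hN])
  have : NeZero M := ⟨hM0⟩
  have : NeZero p := ⟨hp.ne_zero⟩
  have hm0 : m ≠ 0 := by rintro rfl; exact hM0 (zero_dvd_iff.mp hm)
  obtain ⟨M', hM'⟩ := hm
  have hpR : (p : ℝ) ≠ 0 := by exact_mod_cast hp.ne_zero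
  have hfq := hasQExp_qExpansion (one_mem_strictPeriods_Γ₀ N) f
  set F := coprimePart m f with hF
  have hFq := hfq.coprimePart hm0
  -- `F` is invariant under translation by `1 / p`
  have hFu (j : ℤ) : F ∣[(2 : ℤ)] uMat (j / p) = F := by
    refine hFq.slash_uMat_eq hp.ne_zero (fun n hn ↦ ?_) j
    rw [PowerSeries.coeff_mk]
    split_ifs with h
    · exact hf n h hn
    · rfl
  -- The conjugate of this matrix by a translation by `k / m` lies in `Γ₀(N)`.
  have hFl : F ∣[(2 : ℤ)] lMat (p * M ^ 2) = F := by
    refine coprimePart_slash_eq (det_lMat_pos _) fun k ↦ ?_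
    obtain ⟨γ, hγ, h⟩ := conj_lower_mem (N := N) (p := p) (M := M) (m := m) (M' := M') (k := k)
      (by exact_mod_cast hN) (by exact_mod_cast hM') (by exact_mod_cast hm0)
    rw [← SlashAction.slash_mul]
    exact slash_eq_of_mul f hγ (by simpa only [Int.cast_natCast] using h)
  -- If each term of the sum over coset representatives has the same part prime to `m` as `f`,
  -- so has a multiple of the oldform.
  have key {ι : Type} [Fintype ι] [Nonempty ι] (k : ι → GL (Fin 2) ℝ) (hk : IsCosetReps M p k)
      (hinv : ∀ i, coprimePart m
        ((f : ℍ → ℂ) ∣[(2 : ℤ)] (heckeMat p * k i * (heckeMat p)⁻¹)) = F) :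
      ∃ g ∈ oldforms N, ∀ n, n.Coprime m →
        (qExpansion 1 g).coeff n = (qExpansion 1 f).coeff n := by
    obtain ⟨α, hα⟩ : ∃ α : Δ₀ N, α.val = heckeMat p := ⟨⟨_, heckeMat_mem N p⟩, rfl⟩
    set h : S₂ M := CuspForm.trace (Γ₀ M) (CuspForm.translate f α.val)
    have hsum : (h : ℍ → ℂ) = ∑ i, (f : ℍ → ℂ) ∣[(2 : ℤ)] (heckeMat p * k i) :=
      trace_translate_eq_sum hN.dvd hk f α hα
    have hMp : M * p ∣ N := by rw [hN, mul_comm]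
    have hold : (p : ℂ) • ⇑(oldMap hMp h) =
        ∑ i, (f : ℍ → ℂ) ∣[(2 : ℤ)] (heckeMat p * k i * (heckeMat p)⁻¹) := by
      simp_rw [SlashAction.slash_mul _ _ (heckeMat p)⁻¹]
      rw [← SlashAction.sum_slash, ← hsum, heckeMat_inv]
      ext τ
      obtain ⟨τ', hτ, -⟩ := exists_affine τ (natCast_pos_of_neZero p) one_pos 0
      have hτ : (τ' : ℂ) = p * τ := by simpa using hτ
      have hp0 := natCast_pos_of_neZero p
      rw [Pi.smul_apply, oldMap_apply hMp h hτ, slash_upper _ one_pos (by positivity) _ (τ' := τ')]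
      · simp
      · rw [hτ]; simp [mul_comm]
    have hι : (Fintype.card ι : ℂ) ≠ 0 := by exact_mod_cast Fintype.card_ne_zero
    have hne : M ≠ N := fun hMN ↦ by
      rw [hMN] at hN
      have := hp.two_le
      have := Nat.pos_of_ne_zero hN0
      nlinarith
    refine ⟨((p : ℂ) / Fintype.card ι) • oldMap hMp h,
      Submodule.smul_mem _ _ (oldMap_mem_oldforms hMp hne h), fun n hn ↦ ?_⟩
    have hc : coprimePart m (((p : ℂ) / Fintype.card ι) • oldMap hMp h : S₂ N) = F := by
      have : ⇑(((p : ℂ) / Fintype.card ι) • oldMap hMp h : S₂ N) =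
          (Fintype.card ι : ℂ)⁻¹ • ((p : ℂ) • ⇑(oldMap hMp h)) := by
        rw [smul_smul, FunLike.coe_smul]
        congr 1
        ring
      rw [this, coprimePart_smul, hold, coprimePart_sum, Finset.sum_congr rfl fun i _ ↦ hinv i]
      simp only [Finset.sum_const, Finset.card_univ, ← Nat.cast_smul_eq_nsmul ℂ, smul_smul]
      rw [inv_mul_cancel₀ hι, one_smul]
    have h1 := (hasQExp_qExpansion (one_mem_strictPeriods_Γ₀ N)
      (((p : ℂ) / Fintype.card ι) • oldMap hMp h : S₂ N)).coprimePart hm0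
    rw [hc] at h1
    have h2 := congr_arg (PowerSeries.coeff n) (h1.unique hFq)
    simpa only [PowerSeries.coeff_mk, if_pos hn] using h2
  have hconj (j : ℤ) : heckeMat p * slMk 1 j 0 1 (by simp) * (heckeMat p)⁻¹ = uMat (j / p) := by
    apply Units.ext
    rw [heckeMat_conj_val p (slMk_val _)]
    simp [uMat]
  have htrans (j : ℤ) : coprimePart m ((f : ℍ → ℂ) ∣[(2 : ℤ)] uMat (j / p)) = F := by
    rw [coprimePart_slash (det_uMat_pos _), hFu]
    intro k
    rw [← SlashAction.slash_mul, ← SlashAction.slash_mul, uMat_mul, uMat_mul, add_comm]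
  by_cases hpM : p ∣ M
  · have : Nonempty (Fin p) := ⟨⟨0, hp.pos⟩⟩
    exact key _ (isCosetReps_of_dvd hp hpM) fun j ↦ by rw [hconj]; exact htrans j
  · obtain ⟨s, hs⟩ := exists_dvd_one_add hp hpM
    refine key _ (isCosetReps_of_not_dvd hp hs) fun j ↦ ?_
    cases j with
    | some j => simp only [Option.elim]; rw [hconj]; exact htrans j
    | none =>
      simp only [Option.elim]
      set g := heckeMat p * slMk (1 + s * M ^ 2) s (M ^ 2) 1 (by ring) * (heckeMat p)⁻¹ with hg
      have hgval : g.val = !![(1 + s * M ^ 2 : ℝ), s / p; p * M ^ 2, 1] := by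
        rw [hg, heckeMat_conj_val p (slMk_val _)]
        push_cast
        rfl
      have hgul : g = uMat (s / p) * lMat (p * M ^ 2) := by
        apply Units.ext
        rw [hgval, Units.val_mul]
        ext i j
        fin_cases i <;> fin_cases j <;> simp [uMat, lMat, Matrix.mul_apply, Fin.sum_univ_two]
        field_simp
      rw [coprimePart_slash]
      · rw [← hF, hgul, SlashAction.slash_mul, hFu, hFl]
      · rw [hgul, map_mul]
        exact mul_pos (det_uMat_pos _) (det_lMat_pos _)
      · intro k
        -- the commutator of `g` with a translation by `k / m` lies in `Γ₀(N)`
        obtain ⟨γ, hγ, h⟩ := commutator_mem (N := N) (p := p) (M := M) (m := m) (M' := M') (k := k)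
          (s := s) (by exact_mod_cast hN) (by exact_mod_cast hM') (by exact_mod_cast hm0)
          (by exact_mod_cast hp.ne_zero) g (by exact_mod_cast hgval)
        rw [← SlashAction.slash_mul, ← SlashAction.slash_mul]
        exact slash_eq_of_mul f hγ (by simpa only [Int.cast_natCast] using h)

/-- A cusp form whose Fourier coefficients of index prime to the level vanish is an oldform
(Atkin and Lehner). -/
lemma mem_oldforms_of_coeff_eq_zero (f : S₂ N)
    (hf : ∀ n, n.Coprime N → (qExpansion 1 f).coeff n = 0) : f ∈ oldforms N := by
  suffices ∀ m : ℕ, m ∣ N → ∀ f : S₂ N, (∀ n, n.Coprime m → (qExpansion 1 f).coeff n = 0) →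
      f ∈ oldforms N from this N dvd_rfl f hf
  intro m
  induction m using Nat.strong_induction_on with | _ m ih =>
  intro hmN f hf
  have hm0 : m ≠ 0 := by rintro rfl; exact NeZero.ne N (zero_dvd_iff.mp hmN)
  rcases eq_or_ne m 1 with rfl | hm1
  · have : f = 0 := by
      apply eq_of_qExpansion_eq
      ext n
      rw [hf n (Nat.coprime_one_right n)]
      simp [qExpansion_zero]
    rw [this]
    exact zero_mem _
  obtain ⟨p, hp, hpm⟩ := Nat.exists_prime_and_dvd hm1
  obtain ⟨M, hM⟩ := hpm.trans hmN
  -- Remove all factors `p` from `m` at once.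
  set m' := ordCompl[p] m with hm'
  have hcop : p.Coprime m' := Nat.coprime_ordCompl hp hm0
  have hm'm : m' ∣ m := Nat.ordCompl_dvd m p
  have hm'M : m' ∣ M := hcop.symm.dvd_of_dvd_mul_left (hM ▸ hm'm.trans hmN)
  obtain ⟨g, hg, hgf⟩ := exists_oldform_coprimePart_eq f hp hM hm'M fun n hn hpn ↦ by
    refine hf n ?_
    rw [← Nat.ordProj_mul_ordCompl_eq_self m p]
    exact Nat.Coprime.mul_right (((Nat.Prime.coprime_iff_not_dvd hp).mpr hpn).symm.pow_right _) hn
  have hlt : m' < m := lt_of_le_of_ne (Nat.le_of_dvd (Nat.pos_of_ne_zero hm0) hm'm) fun h ↦ by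
    rw [h] at hcop
    exact hp.one_lt.ne' (hcop.eq_one_of_dvd hpm)
  have := ih m' hlt (hm'm.trans hmN) (f - g) fun n hn ↦ by
    rw [← qExpLin_apply, map_sub, map_sub, qExpLin_apply, qExpLin_apply, hgf n hn, sub_self]
  rw [← sub_add_cancel f g]
  exact add_mem this hg

end

/-! ### Integration over quotients of the upper half-plane -/

section

open scoped ENNReal

/-- Sum over a group by cosets of a subgroup. -/
lemma tsum_subgroup_quotient {A : Type*} [Group A] (s : Subgroup A) (φ : A → ℝ≥0∞) :
    ∑' l : s, ∑' q : A ⧸ s, φ (q.out * l) = ∑' a, φ a := by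
  rw [ENNReal.tsum_comm, ← ENNReal.tsum_prod]
  refine Equiv.tsum_eq (Equiv.ofBijective (fun x : (A ⧸ s) × s ↦ x.1.out * (x.2 : A))
    ⟨?_, fun a ↦ ?_⟩) φ
  · rintro ⟨q, l⟩ ⟨q', l'⟩ h
    have hq (q : A ⧸ s) (l : s) : (QuotientGroup.mk (q.out * (l : A)) : A ⧸ s) = q := by
      rw [QuotientGroup.mk_mul_of_mem _ l.2, QuotientGroup.out_eq']
    have h1 : q = q' := by
      rw [← hq q l, ← hq q' l']
      exact congrArg _ h
    subst h1
    simpa using h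
  · obtain ⟨l, hl⟩ := QuotientGroup.mk_out_eq_mul s a
    refine ⟨(QuotientGroup.mk a, l⁻¹), ?_⟩
    change (QuotientGroup.mk a : A ⧸ s).out * ((l⁻¹ : s) : A) = a
    rw [hl]
    simp

/-- A weight function `Φ` on `ℍ` whose translates under `Λ` sum up to `2` almost everywhere. If
`-1 ∈ Λ`, then `γ` and `-γ` contribute equally, and integrating a `Λ`-invariant function against `Φ`
gives its integral over `Λ \ ℍ`. -/
structure IsWeight (Λ : Subgroup (GL (Fin 2) ℝ)) (Φ : ℍ → ℝ≥0∞) : Prop where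
  measurable : Measurable Φ
  tsum_eq : ∀ᵐ τ : ℍ, ∑' γ : Λ, Φ ((γ : GL (Fin 2) ℝ) • τ) = 2

lemma lintegral_comp_smul (g : GL (Fin 2) ℝ) {φ : ℍ → ℝ≥0∞} :
    ∫⁻ τ : ℍ, φ (g • τ) = ∫⁻ τ, φ τ :=
  (measurePreserving_smul g (volume : Measure ℍ)).lintegral_comp_emb
    (measurableEmbedding_const_smul g) φ

lemma withDensity_comp_smul (g : GL (Fin 2) ℝ) {Φ : ℍ → ℝ≥0∞} :
    ((volume : Measure ℍ).withDensity fun τ ↦ Φ (g • τ)).map (g • ·) =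
      (volume : Measure ℍ).withDensity Φ := by
  ext s hs
  rw [Measure.map_apply (measurable_const_smul g) hs, withDensity_apply _
    (measurable_const_smul g hs), withDensity_apply _ hs, ← lintegral_indicator
    (measurable_const_smul g hs), ← lintegral_indicator hs,
    ← lintegral_comp_smul g (φ := s.indicator Φ)]
  rfl

lemma integral_withDensity_comp_smul (g : GL (Fin 2) ℝ) {Φ : ℍ → ℝ≥0∞}
    (F : ℍ → ℂ) :
    ∫ τ, F (g • τ) ∂((volume : Measure ℍ).withDensity fun τ ↦ Φ (g • τ)) =
      ∫ τ, F τ ∂((volume : Measure ℍ).withDensity Φ) := by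
  rw [← withDensity_comp_smul g (Φ := Φ), (measurableEmbedding_const_smul g).integral_map]

/-- Unfolding with one weight function and folding with the other. -/
lemma IsWeight.lintegral_eq {Λ : Subgroup (GL (Fin 2) ℝ)} [Countable Λ] {Φ Ψ : ℍ → ℝ≥0∞}
    (hΦ : IsWeight Λ Φ) (hΨ : IsWeight Λ Ψ) {F : ℍ → ℝ≥0∞} (hF : Measurable F)
    (hinv : ∀ γ ∈ Λ, ∀ τ, F (γ • τ) = F τ) :
    ∫⁻ τ, F τ * Φ τ = ∫⁻ τ, F τ * Ψ τ := by
  have h1 : ∫⁻ τ, F τ * Φ τ * 2 = ∫⁻ τ, F τ * Ψ τ * 2 := by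
    calc ∫⁻ τ, F τ * Φ τ * 2
        = ∫⁻ τ, ∑' γ : Λ, F τ * Φ τ * Ψ ((γ : GL (Fin 2) ℝ) • τ) := by
          refine lintegral_congr_ae ?_
          filter_upwards [hΨ.tsum_eq] with τ hτ
          rw [ENNReal.tsum_mul_left, hτ]
      _ = ∑' γ : Λ, ∫⁻ τ, F τ * Φ τ * Ψ ((γ : GL (Fin 2) ℝ) • τ) :=
          lintegral_tsum fun γ ↦ ((hF.mul hΦ.measurable).mul
            (hΨ.measurable.comp (measurable_const_smul _))).aemeasurable
      _ = ∑' γ : Λ, ∫⁻ τ, F τ * Ψ τ * Φ ((γ⁻¹ : GL (Fin 2) ℝ) • τ) := by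
          refine tsum_congr fun γ ↦ ?_
          rw [← lintegral_comp_smul (γ : GL (Fin 2) ℝ)
            (φ := fun τ ↦ F τ * Ψ τ * Φ ((γ⁻¹ : GL (Fin 2) ℝ) • τ))]
          refine lintegral_congr fun τ ↦ ?_
          rw [hinv γ γ.2, inv_smul_smul]
          ring
      _ = ∑' γ : Λ, ∫⁻ τ, F τ * Ψ τ * Φ ((γ : GL (Fin 2) ℝ) • τ) :=
          (Equiv.inv Λ).tsum_eq fun γ : Λ ↦ ∫⁻ τ, F τ * Ψ τ * Φ ((γ : GL (Fin 2) ℝ) • τ)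
      _ = ∫⁻ τ, ∑' γ : Λ, F τ * Ψ τ * Φ ((γ : GL (Fin 2) ℝ) • τ) :=
          (lintegral_tsum fun γ ↦ ((hF.mul hΨ.measurable).mul
            (hΦ.measurable.comp (measurable_const_smul _))).aemeasurable).symm
      _ = ∫⁻ τ, F τ * Ψ τ * 2 := by
          refine lintegral_congr_ae ?_
          filter_upwards [hΦ.tsum_eq] with τ hτ
          rw [ENNReal.tsum_mul_left, hτ]
  rw [lintegral_mul_const (f := fun τ ↦ F τ * Φ τ) _ (hF.mul hΦ.measurable),
    lintegral_mul_const (f := fun τ ↦ F τ * Ψ τ) _ (hF.mul hΨ.measurable)] at h1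
  exact (ENNReal.mul_left_inj (by norm_num) (by norm_num)).mp h1

/-- The integral of an invariant function does not depend on the weight function. No integrability
is needed: the two measures have the same image under `F`. -/
lemma IsWeight.integral_eq {Λ : Subgroup (GL (Fin 2) ℝ)} [Countable Λ] {Φ Ψ : ℍ → ℝ≥0∞}
    (hΦ : IsWeight Λ Φ) (hΨ : IsWeight Λ Ψ) {F : ℍ → ℂ} (hF : Measurable F)
    (hinv : ∀ γ ∈ Λ, ∀ τ, F (γ • τ) = F τ) :
    ∫ τ, F τ ∂((volume : Measure ℍ).withDensity Φ) =
      ∫ τ, F τ ∂((volume : Measure ℍ).withDensity Ψ) := by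
  have h1 : ((volume : Measure ℍ).withDensity Φ).map F =
      ((volume : Measure ℍ).withDensity Ψ).map F := by
    ext s hs
    have h2 (Φ : ℍ → ℝ≥0∞) : ((volume : Measure ℍ).withDensity Φ).map F s =
        ∫⁻ τ, s.indicator 1 (F τ) * Φ τ := by
      rw [Measure.map_apply hF hs, withDensity_apply _ (hF hs), ← lintegral_indicator (hF hs)]
      refine lintegral_congr fun τ ↦ ?_
      by_cases hτ : F τ ∈ s
      · rw [Set.indicator_of_mem (by exact hτ), Set.indicator_of_mem hτ, Pi.one_apply, one_mul]
      · rw [Set.indicator_of_notMem (by exact hτ), Set.indicator_of_notMem hτ, zero_mul]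
    rw [h2, h2]
    refine hΦ.lintegral_eq hΨ ((measurable_one.indicator hs).comp hF) fun γ hγ τ ↦ ?_
    simp only [hinv γ hγ]
  have h3 (Φ : ℍ → ℝ≥0∞) : ∫ τ, F τ ∂((volume : Measure ℍ).withDensity Φ) =
      ∫ z, z ∂((volume : Measure ℍ).withDensity Φ).map F :=
    (integral_map (f := fun z : ℂ ↦ z) hF.aemeasurable aestronglyMeasurable_id).symm
  rw [h3, h3, h1]

/-- Summing a weight function over cosets gives one for a subgroup. -/
lemma IsWeight.subgroup {Λ : Subgroup (GL (Fin 2) ℝ)} {Φ : ℍ → ℝ≥0∞} (hΦ : IsWeight Λ Φ)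
    (s : Subgroup Λ) [Countable (Λ ⧸ s)] :
    IsWeight (s.map Λ.subtype)
      fun τ ↦ ∑' q : Λ ⧸ s, Φ ((q.out : GL (Fin 2) ℝ) • τ) := by
  refine ⟨Measurable.tsum fun q ↦ hΦ.measurable.comp (measurable_const_smul _), ?_⟩
  filter_upwards [hΦ.tsum_eq] with τ hτ
  rw [← hτ, ← tsum_subgroup_quotient s]
  refine (Equiv.tsum_eq (s.equivMapOfInjective Λ.subtype Subtype.coe_injective).toEquiv
    _).symm.trans (tsum_congr fun l ↦ tsum_congr fun q ↦ ?_)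
  rw [smul_smul]
  rfl

lemma IsWeight.conj {Λ Λ' : Subgroup (GL (Fin 2) ℝ)} {Φ : ℍ → ℝ≥0∞} (hΦ : IsWeight Λ Φ)
    (g : GL (Fin 2) ℝ) (hg : ∀ γ, γ ∈ Λ' ↔ g * γ * g⁻¹ ∈ Λ) :
    IsWeight Λ' fun τ ↦ Φ (g • τ) := by
  refine ⟨hΦ.measurable.comp (measurable_const_smul _), ?_⟩
  have h := (measurePreserving_smul g (volume : Measure ℍ)).quasiMeasurePreserving.ae hΦ.tsum_eq
  filter_upwards [h] with τ hτ
  rw [← hτ]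
  refine (tsum_congr fun γ ↦ ?_).trans (((MulAut.conj g).toEquiv.subtypeEquiv hg).tsum_eq
    fun γ : Λ ↦ Φ ((γ : GL (Fin 2) ℝ) • g • τ))
  simp [smul_smul]

end

section

open scoped ENNReal

/-- Moving a sum of translates from the integrand to the weight function. -/
lemma sum_integral_inv_smul {ι : Type*} [Fintype ι] (r : ι → GL (Fin 2) ℝ) {Φ : ℍ → ℝ≥0∞}
    (hΦ : Measurable Φ) {F : ℍ → ℂ}
    (hF : ∀ i, Integrable (fun τ ↦ F ((r i)⁻¹ • τ)) ((volume : Measure ℍ).withDensity Φ)) :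
    ∑ i, ∫ τ, F ((r i)⁻¹ • τ) ∂((volume : Measure ℍ).withDensity Φ) =
      ∫ τ, F τ ∂((volume : Measure ℍ).withDensity fun τ ↦ ∑' i, Φ (r i • τ)) := by
  have h1 : (fun τ ↦ ∑' i, Φ (r i • τ)) = ∑' i, fun τ ↦ Φ (r i • τ) := by
    ext τ
    rw [ENNReal.tsum_apply]
  have h2 (i : ι) : Integrable F ((volume : Measure ℍ).withDensity fun τ ↦ Φ (r i • τ)) := by
    have h3 := hF i
    rw [← withDensity_comp_smul (r i) (Φ := Φ),
      (measurableEmbedding_const_smul (r i)).integrable_map_iff] at h3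
    simpa [Function.comp_def] using h3
  rw [h1, withDensity_tsum (f := fun i τ ↦ Φ (r i • τ)) fun i ↦
      hΦ.comp (measurable_const_smul (r i)), Measure.sum_fintype,
    integral_finsetSum_measure fun i _ ↦ h2 i]
  refine Finset.sum_congr rfl fun i _ ↦ ?_
  rw [← integral_withDensity_comp_smul (r i)]
  simp

/-- The fundamental domain lies in the half-strip `|x| ≤ 1`, `y > 1 / 2`, of finite hyperbolic
area. -/
lemma volume_fd_ne_top : (volume : Measure ℍ) 𝒟 ≠ ⊤ := by
  have hmeas : MeasurableSet ((↑) '' 𝒟 : Set ℂ) :=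
    ModularGroup.isClosed_coe_fd.measurableSet
  rw [volume_eq_lintegral]
  have hsub : ((↑) '' 𝒟 : Set ℂ) ⊆
      Complex.measurableEquivRealProd ⁻¹' (Set.Icc (-1) 1 ×ˢ Set.Ioi (1 / 2)) := by
    rintro _ ⟨τ, hτ, rfl⟩
    have h1 := ModularGroup.three_le_four_mul_im_sq_of_mem_fd hτ
    have h2 := abs_le.mp hτ.2
    have h3 := τ.im_pos
    simp only [Set.mem_preimage, Complex.measurableEquivRealProd_apply, Set.mem_prod,
      Set.mem_Icc, Set.mem_Ioi, coe_re, coe_im]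
    refine ⟨⟨by linarith [h2.1], by linarith [h2.2]⟩, ?_⟩
    nlinarith
  refine ((lintegral_mono_set hsub).trans_lt ?_).ne
  change ∫⁻ x in Complex.measurableEquivRealProd ⁻¹' (Set.Icc (-1) 1 ×ˢ Set.Ioi (1 / 2)),
    (fun x : ℝ × ℝ ↦ (((1 / ‖x.2‖₊) ^ 2 : NNReal) : ℝ≥0∞)) (Complex.measurableEquivRealProd x) < ⊤
  rw [Complex.volume_preserving_equiv_real_prod.setLIntegral_comp_preimage_emb
    Complex.measurableEquivRealProd.measurableEmbedding
    (fun x : ℝ × ℝ ↦ (((1 / ‖x.2‖₊) ^ 2 : NNReal) : ℝ≥0∞)), Measure.volume_eq_prod,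
    ← Measure.prod_restrict, lintegral_prod _ (by fun_prop)]
  have h1 : ∫⁻ y : ℝ in Set.Ioi (1 / 2), (((1 / ‖y‖₊) ^ 2 : NNReal) : ℝ≥0∞) < ⊤ := by
    have h2 := (integrableOn_Ioi_rpow_of_lt (a := -2) (by norm_num) (c := 1 / 2)
      (by norm_num)).2
    refine lt_of_eq_of_lt (setLIntegral_congr_fun measurableSet_Ioi fun y hy ↦ ?_) h2
    have hy' : (0 : ℝ) < y := lt_trans (by norm_num) hy
    rw [enorm_eq_nnnorm]
    congr 1
    ext
    simp [abs_of_pos hy', Real.rpow_neg hy'.le]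
  change ∫⁻ _ in Set.Icc (-1 : ℝ) 1,
    ∫⁻ y : ℝ in Set.Ioi (1 / 2), (((1 / ‖y‖₊) ^ 2 : NNReal) : ℝ≥0∞) < ⊤
  rw [lintegral_const]
  refine ENNReal.mul_lt_top h1 (by simp)

lemma volume_fd_diff_fdo : (volume : Measure ℍ) (𝒟 \ 𝒟ᵒ) = 0 := by
  rw [volume_eq_lintegral]
  refine setLIntegral_measure_zero _ _ ?_
  refine measure_mono_null (t := Metric.sphere (0 : ℂ) 1 ∪ (frontier {z : ℂ | z.re < 1 / 2} ∪
    frontier {z : ℂ | z.re < -(1 / 2)})) ?_ ?_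
  · rintro _ ⟨τ, ⟨hτ, hτ'⟩, rfl⟩
    have h0 : ¬ (1 < Complex.normSq τ ∧ |τ.re| < 1 / 2) := hτ'
    rw [Complex.frontier_setOfPred_re_lt, Complex.frontier_setOfPred_re_lt]
    simp only [Set.mem_union, mem_sphere_zero_iff_norm, Set.mem_ofPred_eq, coe_re]
    rcases hτ.1.eq_or_lt with h1 | h1
    · left
      rw [Complex.normSq_eq_norm_sq] at h1
      nlinarith [norm_nonneg (τ : ℂ)]
    · have h2 : |τ.re| = 1 / 2 := le_antisymm hτ.2 (not_lt.mp fun h ↦ h0 ⟨h1, h⟩)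
      right
      exact (abs_eq (by norm_num)).mp h2
  · refine measure_union_null ?_ (measure_union_null ?_ ?_)
    · exact Measure.addHaar_sphere _ _ _
    · exact (convex_halfSpace_re_lt _).addHaar_frontier _
    · exact (convex_halfSpace_re_lt _).addHaar_frontier _

instance : Countable SL(2, ℤ) :=
  Function.Injective.countable (f := fun (A : SL(2, ℤ)) i j ↦ A i j)
    fun _ _ h ↦ Matrix.SpecialLinearGroup.ext _ _ fun i j ↦ congr_fun (congr_fun h i) j

/-- Almost every point has exactly two translates in `𝒟`, counted with elements of `SL₂(ℤ)`: those
by `g` and `-g`. -/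
lemma ae_tsum_indicator_fd :
    ∀ᵐ τ : ℍ, ∑' g : SL(2, ℤ), Set.indicator 𝒟 (1 : ℍ → ℝ≥0∞) (g • τ) = 2 := by
  have h1 : ∀ᵐ τ : ℍ, ∀ g : SL(2, ℤ), g • τ ∉ 𝒟 \ 𝒟ᵒ := by
    refine ae_all_iff.mpr fun g ↦ ?_
    have h2 : ∀ᵐ τ : ℍ, τ ∉ 𝒟 \ 𝒟ᵒ := measure_eq_zero_iff_ae_notMem.mp volume_fd_diff_fdo
    exact (measurePreserving_smul (mapGL ℝ g) (volume : Measure ℍ)).quasiMeasurePreserving.ae h2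
  filter_upwards [h1] with τ hτ
  obtain ⟨g₀, hg₀⟩ := ModularGroup.exists_smul_mem_fd τ
  have hg₁ : g₀ • τ ∈ 𝒟ᵒ := by
    by_contra h
    exact hτ g₀ ⟨hg₀, h⟩
  have hne : g₀ ≠ -g₀ := by
    intro h
    have h2 := congrArg (fun g : SL(2, ℤ) ↦ (g 0 0, g 0 1)) h
    simp only [Matrix.SpecialLinearGroup.coe_neg, Matrix.neg_apply, Prod.mk.injEq] at h2
    have h3 := g₀.det_coe
    rw [Matrix.det_fin_two, show g₀ 0 0 = 0 by omega, show g₀ 0 1 = 0 by omega] at h3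
    simp at h3
  rw [tsum_eq_sum (s := {g₀, -g₀}), Finset.sum_pair hne]
  · rw [ModularGroup.SL_neg_smul, Set.indicator_of_mem hg₀]
    norm_num
  · intro g hg
    refine Set.indicator_of_notMem (fun h ↦ hg ?_) _
    have h2 : (g * g₀⁻¹) • (g₀ • τ) ∈ 𝒟 := by rwa [smul_smul, inv_mul_cancel_right]
    rcases ModularGroup.eq_one_or_neg_one_of_mem_fdo_mem_fd hg₁ h2 with h3 | h3
    · simp [mul_inv_eq_one.mp h3]
    · rw [mul_inv_eq_iff_eq_mul] at h3
      simp [h3]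

/-- The weight function for `Γ₀(N)` that counts the translates of a point by representatives of
`Γ₀(N) \ SL₂(ℤ)` lying in the standard fundamental domain. -/
def fdWeight (N : ℕ) (τ : ℍ) : ℝ≥0∞ :=
  ∑' q : SL(2, ℤ) ⧸ CongruenceSubgroup.Gamma0 N,
    Set.indicator 𝒟 (1 : ℍ → ℝ≥0∞) (mapGL ℝ q.out • τ)

lemma measurable_indicator_fd : Measurable (Set.indicator 𝒟 (1 : ℍ → ℝ≥0∞)) :=
  measurable_one.indicator ModularGroup.isClosed_fd.measurableSet

instance (N : ℕ) : Countable (Γ₀ N) :=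
  (Subgroup.equivMapOfInjective _ _ mapGL_injective).symm.injective.countable

lemma isWeight_fdWeight (N : ℕ) [NeZero N] : IsWeight (Γ₀ N) (fdWeight N) := by
  refine ⟨Measurable.tsum fun q ↦ measurable_indicator_fd.comp (measurable_const_smul _), ?_⟩
  filter_upwards [ae_tsum_indicator_fd] with τ hτ
  refine Eq.trans ?_ hτ
  rw [← tsum_subgroup_quotient (CongruenceSubgroup.Gamma0 N)]
  refine (Equiv.tsum_eq (Subgroup.equivMapOfInjective _ (mapGL ℝ) mapGL_injective).toEquiv
    _).symm.trans (tsum_congr fun l ↦ tsum_congr fun q ↦ ?_)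
  rw [smul_smul]
  change _ = Set.indicator 𝒟 1 (mapGL ℝ (q.out * (l : SL(2, ℤ))) • τ)
  rw [map_mul]
  rfl

lemma lintegral_fdWeight_ne_top (N : ℕ) [NeZero N] : ∫⁻ τ, fdWeight N τ ≠ ⊤ := by
  have : Fintype (SL(2, ℤ) ⧸ CongruenceSubgroup.Gamma0 N) := Fintype.ofFinite _
  unfold fdWeight
  rw [lintegral_tsum (f := fun (q : SL(2, ℤ) ⧸ CongruenceSubgroup.Gamma0 N) τ ↦
      Set.indicator 𝒟 (1 : ℍ → ℝ≥0∞) (mapGL ℝ q.out • τ)) fun q ↦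
      (measurable_indicator_fd.comp (measurable_const_smul _)).aemeasurable,
    tsum_fintype]
  refine (ENNReal.sum_lt_top.mpr fun q _ ↦ ?_).ne
  rw [lintegral_comp_smul, lintegral_indicator_one ModularGroup.isClosed_fd.measurableSet]
  exact volume_fd_ne_top.lt_top

end

/-! ### The Petersson product and the adjoints of double coset operators -/

section

open scoped ENNReal ComplexConjugate
open ConjAct Pointwise

variable {N : ℕ}

lemma petersson_slash_two (φ ψ : ℍ → ℂ) {g : GL (Fin 2) ℝ} (hg : 0 < g.det.val) (τ : ℍ) :
    petersson 2 (φ ∣[(2 : ℤ)] g) (ψ ∣[(2 : ℤ)] g) τ = petersson 2 φ ψ (g • τ) := by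
  rw [petersson_slash, σ, if_pos hg]
  simp

lemma norm_petersson_le (φ ψ : ℍ → ℂ) (τ : ℍ) :
    ‖petersson 2 φ ψ τ‖ ≤ ‖petersson 2 φ φ τ‖ + ‖petersson 2 ψ ψ τ‖ := by
  simp only [petersson, norm_mul, RCLike.norm_conj]
  rw [← add_mul]
  gcongr
  nlinarith [sq_nonneg (‖φ τ‖ - ‖ψ τ‖), norm_nonneg (φ τ), norm_nonneg (ψ τ)]

/-- Continuous functions `φ` for which `|φ|² y²` is bounded. -/
def IsPeterssonBounded (φ : ℍ → ℂ) : Prop :=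
  Continuous φ ∧ ∃ C, ∀ τ, ‖petersson 2 φ φ τ‖ ≤ C

lemma isPeterssonBounded_slash [NeZero N] (f : S₂ N) {g : GL (Fin 2) ℝ} (hg : 0 < g.det.val) :
    IsPeterssonBounded ((f : ℍ → ℂ) ∣[(2 : ℤ)] g) := by
  refine ⟨(CuspForm.translate f g).holo'.continuous, ?_⟩
  obtain ⟨C, hC⟩ := CuspFormClass.petersson_bounded_left 2 (Γ₀ N) f f
  exact ⟨C, fun τ ↦ by rw [petersson_slash_two _ _ hg]; exact hC _⟩

lemma isPeterssonBounded [NeZero N] (f : S₂ N) : IsPeterssonBounded f := by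
  simpa using isPeterssonBounded_slash f (g := 1) (by simp)

lemma IsPeterssonBounded.integrable {φ ψ : ℍ → ℂ} (hφ : IsPeterssonBounded φ)
    (hψ : IsPeterssonBounded ψ) {Φ : ℍ → ℝ≥0∞} (hΦ : ∫⁻ τ, Φ τ ≠ ⊤) (g : GL (Fin 2) ℝ) :
    Integrable (fun τ ↦ petersson 2 φ ψ (g • τ)) ((volume : Measure ℍ).withDensity Φ) := by
  obtain ⟨C, hC⟩ := hφ.2
  obtain ⟨D, hD⟩ := hψ.2
  have := isFiniteMeasure_withDensity hΦ
  refine Integrable.of_bound (C := C + D) ?_ ?_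
  · exact ((petersson_continuous 2 hφ.1 hψ.1).comp
      (continuous_const_smul g)).measurable.aestronglyMeasurable
  · exact ae_of_all _ fun τ ↦ (norm_petersson_le _ _ _).trans (add_le_add (hC _) (hD _))

lemma IsPeterssonBounded.measurable {φ ψ : ℍ → ℂ} (hφ : IsPeterssonBounded φ)
    (hψ : IsPeterssonBounded ψ) : Measurable (petersson 2 φ ψ) :=
  (petersson_continuous 2 hφ.1 hψ.1).measurable

lemma pet_eq_integral [NeZero N] (f g : S₂ N) :
    pet f g = ∫ τ, petersson 2 f g τ ∂((volume : Measure ℍ).withDensity (fdWeight N)) := by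
  have : Fintype (SL(2, ℤ) ⧸ CongruenceSubgroup.Gamma0 N) := Fintype.ofFinite _
  have hfin : ∫⁻ τ, Set.indicator 𝒟 (1 : ℍ → ℝ≥0∞) τ ≠ ⊤ := by
    rw [lintegral_indicator_one ModularGroup.isClosed_fd.measurableSet]
    exact volume_fd_ne_top
  have hν : (volume : Measure ℍ).withDensity (Set.indicator 𝒟 1) = volume.restrict 𝒟 :=
    withDensity_indicator_one ModularGroup.isClosed_fd.measurableSet
  have key := sum_integral_inv_smul
    (fun q : SL(2, ℤ) ⧸ CongruenceSubgroup.Gamma0 N ↦ mapGL ℝ q.out) measurable_indicator_fd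
    (F := petersson 2 f g)
    fun q ↦ (isPeterssonBounded f).integrable (isPeterssonBounded g) hfin _
  refine Eq.trans ?_ key
  rw [← integral_finsetSum _ fun q _ ↦
    (isPeterssonBounded f).integrable (isPeterssonBounded g) hfin _, hν, pet]
  congr 1
  ext τ
  rw [finsum_eq_sum_of_fintype]
  refine Finset.sum_congr rfl fun q _ ↦ ?_
  rw [← map_inv]
  rfl

lemma pet_add_right [NeZero N] (f g g' : S₂ N) : pet f (g + g') = pet f g + pet f g' := by
  rw [pet_eq_integral, pet_eq_integral, pet_eq_integral, ← integral_add]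
  · congr 1
    ext τ
    simp [petersson]
    ring
  · simpa using (isPeterssonBounded f).integrable (isPeterssonBounded g)
      (lintegral_fdWeight_ne_top N) 1
  · simpa using (isPeterssonBounded f).integrable (isPeterssonBounded g')
      (lintegral_fdWeight_ne_top N) 1

lemma pet_smul_right [NeZero N] (f g : S₂ N) (c : ℂ) : pet f (c • g) = c * pet f g := by
  rw [pet_eq_integral, pet_eq_integral, ← integral_const_mul]
  congr 1
  ext τ
  simp [petersson]
  ring

lemma pet_conj [NeZero N] (f g : S₂ N) : conj (pet f g) = pet g f := by
  rw [pet_eq_integral, pet_eq_integral, ← integral_conj]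
  congr 1
  ext τ
  exact (petersson_symm ..).symm

/-- The Petersson product with `f` as a linear functional. -/
def petLin [NeZero N] (f : S₂ N) : S₂ N →ₗ[ℂ] ℂ where
  toFun := pet f
  map_add' := pet_add_right f
  map_smul' c g := pet_smul_right f g c

lemma petLin_apply [NeZero N] (f g : S₂ N) : petLin f g = pet f g := rfl

instance : (volume : Measure ℍ).IsOpenPosMeasure := by
  have h1 : ((volume : Measure ℂ).comap UpperHalfPlane.coe).IsOpenPosMeasure := by
    refine ⟨fun U hU hne ↦ ?_⟩
    rw [measurableEmbedding_coe.comap_apply]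
    exact ((isOpenEmbedding_coe.isOpenMap U hU).measure_pos _ (hne.image _)).ne'
  rw [volume_def]
  refine (withDensity_absolutelyContinuous' ?_ (ae_of_all _ fun τ ↦ ?_)).isOpenPosMeasure
  · refine (Continuous.measurable ?_).aemeasurable
    refine ENNReal.continuous_coe.comp (.pow (.div₀ continuous_const ?_ ?_) _)
    · exact continuous_im.subtype_mk _
    · exact fun x ↦ NNReal.ne_iff.mp x.im_ne_zero
  · simpa [← NNReal.coe_inj] using τ.im_ne_zero

lemma eq_zero_of_pet_self [NeZero N] {f : S₂ N} (hf : pet f f = 0) : f = 0 := by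
  have hP (τ : ℍ) : petersson 2 f f τ = ((‖f τ‖ ^ 2 * τ.im ^ 2 : ℝ) : ℂ) := by
    rw [petersson, mul_comm (conj _), Complex.mul_conj, Complex.normSq_eq_norm_sq]
    push_cast
    rfl
  have hcont : Continuous f := (isPeterssonBounded f).1
  have hint := (isPeterssonBounded f).integrable (isPeterssonBounded f)
    (lintegral_fdWeight_ne_top N) 1
  rw [pet_eq_integral] at hf
  simp only [hP, one_smul] at hf hint
  rw [integral_complex_ofReal, Complex.ofReal_eq_zero, integral_eq_zero_iff_of_nonneg
    (fun τ ↦ by positivity)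
    (by simpa only [RCLike.re_to_complex, Complex.ofReal_re] using hint.re)] at hf
  rw [Filter.EventuallyEq, ae_withDensity_iff (isWeight_fdWeight N).measurable] at hf
  have h1 : ∀ᵐ τ : ℍ, ∀ γ : Γ₀ N, fdWeight N ((γ : GL (Fin 2) ℝ) • τ) ≠ 0 →
      f ((γ : GL (Fin 2) ℝ) • τ) = 0 := by
    refine ae_all_iff.mpr fun γ ↦ ?_
    refine (measurePreserving_smul (γ : GL (Fin 2) ℝ) (volume :
      Measure ℍ)).quasiMeasurePreserving.ae (p := fun τ ↦ fdWeight N τ ≠ 0 → f τ = 0) ?_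
    filter_upwards [hf] with τ hτ h
    simpa [τ.im_ne_zero] using hτ h
  -- almost every orbit meets the set where the weight is not zero
  have h2 : (f : ℍ → ℂ) =ᵐ[volume] 0 := by
    filter_upwards [h1, (isWeight_fdWeight N).tsum_eq] with τ h3 h4
    obtain ⟨γ, hγ⟩ : ∃ γ : Γ₀ N, fdWeight N ((γ : GL (Fin 2) ℝ) • τ) ≠ 0 := by
      by_contra! h
      simp [h] at h4
    have h5 := congr_arg norm (SlashInvariantFormClass.petersson_smul (f := f) (f' := f)
      (k := 2) (τ := τ) γ.2)
    rw [hP, hP, h3 γ hγ] at h5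
    simpa [τ.im_ne_zero] using h5.symm
  exact DFunLike.coe_injective ((hcont.ae_eq_iff_eq volume continuous_zero).mp h2)

/-- The group `Γ₀(N) ∩ α⁻¹ Γ₀(N) α`. -/
def interConj (N : ℕ) (α : GL (Fin 2) ℝ) : Subgroup (GL (Fin 2) ℝ) :=
  toConjAct α⁻¹ • Γ₀ N ⊓ Γ₀ N

lemma mem_interConj {α γ : GL (Fin 2) ℝ} :
    γ ∈ interConj N α ↔ α * γ * α⁻¹ ∈ Γ₀ N ∧ γ ∈ Γ₀ N := by
  rw [interConj, Subgroup.mem_inf, mem_conj_iff]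

instance (α : GL (Fin 2) ℝ) : Countable (interConj N α) :=
  (Subgroup.inclusion_injective (inf_le_right : interConj N α ≤ Γ₀ N)).countable

lemma det_pos_of_mem_Γ₀ {γ : GL (Fin 2) ℝ} (hγ : γ ∈ Γ₀ N) : 0 < γ.det.val := by
  obtain ⟨h, -, rfl⟩ := hγ
  rw [det_mapGL]
  simp

/-- Unfolding of the sum over cosets in a double coset operator. -/
lemma exists_pet_cosetOp_eq [NeZero N] (α : Δ₀ N) (f : S₂ N) :
    ∃ Φ, IsWeight (interConj N α) Φ ∧ ∀ g : S₂ N, pet g (cosetOp α f) =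
      ∫ τ, petersson 2 g ((f : ℍ → ℂ) ∣[(2 : ℤ)] α.val) τ
        ∂((volume : Measure ℍ).withDensity Φ) := by
  have : Fintype (Γ₀ N ⧸ (toConjAct α.val⁻¹ • Γ₀ N).subgroupOf (Γ₀ N)) := Fintype.ofFinite _
  refine ⟨fun τ ↦ ∑' q : Γ₀ N ⧸ (toConjAct α.val⁻¹ • Γ₀ N).subgroupOf (Γ₀ N),
    fdWeight N ((q.out : GL (Fin 2) ℝ) • τ), ?_, fun g ↦ ?_⟩
  · have := (isWeight_fdWeight N).subgroup ((toConjAct α.val⁻¹ • Γ₀ N).subgroupOf (Γ₀ N))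
    rwa [Subgroup.subgroupOf_map_subtype] at this
  · have hf := isPeterssonBounded_slash f (det_pos α)
    have hint (q : Γ₀ N ⧸ (toConjAct α.val⁻¹ • Γ₀ N).subgroupOf (Γ₀ N)) :=
      (isPeterssonBounded g).integrable hf (lintegral_fdWeight_ne_top N)
        (q.out : GL (Fin 2) ℝ)⁻¹
    rw [← sum_integral_inv_smul (fun q : Γ₀ N ⧸ (toConjAct α.val⁻¹ • Γ₀ N).subgroupOf (Γ₀ N) ↦
      (q.out : GL (Fin 2) ℝ)) (isWeight_fdWeight N).measurable hint,
      ← integral_finsetSum _ fun q _ ↦ hint q, pet_eq_integral]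
    congr 1
    ext τ
    have h1 : (cosetOp α f : ℍ → ℂ) τ =
        ∑ q : Γ₀ N ⧸ (toConjAct α.val⁻¹ • Γ₀ N).subgroupOf (Γ₀ N),
          ((f : ℍ → ℂ) ∣[(2 : ℤ)] (α.val * (q.out : GL (Fin 2) ℝ)⁻¹)) τ := by
      rw [cosetOp, LinearMap.coe_mk, AddHom.coe_mk, trace_apply, finsum_eq_sum_of_fintype,
        Finset.sum_apply]
    rw [petersson, h1, Finset.mul_sum, Finset.sum_mul]
    refine Finset.sum_congr rfl fun q _ ↦ ?_
    rw [← petersson_slash_two _ _ (det_pos_of_mem_Γ₀ (inv_mem q.out.2)), ← SlashAction.slash_mul,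
      SlashInvariantFormClass.slash_action_eq g _ (inv_mem q.out.2)]
    rfl

/-- The operators of `α` and of its adjugate `β` are adjoint to each other: after unfolding, the
substitution `τ ↦ α τ` turns one integral into the other, up to the choice of weight function. -/
lemma pet_cosetOp_adjoint [NeZero N] {α β : Δ₀ N} {c : ℝ} (hc : 0 < c) (h)
    (hβα : β.val * α.val = glMk c 0 0 c h) (f g : S₂ N) :
    pet g (cosetOp α f) = pet (cosetOp β g) f := by
  obtain ⟨Φ, hΦ, hf⟩ := exists_pet_cosetOp_eq α f
  obtain ⟨Ψ, hΨ, hg⟩ := exists_pet_cosetOp_eq β g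
  have hcomm (γ : GL (Fin 2) ℝ) : glMk c 0 0 c h * γ = γ * glMk c 0 0 c h := by
    apply Units.ext
    ext i j
    fin_cases i <;> fin_cases j <;> simp [Matrix.mul_apply, Fin.sum_univ_two, mul_comm]
  have hscal (φ : ℍ → ℂ) : φ ∣[(2 : ℤ)] (glMk c 0 0 c h) = φ := by
    ext τ
    rw [slash_upper φ hc hc h (τ' := τ)]
    · rw [div_self (by exact_mod_cast hc.ne'), one_mul]
    · have : (c : ℂ) ≠ 0 := by exact_mod_cast hc.ne'
      field_simp
      simp
  -- `β` and `α⁻¹` differ by a scalar matrix, which acts trivially.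
  have hconj (γ : GL (Fin 2) ℝ) : β.val * γ * β.val⁻¹ = α.val⁻¹ * γ * α.val := by
    have hβ : β.val = α.val⁻¹ * glMk c 0 0 c h := by
      rw [eq_mul_inv_of_mul_eq hβα, hcomm]
    rw [hβ, mul_assoc α.val⁻¹, hcomm]
    group
  have hgβ := isPeterssonBounded_slash g (det_pos β)
  have hF (γ) (hγ : γ ∈ interConj N β) (τ : ℍ) :
      petersson 2 ((g : ℍ → ℂ) ∣[(2 : ℤ)] β.val) f (γ • τ) =
        petersson 2 ((g : ℍ → ℂ) ∣[(2 : ℤ)] β.val) f τ := by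
    rw [mem_interConj] at hγ
    rw [← petersson_slash_two _ _ (det_pos_of_mem_Γ₀ hγ.2),
      SlashInvariantFormClass.slash_action_eq f _ hγ.2, ← SlashAction.slash_mul,
      slash_eq_of_mul g hγ.1 (g := β.val * γ) (g' := β.val) (by group)]
  have hΦ' : IsWeight (interConj N β) fun τ ↦ Φ (α.val⁻¹ • τ) := by
    refine hΦ.conj _ fun γ ↦ ?_
    rw [mem_interConj, mem_interConj, hconj, inv_inv, and_comm]
    congr! 2
    group
  rw [hf, ← pet_conj, hg, ← integral_conj]
  simp only [← petersson_symm]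
  rw [hΨ.integral_eq hΦ' (hgβ.measurable (isPeterssonBounded f)) hF,
    ← integral_withDensity_comp_smul α.val (Φ := fun τ ↦ Φ (α.val⁻¹ • τ))]
  simp only [inv_smul_smul]
  congr 1
  ext τ
  rw [← petersson_slash_two _ _ (det_pos α), ← SlashAction.slash_mul, hβα, hscal]

lemma cosetOp_eq_of_mul_eq [NeZero N] {α β : Δ₀ N} {γ δ : GL (Fin 2) ℝ} (hγ : γ ∈ Γ₀ N)
    (hδ : δ ∈ Γ₀ N) (h : α.val * γ = δ * β.val) : cosetOp α = cosetOp β := by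
  ext f : 1
  apply DFunLike.coe_injective
  rw [cosetOp_eq, cosetOp_eq, DoubleCoset.doubleCoset_eq_of_mem (a := β.val) (b := α.val)]
  exact DoubleCoset.mem_doubleCoset.mpr ⟨δ, hδ, γ⁻¹, inv_mem hγ, by rw [← h]; group⟩

/-- The Hecke operator `T_p` is self-adjoint for `p` prime to the level. -/
lemma pet_heckeOp [NeZero N] {p : ℕ} [NeZero p] (hp : p.Prime) (hpN : ¬ p ∣ N) (f g : S₂ N) :
    pet g (heckeOp N p f) = pet (heckeOp N p g) f := by
  have hp0 : (0 : ℝ) < p := by exact_mod_cast hp.pos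
  have hβ : glMk p 0 0 1 (by simpa using NeZero.ne p) ∈ Δ₀ N := by
    refine ⟨!![(p : ℤ), 0; 0, 1], ?_, ?_, ?_, ?_⟩
    · ext i j; fin_cases i <;> fin_cases j <;> simp
    · simpa using hp.pos
    · simp
    · simpa using Nat.isCoprime_iff_coprime.mpr ((hp.coprime_iff_not_dvd).mpr hpN)
  obtain ⟨s, u, hs⟩ := exists_dvd_one_add hp hpN
  -- `diag(1, p)` and its adjugate `diag(p, 1)` lie in the same double coset.
  have h1 : cosetOp ⟨heckeMat p, heckeMat_mem N p⟩ = cosetOp ⟨_, hβ⟩ :=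
    cosetOp_eq_of_mul_eq (slMk_mem _ (dvd_pow_self _ two_ne_zero))
      (slMk_mem _ (dvd_pow_self _ two_ne_zero)) (heckeMat_mul_eq hs)
  rw [heckeOp, pet_cosetOp_adjoint (α := ⟨heckeMat p, heckeMat_mem N p⟩) (β := ⟨_, hβ⟩) hp0
    (by simpa using hp0.ne'), h1]
  apply Units.ext
  ext i j
  fin_cases i <;> fin_cases j <;> simp [heckeMat]

end

/-! ### Rationality of the characteristic polynomials -/

section

open Cardinal

/-- Two embeddings of a countable domain into uncountable algebraically closed fields of the same
cardinality differ by an isomorphism, obtained by matching transcendence bases. -/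
lemma exists_ringEquiv_extending {R K L : Type} [CommRing R] [IsDomain R] [Countable R] [Field K]
    [Field L] [IsAlgClosed K] [IsAlgClosed L] (hK : ℵ₀ < #K) (hKL : #K = #L)
    {i : R →+* K} {φ : R →+* L} (hi : Function.Injective i) (hφ : Function.Injective φ) :
    ∃ E : K ≃+* L, ∀ r, E (i r) = φ r := by
  let := i.toAlgebra
  let := φ.toAlgebra
  have : FaithfulSMul R K := (faithfulSMul_iff_algebraMap_injective R K).mpr hi
  have : FaithfulSMul R L := (faithfulSMul_iff_algebraMap_injective R L).mpr hφ
  obtain ⟨s, hs⟩ := exists_isTranscendenceBasis R K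
  obtain ⟨t, ht⟩ := exists_isTranscendenceBasis R L
  have hst : #s = #t := by
    rw [← IsAlgClosed.cardinal_eq_cardinal_transcendence_basis_of_aleph0_lt' _ hs mk_le_aleph0 hK,
      ← IsAlgClosed.cardinal_eq_cardinal_transcendence_basis_of_aleph0_lt' _ ht mk_le_aleph0
        (hKL ▸ hK), hKL]
  obtain ⟨e⟩ := Cardinal.eq.mp hst
  let := IsAlgClosed.isAlgClosure_of_transcendence_basis _ hs
  let := IsAlgClosed.isAlgClosure_of_transcendence_basis _ ht
  let e' : Algebra.adjoin R (Set.range ((↑) : s → K)) ≃ₐ[R]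
      Algebra.adjoin R (Set.range ((↑) : t → L)) :=
    hs.1.aevalEquiv.symm.trans ((MvPolynomial.renameEquiv R e).trans ht.1.aevalEquiv)
  refine ⟨IsAlgClosure.equivOfEquiv K L e'.toRingEquiv, fun r ↦ ?_⟩
  have h1 := IsAlgClosure.equivOfEquiv_algebraMap K L e'.toRingEquiv (algebraMap R _ r)
  have h2 : e'.toRingEquiv (algebraMap R _ r) = algebraMap R _ r := e'.commutes r
  rw [h2] at h1
  exact h1

/-- An irrational number is moved by some automorphism of `ℂ`: to a conjugate if it is algebraic,
and from `x` to `x + 1` if it is transcendental. -/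
lemma exists_ringEquiv_apply_ne {x : ℂ} (hx : x ∉ Set.range ((↑) : ℚ → ℂ)) :
    ∃ σ : ℂ ≃+* ℂ, σ x ≠ x := by
  have hC : ℵ₀ < #ℂ := by rw [Cardinal.mk_complex]; exact Cardinal.aleph0_lt_continuum
  have : Countable ℚ[X] := by
    rw [← Cardinal.mk_le_aleph0_iff]
    exact Polynomial.cardinalMk_le_max.trans (by simp)
  by_cases hint : IsIntegral ℚ x
  · have hirr := minpoly.irreducible hint
    have : Fact (Irreducible (minpoly ℚ x)) := ⟨hirr⟩
    obtain ⟨y, hyx, hy⟩ := (notMem_iff_exists_ne_and_isConjRoot (K := ℚ) (x := x)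
      (minpoly.irreducible hint).separable (IsAlgClosed.splits _)).mp
        (by simpa [Algebra.mem_bot] using hx)
    have hy₀ : (minpoly ℚ x).eval₂ (algebraMap ℚ ℂ) y = 0 := by rw [hy]; exact minpoly.aeval ℚ y
    have hx₀ : (minpoly ℚ x).eval₂ (algebraMap ℚ ℂ) x = 0 := minpoly.aeval ℚ x
    have : Countable (AdjoinRoot (minpoly ℚ x)) := AdjoinRoot.mk_surjective.countable
    obtain ⟨E, hE⟩ := exists_ringEquiv_extending hC rfl
      (AdjoinRoot.lift (algebraMap ℚ ℂ) x hx₀).injective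
      (AdjoinRoot.lift (algebraMap ℚ ℂ) y hy₀).injective
    refine ⟨E, ?_⟩
    have h1 : E x = y := by
      have := hE (AdjoinRoot.root _)
      rwa [AdjoinRoot.lift_root, AdjoinRoot.lift_root] at this
    rw [h1]
    exact hyx.symm
  · have htr : Transcendental ℚ x := fun h ↦ hint h.isIntegral
    have htr' : Transcendental ℚ (x + 1) := fun h ↦ htr (by simpa using h.sub isAlgebraic_one)
    obtain ⟨E, hE⟩ := exists_ringEquiv_extending (R := ℚ[X]) hC rfl
      (i := (Polynomial.aeval x).toRingHom) (φ := (Polynomial.aeval (x + 1)).toRingHom)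
      (transcendental_iff_injective.mp htr) (transcendental_iff_injective.mp htr')
    refine ⟨E, ?_⟩
    have := hE Polynomial.X
    simp at this
    rw [this]
    simp

/-- If the coefficients of a complex polynomial are fixed by all automorphisms of `ℂ`, they are
rational. -/
lemma exists_map_eq_of_forall_ringEquiv {P : ℂ[X]}
    (hP : ∀ σ : ℂ ≃+* ℂ, P.map (σ : ℂ →+* ℂ) = P) : ∃ P₀ : ℚ[X], P₀.map (algebraMap ℚ ℂ) = P := by
  refine (Polynomial.mem_lifts P).mp ((Polynomial.lifts_iff_coeff_lifts P).mpr fun n ↦ ?_)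
  by_contra h
  obtain ⟨σ, hσ⟩ := exists_ringEquiv_apply_ne (x := P.coeff n) (by simpa using h)
  refine hσ ?_
  conv_rhs => rw [← hP σ]
  rw [Polynomial.coeff_map]
  rfl

/-- If `T` commutes with a `σ`-semilinear bijection, then `σ` fixes its characteristic polynomial:
the matrix of `T` in the image of a basis is the image of its matrix under `σ`. -/
lemma charpoly_map_of_semilinear {V : Type*} [AddCommGroup V] [Module ℂ V]
    [FiniteDimensional ℂ V] (σ : ℂ ≃+* ℂ) (S : V → V) (hadd : ∀ v w, S (v + w) = S v + S w)
    (hsmul : ∀ (c : ℂ) v, S (c • v) = σ c • S v) (hinj : Function.Injective S)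
    (T : Module.End ℂ V) (hT : ∀ v, S (T v) = T (S v)) :
    T.charpoly.map (σ : ℂ →+* ℂ) = T.charpoly := by
  let S' : V →+ V := AddMonoidHom.mk' S hadd
  have hsum {n : ℕ} (c : Fin n → ℂ) (v : Fin n → V) :
      S (∑ i, c i • v i) = ∑ i, σ (c i) • S (v i) := by
    rw [show S = S' from rfl, map_sum]
    exact Finset.sum_congr rfl fun i _ ↦ hsmul _ _
  let b := Module.finBasis ℂ V
  have hli : LinearIndependent ℂ fun i ↦ S (b i) := by
    rw [Fintype.linearIndependent_iff]
    intro c hc i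
    have h1 : S (∑ i, σ.symm (c i) • b i) = S 0 := by
      rw [hsum, show S 0 = S' 0 from rfl, map_zero]
      simpa using hc
    have h2 := Fintype.linearIndependent_iff.mp b.linearIndependent _ (hinj h1) i
    simpa using h2
  let b' := Module.Basis.mk hli (hli.span_eq_top_of_card_eq_finrank' (by simp)).ge
  have hb' (i) : b' i = S (b i) := by
    simp [b']
  have hmat : LinearMap.toMatrix b' b' T = (LinearMap.toMatrix b b T).map σ := by
    ext i j
    rw [LinearMap.toMatrix_apply, hb', ← hT, ← b.sum_repr (T (b j)), hsum]
    simp only [← hb']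
    rw [b'.repr_sum_self, Matrix.map_apply, LinearMap.toMatrix_apply]
  rw [← LinearMap.charpoly_toMatrix T b, ← Matrix.charpoly_map]
  conv_rhs => rw [LinearMap.charpoly_toMatrix T b, ← LinearMap.charpoly_toMatrix T b', hmat]
  rfl

end

/-- The form obtained by applying `σ` to the Fourier coefficients of `f`. -/
def conjForm {N : ℕ} [NeZero N] (σ : ℂ →+* ℂ) (f : S₂ N) : S₂ N := (exists_conj σ f).choose

lemma qExpansion_conjForm {N : ℕ} [NeZero N] (σ : ℂ →+* ℂ) (f : S₂ N) :
    qExpansion 1 (conjForm σ f) = (qExpansion 1 f).map σ := (exists_conj σ f).choose_spec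

/-- The characteristic polynomial of `T_p` has rational coefficients. -/
lemma exists_charpoly_heckeOp_eq {N p : ℕ} [NeZero N] [NeZero p] (hp : p.Prime) (hpN : ¬ p ∣ N) :
    ∃ P₀ : ℚ[X], P₀.map (algebraMap ℚ ℂ) = (heckeOp N p).charpoly := by
  have hq (f : S₂ N) : qExpansion 1 f = qExpLin N f := (qExpLin_apply f).symm
  refine exists_map_eq_of_forall_ringEquiv fun σ ↦
    charpoly_map_of_semilinear σ (conjForm (σ : ℂ →+* ℂ)) (fun f g ↦ ?_) (fun c f ↦ ?_)
      (fun f g h ↦ ?_) _ fun f ↦ ?_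
  · apply eq_of_qExpansion_eq
    rw [qExpansion_conjForm, hq, hq, map_add, map_add, map_add, ← hq, ← hq, ← hq, ← hq,
      qExpansion_conjForm, qExpansion_conjForm]
  · apply eq_of_qExpansion_eq
    rw [qExpansion_conjForm, hq, hq, LinearMap.map_smul, LinearMap.map_smul, ← hq, ← hq,
      qExpansion_conjForm]
    ext n
    simp
  · apply eq_of_qExpansion_eq
    have h1 := congr_arg (fun f : S₂ N ↦ qExpansion 1 f) h
    simp only [qExpansion_conjForm] at h1
    exact PowerSeries.map_injective _ σ.injective h1
  · apply eq_of_qExpansion_eq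
    ext n
    rw [qExpansion_conjForm, PowerSeries.coeff_map, coeff_heckeOp hp hpN, coeff_heckeOp hp hpN,
      qExpansion_conjForm, PowerSeries.coeff_map]
    split_ifs
    · simp
    · simp

/-! ### Products of double coset operators -/

section

open ConjAct Pointwise

variable {N : ℕ}

/-- The formal sums of left cosets `g Γ₀(N)`; the coset of `g` stands for the slash operator
of `g⁻¹`, which is well defined on `S₂(N)`. -/
abbrev CosetSum (N : ℕ) : Type := (GL (Fin 2) ℝ ⧸ Γ₀ N) →₀ ℤ

/-- The action of a formal sum of cosets on a cusp form. -/
def cosetSlash (f : S₂ N) : CosetSum N →+ (ℍ → ℂ) :=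
  Finsupp.liftAddHom fun q ↦ ((zmultiplesHom _) ((f : ℍ → ℂ) ∣[(2 : ℤ)] (q.out)⁻¹))

lemma cosetSlash_single (f : S₂ N) (q : GL (Fin 2) ℝ ⧸ Γ₀ N) :
    cosetSlash f (.single q 1) = (f : ℍ → ℂ) ∣[(2 : ℤ)] (q.out)⁻¹ := by
  simp [cosetSlash]

lemma cosetSlash_single_mk (f : S₂ N) (g : GL (Fin 2) ℝ) :
    cosetSlash f (.single (QuotientGroup.mk g) 1) = (f : ℍ → ℂ) ∣[(2 : ℤ)] g⁻¹ := by
  obtain ⟨γ, hγ⟩ := QuotientGroup.mk_out_eq_mul (Γ₀ N) g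
  rw [cosetSlash_single, hγ]
  exact slash_eq_of_mul f (inv_mem γ.2) (by group)

/-- Left translation of formal sums of cosets. -/
def cosetShift (g : GL (Fin 2) ℝ) : CosetSum N →+ CosetSum N :=
  Finsupp.mapDomain.addMonoidHom (g • ·)

lemma cosetShift_single (g : GL (Fin 2) ℝ) (q : GL (Fin 2) ℝ ⧸ Γ₀ N) (n : ℤ) :
    cosetShift g (.single q n) = .single (g • q) n := Finsupp.mapDomain_single

lemma cosetShift_apply (g : GL (Fin 2) ℝ) (m : CosetSum N) (q : GL (Fin 2) ℝ ⧸ Γ₀ N) :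
    cosetShift g m (g • q) = m q :=
  Finsupp.mapDomain_apply (MulAction.injective g) m q

lemma cosetShift_mul (g h : GL (Fin 2) ℝ) (m : CosetSum N) :
    cosetShift (g * h) m = cosetShift g (cosetShift h m) := by
  change Finsupp.mapDomain _ _ = Finsupp.mapDomain _ (Finsupp.mapDomain _ _)
  rw [← Finsupp.mapDomain_comp]
  congr 1
  ext q
  simp [mul_smul]

lemma cosetSlash_cosetShift (f : S₂ N) (g : GL (Fin 2) ℝ) (m : CosetSum N) :
    cosetSlash f (cosetShift g m) = cosetSlash f m ∣[(2 : ℤ)] g⁻¹ := by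
  let S : (ℍ → ℂ) →+ (ℍ → ℂ) := AddMonoidHom.mk' (· ∣[(2 : ℤ)] g⁻¹)
    fun a b ↦ SlashAction.add_slash _ _ _ _
  suffices (cosetSlash f).comp (cosetShift g) = S.comp (cosetSlash f) from
    DFunLike.congr_fun this m
  ext q : 2
  induction q using QuotientGroup.induction_on with | H x => ?_
  simp only [AddMonoidHom.comp_apply, Finsupp.singleAddHom_apply,
    cosetShift_single, MulAction.Quotient.smul_mk, cosetSlash_single_mk, smul_eq_mul]
  change _ = (_ ∣[(2 : ℤ)] _) ∣[(2 : ℤ)] g⁻¹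
  rw [← SlashAction.slash_mul, mul_inv_rev]

/-- The summands of the operator of `α` correspond to the cosets `h α⁻¹ Γ₀(N)` with `h ∈ Γ₀(N)`. -/
lemma cosetOp_bijOn [NeZero N] (α : Δ₀ N) :
    Set.BijOn (fun q : Γ₀ N ⧸ (toConjAct α.val⁻¹ • Γ₀ N).subgroupOf (Γ₀ N) ↦
      (QuotientGroup.mk ((q.out : GL (Fin 2) ℝ) * α.val⁻¹) : GL (Fin 2) ℝ ⧸ Γ₀ N)) Set.univ
      (MulAction.orbit (Γ₀ N) (QuotientGroup.mk α.val⁻¹ : GL (Fin 2) ℝ ⧸ Γ₀ N)) := by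
  have key (h k : Γ₀ N) : (QuotientGroup.mk ((h : GL (Fin 2) ℝ) * α.val⁻¹) :
      GL (Fin 2) ℝ ⧸ Γ₀ N) = QuotientGroup.mk ((k : GL (Fin 2) ℝ) * α.val⁻¹) ↔
      (QuotientGroup.mk h : Γ₀ N ⧸ (toConjAct α.val⁻¹ • Γ₀ N).subgroupOf (Γ₀ N)) =
        QuotientGroup.mk k := by
    rw [QuotientGroup.eq, QuotientGroup.eq, Subgroup.mem_subgroupOf, mem_conj_iff]
    simp [mul_assoc]
  refine ⟨fun q _ ↦ ⟨q.out, rfl⟩, fun q _ r _ h ↦ ?_, ?_⟩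
  · rw [← q.out_eq', ← r.out_eq']
    exact (key _ _).mp h
  · rintro _ ⟨h, rfl⟩
    exact ⟨QuotientGroup.mk h, trivial, (key _ h).mpr (QuotientGroup.out_eq' _)⟩

lemma finite_orbit [NeZero N] (α : Δ₀ N) :
    (MulAction.orbit (Γ₀ N) (QuotientGroup.mk α.val⁻¹ : GL (Fin 2) ℝ ⧸ Γ₀ N)).Finite := by
  rw [← (cosetOp_bijOn α).image_eq]
  exact Set.toFinite _

/-- The double coset of `α` as the formal sum of the cosets in it. -/
def orbitSum [NeZero N] (α : Δ₀ N) : CosetSum N :=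
  ∑ q ∈ (finite_orbit α).toFinset, .single q 1

lemma smul_mem_orbit_iff {γ : GL (Fin 2) ℝ} (hγ : γ ∈ Γ₀ N) {q r : GL (Fin 2) ℝ ⧸ Γ₀ N} :
    γ • r ∈ MulAction.orbit (Γ₀ N) q ↔ r ∈ MulAction.orbit (Γ₀ N) q := by
  rw [← MulAction.orbit_eq_iff, ← MulAction.orbit_eq_iff,
    show γ • r = (⟨γ, hγ⟩ : Γ₀ N) • r from rfl, MulAction.orbit_smul]

lemma orbitSum_apply [NeZero N] (α : Δ₀ N) (q : GL (Fin 2) ℝ ⧸ Γ₀ N)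
    [Decidable (q ∈ MulAction.orbit (Γ₀ N) (QuotientGroup.mk α.val⁻¹ : GL (Fin 2) ℝ ⧸ Γ₀ N))] :
    orbitSum α q = if q ∈ MulAction.orbit (Γ₀ N)
      (QuotientGroup.mk α.val⁻¹ : GL (Fin 2) ℝ ⧸ Γ₀ N) then 1 else 0 := by
  classical
  rw [orbitSum, Finsupp.finsetSum_apply]
  simp [Finsupp.single_apply]

lemma cosetSlash_orbitSum [NeZero N] (α : Δ₀ N) (f : S₂ N) :
    cosetSlash f (orbitSum α) = cosetOp α f := by
  have h1 := finsum_mem_coe_finset (fun q : GL (Fin 2) ℝ ⧸ Γ₀ N ↦ cosetSlash f (.single q 1))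
    (finite_orbit α).toFinset
  rw [Set.Finite.coe_toFinset] at h1
  rw [cosetOp, LinearMap.coe_mk, AddHom.coe_mk, trace_apply, orbitSum, map_sum, ← h1]
  symm
  rw [← finsum_mem_univ]
  apply finsum_mem_eq_of_bijOn _ (cosetOp_bijOn α)
  intro q _
  rw [cosetSlash_single_mk, mul_inv_rev, inv_inv]

lemma cosetShift_orbitSum [NeZero N] (α : Δ₀ N) {γ : GL (Fin 2) ℝ} (hγ : γ ∈ Γ₀ N) :
    cosetShift γ (orbitSum α) = orbitSum α := by
  classical
  ext q
  obtain ⟨r, rfl⟩ := MulAction.surjective γ q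
  rw [cosetShift_apply, orbitSum_apply, orbitSum_apply]
  simp only [smul_mem_orbit_iff hγ]

lemma doubleCosetOp_mk [NeZero N] (α : Δ₀ N) :
    doubleCosetOp (HeckeCoset.mk (Γ₀ N) (Γ₀ N) α) = cosetOp α := rfl

lemma heckeAct_of_single [NeZero N] (D : HeckeCoset (Δ₀ N) (Γ₀ N) (Γ₀ N)) :
    heckeAct N (HeckeCosetModule.of (.single D 1)) = doubleCosetOp D :=
  (Finsupp.sum_single_index (h := fun (D : HeckeCoset (Δ₀ N) (Γ₀ N) (Γ₀ N)) (n : ℤ) ↦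
    n • doubleCosetOp D) (zero_smul ℤ _)).trans (one_smul ℤ _)

/-- A `Γ₀(N)`-invariant formal sum of cosets of elements of `Δ₀(N)` is a linear combination of
double cosets. -/
lemma exists_heckeAct_eq [NeZero N] (m : CosetSum N)
    (hinv : ∀ γ ∈ Γ₀ N, cosetShift γ m = m)
    (hsupp : ∀ q ∈ m.support, ∃ α : Δ₀ N, q = QuotientGroup.mk α.val⁻¹) :
    ∃ T : 𝕋 N, ∀ f : S₂ N, (heckeAct N T f : ℍ → ℂ) = cosetSlash f m := by
  classical
  induction hn : m.support.card using Nat.strong_induction_on generalizing m with | _ n ih => ?_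
  rcases m.support.eq_empty_or_nonempty with hm | ⟨q, hq⟩
  · refine ⟨0, fun f ↦ ?_⟩
    rw [Finsupp.support_eq_empty.mp hm]
    simp
  · obtain ⟨α, rfl⟩ := hsupp q hq
    set q : GL (Fin 2) ℝ ⧸ Γ₀ N := QuotientGroup.mk α.val⁻¹ with hq'
    have hconst (r) (hr : r ∈ MulAction.orbit (Γ₀ N) q) : m r = m q := by
      obtain ⟨γ, rfl⟩ := hr
      conv_lhs => rw [← hinv γ γ.2]
      exact cosetShift_apply (γ : GL (Fin 2) ℝ) m q
    have hval (r) : (m - m q • orbitSum α) r = if r ∈ MulAction.orbit (Γ₀ N) q then 0 else m r := by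
      rw [Finsupp.sub_apply, Finsupp.smul_apply, orbitSum_apply]
      split_ifs with h
      · simp [hconst r h]
      · simp
    have hsub : (m - m q • orbitSum α).support ⊂ m.support := by
      rw [Finset.ssubset_iff_of_subset]
      · refine ⟨q, hq, ?_⟩
        rw [Finsupp.notMem_support_iff, hval, if_pos (MulAction.mem_orbit_self q)]
      · intro r hr
        rw [Finsupp.mem_support_iff, hval] at hr
        rw [Finsupp.mem_support_iff]
        intro h
        simp [h] at hr
    -- subtracting `m q` times the orbit of `q` makes the support smaller
    obtain ⟨T, hT⟩ := ih _ (hn ▸ Finset.card_lt_card hsub) (m - m q • orbitSum α)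
      (fun γ hγ ↦ by rw [map_sub, map_zsmul, cosetShift_orbitSum α hγ, hinv γ hγ])
      (fun r hr ↦ hsupp r (hsub.1 hr)) rfl
    refine ⟨T + m q • HeckeCosetModule.of (.single (HeckeCoset.mk _ _ α) 1), fun f ↦ ?_⟩
    rw [map_add, map_zsmul, heckeAct_of_single, doubleCosetOp_mk, LinearMap.add_apply,
      FunLike.coe_add, hT, map_sub, map_zsmul, cosetSlash_orbitSum]
    ext τ
    simp

lemma mem_Δ₀_of_mem_Γ₀ {γ : GL (Fin 2) ℝ} (hγ : γ ∈ Γ₀ N) : γ ∈ Δ₀ N := by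
  obtain ⟨a, b, c, d, hdet, hc, hval⟩ := mem_Γ₀_iff.mp hγ
  refine ⟨!![a, b; c, d], ?_, by rw [Matrix.det_fin_two_of, hdet]; norm_num, hc, ?_⟩
  · rw [hval]
    ext i j; fin_cases i <;> fin_cases j <;> simp
  · obtain ⟨e, rfl⟩ := hc
    exact ⟨d, -(b * e), by simp; linarith⟩

/-- The product of two double coset operators is a combination of double coset operators: the
corresponding formal sum of cosets is invariant under `Γ₀(N)`. -/
lemma exists_heckeAct_eq_cosetOp_mul [NeZero N] (α β : Δ₀ N) :
    ∃ T : 𝕋 N, heckeAct N T = cosetOp α * cosetOp β := by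
  classical
  set O := (finite_orbit α).toFinset with hO
  suffices h : (∀ γ ∈ Γ₀ N, cosetShift γ (∑ q ∈ O, cosetShift q.out (orbitSum β)) =
      ∑ q ∈ O, cosetShift q.out (orbitSum β)) ∧
      ∀ q ∈ (∑ q ∈ O, cosetShift q.out (orbitSum β)).support,
        ∃ α : Δ₀ N, q = QuotientGroup.mk α.val⁻¹ by
    obtain ⟨T, hT⟩ := exists_heckeAct_eq _ h.1 h.2
    refine ⟨T, ?_⟩
    ext f : 1
    apply DFunLike.coe_injective
    have h2 := cosetSlash_orbitSum α (cosetOp β f)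
    rw [orbitSum, map_sum] at h2
    rw [hT, map_sum, Module.End.mul_apply, ← h2]
    refine Finset.sum_congr rfl fun q _ ↦ ?_
    rw [cosetSlash_cosetShift, cosetSlash_orbitSum, cosetSlash_single]
  refine ⟨fun γ hγ ↦ ?_, fun r hr ↦ ?_⟩
  · have h1 (q : GL (Fin 2) ℝ ⧸ Γ₀ N) : cosetShift γ (cosetShift q.out (orbitSum β)) =
        cosetShift (γ • q).out (orbitSum β) := by
      obtain ⟨k, hk⟩ := QuotientGroup.mk_out_eq_mul (Γ₀ N) (γ * q.out)
      have h2 : (QuotientGroup.mk (γ * q.out) : GL (Fin 2) ℝ ⧸ Γ₀ N) = γ • q := by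
        conv_rhs => rw [← QuotientGroup.out_eq' q]
        rfl
      rw [← h2, hk, cosetShift_mul (γ * q.out), cosetShift_orbitSum β k.2, cosetShift_mul]
    rw [map_sum, Finset.sum_congr rfl fun q _ ↦ h1 q]
    refine Finset.sum_nbij' (γ • ·) (γ⁻¹ • ·) (fun q hq ↦ ?_) (fun q hq ↦ ?_)
      (fun q _ ↦ inv_smul_smul _ _) (fun q _ ↦ smul_inv_smul _ _) fun q _ ↦ rfl
    · rw [hO, Set.Finite.mem_toFinset] at hq ⊢
      exact (smul_mem_orbit_iff hγ).mpr hq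
    · rw [hO, Set.Finite.mem_toFinset] at hq ⊢
      exact (smul_mem_orbit_iff (inv_mem hγ)).mpr hq
  · have horb {δ : Δ₀ N} {q : GL (Fin 2) ℝ ⧸ Γ₀ N}
        (hq : q ∈ MulAction.orbit (Γ₀ N) (QuotientGroup.mk δ.val⁻¹ : GL (Fin 2) ℝ ⧸ Γ₀ N)) :
        ∃ g ∈ Δ₀ N, q = QuotientGroup.mk g⁻¹ := by
      obtain ⟨γ, rfl⟩ := hq
      refine ⟨δ.val * (γ : GL (Fin 2) ℝ)⁻¹, mul_mem δ.2 (mem_Δ₀_of_mem_Γ₀ (inv_mem γ.2)), ?_⟩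
      rw [mul_inv_rev, inv_inv]
      rfl
    obtain ⟨q, hq, hqr⟩ : ∃ q ∈ O, cosetShift q.out (orbitSum β) r ≠ 0 := by
      by_contra! h
      rw [Finsupp.mem_support_iff, Finsupp.finsetSum_apply] at hr
      exact hr (Finset.sum_eq_zero h)
    obtain ⟨s, rfl⟩ := MulAction.surjective q.out r
    rw [cosetShift_apply, orbitSum_apply, ne_eq, ite_eq_right_iff, Classical.not_imp] at hqr
    obtain ⟨g, hg, rfl⟩ := horb hqr.1
    rw [hO, Set.Finite.mem_toFinset] at hq
    obtain ⟨g', hg', rfl⟩ := horb hq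
    obtain ⟨k, hk⟩ := QuotientGroup.mk_out_eq_mul (Γ₀ N) g'⁻¹
    refine ⟨⟨g * ((k : GL (Fin 2) ℝ)⁻¹ * g'), mul_mem hg
      (mul_mem (mem_Δ₀_of_mem_Γ₀ (inv_mem k.2)) hg')⟩, ?_⟩
    rw [hk]
    change (QuotientGroup.mk (g'⁻¹ * (k : GL (Fin 2) ℝ) * g⁻¹) : GL (Fin 2) ℝ ⧸ Γ₀ N) = _
    congr 1

lemma exists_heckeAct_eq_mul [NeZero N] (T U : 𝕋 N) :
    ∃ V : 𝕋 N, heckeAct N V = heckeAct N T * heckeAct N U := by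
  have hind (p : 𝕋 N → Prop) (h0 : p 0) (hadd : ∀ T U, p T → p U → p (T + U))
      (hneg : ∀ T, p T → p (-T))
      (h1 : ∀ α : Δ₀ N, p (HeckeCosetModule.of (.single (HeckeCoset.mk _ _ α) 1))) (T) : p T := by
    suffices ∀ m : HeckeCoset (Δ₀ N) (Γ₀ N) (Γ₀ N) →₀ ℤ, p (HeckeCosetModule.of m) from
      this (HeckeCosetModule.of.symm T)
    have h2 (D : HeckeCoset (Δ₀ N) (Γ₀ N) (Γ₀ N)) (n : ℕ) :
        p (HeckeCosetModule.of (.single D (n : ℤ))) := by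
      obtain ⟨α, rfl⟩ : ∃ α, D = HeckeCoset.mk _ _ α := ⟨_, (Quotient.out_eq D).symm⟩
      induction n with
      | zero =>
        rw [Nat.cast_zero, Finsupp.single_zero]
        exact h0
      | succ n ih =>
        have := hadd _ _ ih (h1 α)
        rw [Nat.cast_succ, Finsupp.single_add]
        exact this
    intro m
    induction m using Finsupp.induction_linear with
    | zero => exact h0
    | add a b ha hb => exact hadd _ _ ha hb
    | single D n =>
      obtain ⟨n, rfl | rfl⟩ := n.eq_nat_or_neg
      · exact h2 D n
      · rw [Finsupp.single_neg]
        exact hneg _ (h2 D n)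
  induction T using hind with
  | h0 => exact ⟨0, by simp⟩
  | hadd T T' h h' =>
    obtain ⟨V, hV⟩ := h
    obtain ⟨V', hV'⟩ := h'
    exact ⟨V + V', by rw [map_add, map_add, hV, hV', add_mul]⟩
  | hneg T h =>
    obtain ⟨V, hV⟩ := h
    exact ⟨-V, by rw [map_neg, map_neg, hV, neg_mul]⟩
  | h1 α =>
    induction U using hind with
    | h0 => exact ⟨0, by simp⟩
    | hadd T T' h h' =>
      obtain ⟨V, hV⟩ := h
      obtain ⟨V', hV'⟩ := h'
      exact ⟨V + V', by rw [map_add, map_add, hV, hV', mul_add]⟩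
    | hneg T h =>
      obtain ⟨V, hV⟩ := h
      exact ⟨-V, by rw [map_neg, map_neg, hV, mul_neg]⟩
    | h1 β =>
      rw [heckeAct_of_single, heckeAct_of_single]
      exact exists_heckeAct_eq_cosetOp_mul α β

lemma exists_heckeAct_eq_one [NeZero N] : ∃ T : 𝕋 N, heckeAct N T = 1 := by
  suffices h : (∀ γ ∈ Γ₀ N, cosetShift γ (.single (QuotientGroup.mk 1 : GL (Fin 2) ℝ ⧸ Γ₀ N) 1) =
      .single (QuotientGroup.mk 1 : GL (Fin 2) ℝ ⧸ Γ₀ N) 1) ∧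
      ∀ q ∈ (Finsupp.single (QuotientGroup.mk 1 : GL (Fin 2) ℝ ⧸ Γ₀ N) (1 : ℤ)).support,
        ∃ α : Δ₀ N, q = QuotientGroup.mk α.val⁻¹ by
    obtain ⟨T, hT⟩ := exists_heckeAct_eq _ h.1 h.2
    refine ⟨T, ?_⟩
    ext f : 1
    apply DFunLike.coe_injective
    rw [hT, cosetSlash_single_mk, inv_one, SlashAction.slash_one]
    rfl
  refine ⟨fun γ hγ ↦ ?_, fun q hq ↦ ?_⟩
  · rw [cosetShift_single, MulAction.Quotient.smul_mk, smul_eq_mul, mul_one]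
    congr 1
    rw [QuotientGroup.eq]
    simpa using inv_mem hγ
  · refine ⟨1, ?_⟩
    classical
    rw [Finsupp.mem_support_iff, Finsupp.single_apply, ne_eq, ite_eq_right_iff,
      Classical.not_imp] at hq
    rw [← hq.1]
    simp

/-- The operators of `𝕋 ⊗ K` form a subalgebra over `K`. -/
def heckeSubalgebra (N : ℕ) [NeZero N] (K : IntermediateField ℚ ℂ) :
    Subalgebra K (Module.End ℂ (S₂ N)) where
  carrier := Set.range (heckeActTensor N K)
  add_mem' := by
    rintro _ _ ⟨t, rfl⟩ ⟨u, rfl⟩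
    exact ⟨t + u, map_add _ _ _⟩
  mul_mem' := by
    rintro _ _ ⟨t, rfl⟩ ⟨u, rfl⟩
    induction t with
    | zero => exact ⟨0, by simp⟩
    | add t t' h h' =>
      obtain ⟨v, hv⟩ := h
      obtain ⟨v', hv'⟩ := h'
      exact ⟨v + v', by rw [map_add, map_add, hv, hv', add_mul]⟩
    | tmul T c =>
      induction u with
      | zero => exact ⟨0, by simp⟩
      | add t t' h h' =>
        obtain ⟨v, hv⟩ := h
        obtain ⟨v', hv'⟩ := h'
        exact ⟨v + v', by rw [map_add, map_add, hv, hv', mul_add]⟩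
      | tmul U d =>
        obtain ⟨V, hV⟩ := exists_heckeAct_eq_mul T U
        refine ⟨V ⊗ₜ (c * d), ?_⟩
        change ((c * d : K) : ℂ) • heckeAct N V =
          ((c : ℂ) • heckeAct N T) * ((d : ℂ) • heckeAct N U)
        rw [hV, smul_mul_smul_comm]
        rfl
  algebraMap_mem' c := by
    obtain ⟨T, hT⟩ := exists_heckeAct_eq_one (N := N)
    refine ⟨T ⊗ₜ c, ?_⟩
    change (c : ℂ) • heckeAct N T = _
    rw [hT]
    rfl

end

/-! ### Multiplicity one -/

section

open scoped ComplexConjugate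

variable {M N : ℕ}

lemma pet_add_left [NeZero N] (f f' g : S₂ N) : pet (f + f') g = pet f g + pet f' g := by
  rw [← pet_conj, pet_add_right, map_add, pet_conj, pet_conj]

lemma pet_smul_left [NeZero N] (c : ℂ) (f g : S₂ N) : pet (c • f) g = conj c * pet f g := by
  rw [← pet_conj, pet_smul_right, map_mul, pet_conj]

/-- Every linear functional on `S₂(N)` is given by the Petersson product. -/
lemma exists_petLin_eq [NeZero N] (L : S₂ N →ₗ[ℂ] ℂ) : ∃ g : S₂ N, petLin g = L := by
  -- `petLin` is conjugate linear; as a real linear map it is injective between spaces of the same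
  -- dimension.
  let Φ : S₂ N →ₗ[ℝ] (S₂ N →ₗ[ℂ] ℂ) :=
    { toFun := petLin
      map_add' := fun f f' ↦ by ext g; exact pet_add_left f f' g
      map_smul' := fun c f ↦ by
        ext g
        have h := pet_smul_left (c : ℂ) f g
        rw [Complex.conj_ofReal] at h
        exact h }
  have hinj : Function.Injective Φ := by
    rw [injective_iff_map_eq_zero]
    intro f hf
    exact eq_zero_of_pet_self (DFunLike.congr_fun hf f)
  have hdim : Module.finrank ℝ (S₂ N) = Module.finrank ℝ (S₂ N →ₗ[ℂ] ℂ) := by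
    have h1 := finrank_real_of_complex (S₂ N)
    have h2 := finrank_real_of_complex (S₂ N →ₗ[ℂ] ℂ)
    have h3 := Subspace.dual_finrank_eq (K := ℂ) (V := S₂ N)
    rw [h1, h2]
    exact congrArg (2 * ·) h3.symm
  have : FiniteDimensional ℝ (S₂ N) := FiniteDimensional.complexToReal _
  have : FiniteDimensional ℝ (S₂ N →ₗ[ℂ] ℂ) := FiniteDimensional.complexToReal _
  exact (LinearMap.injective_iff_surjective_of_finrank_eq_finrank hdim).mp hinj L

/-- The forms of level `M` that are eigenforms of `T_p` with eigenvalue `l p` for all primes `p`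
not dividing `N`. Here `M` will be a divisor of `N`. -/
def eigenforms (N : ℕ) (l : Nat.Primes → ℂ) (M : ℕ) [NeZero M] : Submodule ℂ (S₂ M) :=
  ⨅ p : {p : Nat.Primes // ¬ (p : ℕ) ∣ N}, LinearMap.ker (heckeOp M p.1 - l p.1 • 1)

lemma mem_eigenforms {l : Nat.Primes → ℂ} [NeZero M] {f : S₂ M} :
    f ∈ eigenforms N l M ↔ ∀ p : Nat.Primes, ¬ (p : ℕ) ∣ N → heckeOp M p f = l p • f := by
  simp [eigenforms, sub_eq_zero]

/-- If the first coefficient vanishes on a subspace stable under the Hecke operators `T_p`, then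
so do all coefficients prime to the level. -/
lemma coeff_eq_zero_of_stable [NeZero M] {N : ℕ} (hMN : M ∣ N) {W : Submodule ℂ (S₂ M)}
    (hW : ∀ p : Nat.Primes, ¬ (p : ℕ) ∣ N → ∀ f ∈ W, heckeOp M p f ∈ W)
    (h1 : ∀ f ∈ W, (qExpansion 1 f).coeff 1 = 0) {n : ℕ} (hn : n.Coprime N) (hn0 : n ≠ 0)
    {f : S₂ M} (hf : f ∈ W) : (qExpansion 1 f).coeff n = 0 := by
  induction n using Nat.strong_induction_on generalizing f with | _ n ih => ?_
  rcases eq_or_ne n 1 with rfl | hn1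
  · exact h1 f hf
  obtain ⟨p, hp, k, rfl⟩ := Nat.exists_prime_and_dvd hn1
  have : NeZero p := ⟨hp.ne_zero⟩
  have hpN : ¬ p ∣ N := (hp.coprime_iff_not_dvd).mp (hn.coprime_dvd_left (dvd_mul_right p k))
  have hk0 : k ≠ 0 := by rintro rfl; simp at hn0
  have hkN : k.Coprime N := hn.coprime_dvd_left (dvd_mul_left k p)
  have hk : k < p * k := by nlinarith [hp.two_le, Nat.pos_of_ne_zero hk0]
  have h2 := coeff_heckeOp hp (fun h ↦ hpN (h.trans hMN)) f k
  rw [ih k hk hkN hk0 (hW ⟨p, hp⟩ hpN f hf)] at h2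
  split_ifs at h2 with hpk
  · obtain ⟨j, rfl⟩ := hpk
    rw [Nat.mul_div_cancel_left j hp.pos, ih j ?_ (hkN.coprime_dvd_left (dvd_mul_left j p)) ?_ hf]
      at h2
    · simpa using h2.symm
    · nlinarith [hp.two_le, Nat.pos_of_ne_zero (right_ne_zero_of_mul hk0)]
    · exact right_ne_zero_of_mul hk0
  · simpa using h2.symm

lemma coeff_zero_eq_zero [NeZero N] (f : S₂ N) : (qExpansion 1 f).coeff 0 = 0 :=
  CuspFormClass.qExpansion_coeff_zero f one_pos (one_mem_strictPeriods_Γ₀ N)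

/-- A nonzero oldform that is an eigenform of the `T_p` yields an eigenform with the same
eigenvalues at a lower level. -/
lemma exists_eigenforms_ne_bot [NeZero M] {l : Nat.Primes → ℂ} (hMN : M ∣ N)
    (hl : ∀ p : Nat.Primes, ¬ (p : ℕ) ∣ N → conj (l p) = l p) {h : S₂ M} (hh : h ≠ 0)
    (hmem : h ∈ eigenforms N l M) (hold : h ∈ oldforms M) :
    ∃ (M' : ℕ) (_ : NeZero M'), M' ∣ M ∧ M' ≠ M ∧ eigenforms N l M' ≠ ⊥ := by
  rw [mem_eigenforms] at hmem
  by_contra! hcon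
  refine hh (eq_zero_of_pet_self (?_ : h ∈ LinearMap.ker (petLin h)))
  refine oldforms_le (fun M' d _ _ hd hne f ↦ ?_) hold
  -- the image of `h` under the adjoint of the degeneracy map to level `M'`
  obtain ⟨g, hg⟩ := exists_petLin_eq (petLin h ∘ₗ oldMap hd)
  have hgf (f : S₂ M') : pet g f = pet h (oldMap hd f) := DFunLike.congr_fun hg f
  have hg0 : g = 0 := by
    have hM' : M' ∣ M := (dvd_mul_right M' d).trans hd
    rw [← Submodule.mem_bot ℂ, ← hcon M' inferInstance hM' hne, mem_eigenforms]
    intro p hpN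
    have hpM : ¬ (p : ℕ) ∣ M := fun h ↦ hpN (h.trans hMN)
    refine sub_eq_zero.mp (eq_zero_of_pet_self ?_)
    set f := heckeOp M' p g - l p • g
    have h1 : pet (heckeOp M' p g) f = l p * pet h (oldMap hd f) := by
      rw [← pet_heckeOp p.2 (fun h ↦ hpM (h.trans hM')), hgf, ← heckeOp_oldMap hd f p.2 hpM,
        pet_heckeOp p.2 hpM, hmem p hpN, pet_smul_left, hl p hpN]
    have h2 : f = heckeOp M' p g + (-l p) • g := by
      rw [_root_.neg_smul, ← sub_eq_add_neg]
    conv_lhs => rw [h2]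
    rw [pet_add_left, pet_smul_left, ← h2, h1, hgf, map_neg, hl p hpN]
    ring
  rw [LinearMap.mem_ker, petLin_apply, ← hgf, hg0]
  simpa using pet_smul_left 0 (0 : S₂ M') f

lemma heckeOp_mem_eigenforms [NeZero M] {l : Nat.Primes → ℂ} (hMN : M ∣ N) {f : S₂ M}
    (hf : f ∈ eigenforms N l M) (p : Nat.Primes) (hp : ¬ (p : ℕ) ∣ M) :
    heckeOp M p f ∈ eigenforms N l M := by
  rw [mem_eigenforms] at hf ⊢
  intro r hr
  have h := heckeOp_comm r.2 p.2 (fun h ↦ hr (h.trans hMN)) hp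
  rw [← Module.End.mul_apply, h.eq, Module.End.mul_apply, hf r hr, map_smul]

lemma IsNewform.ne_zero [NeZero N] {G : S₂ N} (hG : IsNewform G) : G ≠ 0 := by
  rintro rfl
  have h1 := hG.normalized
  rw [← qExpLin_apply, map_zero] at h1
  simp at h1

/-- A form of level `N` with the same eigenvalues as the newform `G` for all `T_p` with `p ∤ N` is a
multiple of `G`. -/
lemma eigenforms_le_span [NeZero N] {G : S₂ N} (hG : IsNewform G) {l : Nat.Primes → ℂ}
    (hGl : G ∈ eigenforms N l N) (hl : ∀ p : Nat.Primes, ¬ (p : ℕ) ∣ N → conj (l p) = l p) :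
    eigenforms N l N ≤ Submodule.span ℂ {G} := by
  classical
  -- An eigenform whose first coefficient vanishes is old.
  have hold (f) (hf : f ∈ eigenforms N l N) (h1 : (qExpansion 1 f).coeff 1 = 0) :
      f ∈ oldforms N := by
    refine mem_oldforms_of_coeff_eq_zero f fun n hn ↦ ?_
    rcases eq_or_ne n 0 with rfl | hn0
    · exact coeff_zero_eq_zero f
    refine coeff_eq_zero_of_stable dvd_rfl (W := Submodule.span ℂ {f}) (fun p hp g hg ↦ ?_)
      (fun g hg ↦ ?_) hn hn0 (Submodule.mem_span_singleton_self f)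
    · obtain ⟨c, rfl⟩ := Submodule.mem_span_singleton.mp hg
      rw [map_smul, mem_eigenforms.mp hf p hp]
      exact Submodule.smul_mem _ _ (Submodule.smul_mem _ _ (Submodule.mem_span_singleton_self f))
    · obtain ⟨c, rfl⟩ := Submodule.mem_span_singleton.mp hg
      rw [← qExpLin_apply, map_smul, PowerSeries.coeff_smul, qExpLin_apply, h1, smul_zero]
  intro f hf
  by_contra hfG
  set a := (qExpansion 1 f).coeff 1
  have hsub (g h : S₂ N) : (qExpansion 1 (g - h : S₂ N)).coeff 1 =
      (qExpansion 1 g).coeff 1 - (qExpansion 1 h).coeff 1 := by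
    simp_rw [← qExpLin_apply, map_sub]
  have hf' : f - a • G ∈ eigenforms N l N := Submodule.sub_mem _ hf (Submodule.smul_mem _ _ hGl)
  have hf'0 : f - a • G ≠ 0 := fun h ↦ hfG (Submodule.mem_span_singleton.mpr
    ⟨a, (sub_eq_zero.mp h).symm⟩)
  have hf'1 : (qExpansion 1 (f - a • G : S₂ N)).coeff 1 = 0 := by
    rw [hsub, ← qExpLin_apply (a • G), map_smul, PowerSeries.coeff_smul, qExpLin_apply,
      hG.normalized, smul_eq_mul, mul_one, sub_self]
  obtain ⟨M₀, hM₀, hM₀N, hM₀ne, hM₀W⟩ :=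
    exists_eigenforms_ne_bot dvd_rfl hl hf'0 hf' (hold _ hf' hf'1)
  -- the smallest level at which the system of eigenvalues occurs
  have hex : ∃ M, ∃ (_ : NeZero M), M ∣ N ∧ M ≠ N ∧ eigenforms N l M ≠ ⊥ :=
    ⟨M₀, hM₀, hM₀N, hM₀ne, hM₀W⟩
  obtain ⟨hM, hMN, hMne, hMW⟩ := Nat.find_spec hex
  set M := Nat.find hex
  obtain ⟨h, hh, hh1⟩ : ∃ h ∈ eigenforms N l M, (qExpansion 1 h).coeff 1 ≠ 0 := by
    by_contra! hzero
    obtain ⟨h, hh, hh0⟩ := Submodule.exists_mem_ne_zero_of_ne_bot hMW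
    have hold' : h ∈ oldforms M := by
      refine mem_oldforms_of_coeff_eq_zero h fun n hn ↦ ?_
      rcases eq_or_ne n 0 with rfl | hn0
      · exact coeff_zero_eq_zero h
      exact coeff_eq_zero_of_stable dvd_rfl (fun p hp g hg ↦ heckeOp_mem_eigenforms hMN hg p hp)
        hzero hn hn0 hh
    obtain ⟨M', hM', hM'M, hM'ne, hM'W⟩ := exists_eigenforms_ne_bot hMN hl hh0 hh hold'
    have hlt : M' < M := lt_of_le_of_ne (Nat.le_of_dvd (Nat.pos_of_ne_zero hM.out) hM'M) hM'ne
    refine Nat.find_min hex hlt ⟨hM', hM'M.trans hMN, fun h ↦ ?_, hM'W⟩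
    have := Nat.le_of_dvd (Nat.pos_of_ne_zero (NeZero.ne N)) hMN
    omega
  -- The eigenform of minimal level is normalized and viewed as an oldform `g` of level `N`. Then
  -- `G - g` is old as well, and so is `G`, a contradiction.
  have hMN1 : M * 1 ∣ N := by rwa [mul_one]
  set b := (qExpansion 1 h).coeff 1
  set g : S₂ N := b⁻¹ • oldMap hMN1 h
  have hgold : g ∈ oldforms N := Submodule.smul_mem _ _ (oldMap_mem_oldforms hMN1 hMne h)
  have hgmem : g ∈ eigenforms N l N := by
    refine Submodule.smul_mem _ _ (mem_eigenforms.mpr fun p hp ↦ ?_)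
    rw [heckeOp_oldMap hMN1 h p.2 hp, mem_eigenforms.mp hh p hp, map_smul]
  have hg1 : (qExpansion 1 g).coeff 1 = 1 := by
    rw [← qExpLin_apply, map_smul, PowerSeries.coeff_smul, qExpLin_apply, qExpansion_oldMap]
    simp [dilate, b, hh1]
  have hGg : G - g ∈ oldforms N := hold _ (Submodule.sub_mem _ hGl hgmem) (by
    rw [hsub, hG.normalized, hg1, sub_self])
  have hGold : G ∈ oldforms N := by
    have := Submodule.add_mem _ hGg hgold
    rwa [sub_add_cancel] at this
  exact hG.ne_zero (eq_zero_of_pet_self (hG.pet_eq_zero G hGold))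

end

/-! ### The projection onto the line of a newform -/

section

open scoped ComplexConjugate

variable {N : ℕ} [NeZero N]

/-- Generalized eigenvectors of a self-adjoint operator are eigenvectors. -/
lemma ker_pow_le_of_pet_adjoint {A : Module.End ℂ (S₂ N)}
    (hA : ∀ f g, pet g (A f) = pet (A g) f) (n : ℕ) {f : S₂ N} (hf : (A ^ n) f = 0) :
    A f = 0 := by
  induction n with
  | zero =>
    have : f = 0 := by simpa using hf
    rw [this, map_zero]
  | succ n ih =>
    cases n with
    | zero => simpa using hf
    | succ n =>
      refine ih (eq_zero_of_pet_self ?_)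
      have h1 (m : ℕ) (g : S₂ N) : (A ^ (m + 1)) g = A ((A ^ m) g) := by
        rw [pow_succ', Module.End.mul_apply]
      conv_lhs => rw [h1 n]
      rw [← hA, ← h1 n, ← h1 (n + 1), hf]
      exact map_zero (petLin _)

/-- If `T` is self-adjoint and `l` is a real root of multiplicity `μ` of its characteristic
polynomial, the complementary factor maps into the `l`-eigenspace. -/
lemma sub_mul_aeval_eq_zero {T : Module.End ℂ (S₂ N)} (hT : ∀ f g, pet g (T f) = pet (T g) f)
    {l : ℂ} (hl : conj l = l) {μ : ℕ} {Q : ℂ[X]}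
    (hQ : T.charpoly = (Polynomial.X - Polynomial.C l) ^ μ * Q) :
    (T - l • 1) * Polynomial.aeval T Q = 0 := by
  have hA (f g : S₂ N) : pet g ((T - l • 1 : Module.End ℂ (S₂ N)) f) =
      pet ((T - l • 1 : Module.End ℂ (S₂ N)) g) f := by
    have h1 (f : S₂ N) : (T - l • 1 : Module.End ℂ (S₂ N)) f = T f + (-l) • f := by
      rw [LinearMap.sub_apply, LinearMap.smul_apply, Module.End.one_apply, _root_.neg_smul,
        sub_eq_add_neg]
    rw [h1, h1, pet_add_right, pet_add_left, pet_smul_right, pet_smul_left, hT, map_neg, hl]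
  have hker := LinearMap.aeval_self_charpoly T
  rw [hQ, map_mul, map_pow, map_sub, Polynomial.aeval_X, Polynomial.aeval_C,
    Algebra.algebraMap_eq_smul_one] at hker
  ext f : 1
  exact ker_pow_le_of_pet_adjoint hA μ (DFunLike.congr_fun hker f)

/-- The functional `pet G` is an eigenvector of the transpose of a self-adjoint operator `T` if
`G` is one of `T`. -/
lemma pet_aeval_eq {T : Module.End ℂ (S₂ N)} (hT : ∀ f g, pet g (T f) = pet (T g) f)
    {l : ℂ} (hl : conj l = l) {G : S₂ N} (hG : T G = l • G) (Q : ℂ[X]) (f : S₂ N) :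
    pet G (Polynomial.aeval T Q f) = Q.eval l * pet G f := by
  have h1 (f : S₂ N) : pet G (T f) = l * pet G f := by
    rw [hT, hG, pet_smul_left, hl]
  have h2 (n : ℕ) (f : S₂ N) : pet G ((T ^ n) f) = l ^ n * pet G f := by
    induction n with
    | zero => simp
    | succ n ih => rw [pow_succ', Module.End.mul_apply, h1, ih, pow_succ']; ring
  induction Q using Polynomial.induction_on' with
  | add p q hp hq =>
    rw [map_add, LinearMap.add_apply, pet_add_right, hp, hq, Polynomial.eval_add]
    ring
  | monomial n a =>
    rw [Polynomial.aeval_monomial, Module.End.mul_apply, Module.algebraMap_end_apply,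
      pet_smul_right, h2, Polynomial.eval_monomial]
    ring

lemma mul_list_prod_eq_zero {ι R : Type*} [Ring R] {A : R} {Y : ι → R} {L : List ι} {i : ι}
    (hi : i ∈ L) (hA : A * Y i = 0) (hcomm : ∀ j ∈ L, Commute A (Y j)) :
    A * (L.map Y).prod = 0 := by
  induction L with
  | nil => simp at hi
  | cons j L ih =>
    rw [List.map_cons, List.prod_cons, ← mul_assoc]
    rcases List.mem_cons.mp hi with rfl | hi
    · rw [hA, zero_mul]
    · rw [(hcomm j List.mem_cons_self).eq, mul_assoc,
        ih hi fun k hk ↦ hcomm k (List.mem_cons_of_mem _ hk), mul_zero]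

lemma heckeActTensor_tmul_one (K : IntermediateField ℚ ℂ) (T : 𝕋 N) :
    heckeActTensor N K (T ⊗ₜ 1) = heckeAct N T :=
  one_smul ℂ _

/-- Finitely many of the operators `T_p` suffice to cut out the common eigenspace. -/
lemma exists_list_eigenforms (l : Nat.Primes → ℂ) :
    ∃ L : List Nat.Primes, (∀ p ∈ L, ¬ (p : ℕ) ∣ N) ∧
      ∀ f : S₂ N, (∀ p ∈ L, heckeOp N p f = l p • f) → f ∈ eigenforms N l N := by
  classical
  obtain ⟨s, hs⟩ := Finset.exists_inf_le fun p : {p : Nat.Primes // ¬ (p : ℕ) ∣ N} ↦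
    LinearMap.ker (heckeOp N p.1 - l p.1 • 1)
  refine ⟨s.toList.map (↑), fun p hp ↦ ?_, fun f hf ↦ ?_⟩
  · obtain ⟨q, -, rfl⟩ := List.mem_map.mp hp
    exact q.2
  · rw [eigenforms, Submodule.mem_iInf]
    intro p
    refine hs p ?_
    rw [Submodule.mem_finsetInf]
    intro q hq
    have := hf q (List.mem_map.mpr ⟨q, Finset.mem_toList.mpr hq, rfl⟩)
    simp [this]

end

end HeckeProj

end

theorem proposition2p1 (N : ℕ) [NeZero N] (G : S₂ N) (hG : IsNewform G) :
    ∃ t : 𝕋 N ⊗[ℤ] heckeField G,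
      IsOrthogonalProjection (heckeActTensor N (heckeField G) t) G ∧
      ∃ (_ : FiniteDimensional ℂ (S₂ N)) (l : List Nat.Primes)
        (eig : Nat.Primes → heckeField G) (Q : Nat.Primes → (heckeField G)[X]),
        (∀ p ∈ l, ¬ (p : ℕ) ∣ N ∧
          heckeAct N (heckeT N p) G = (eig p : ℂ) • G ∧
          (Q p).eval (eig p) ≠ 0 ∧
          ∃ μ : ℕ, LinearMap.charpoly (heckeAct N (heckeT N p)) =
            ((Polynomial.X - Polynomial.C (eig p)) ^ μ * Q p).map
              (algebraMap (heckeField G) ℂ)) ∧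
        heckeActTensor N (heckeField G) t =
          (l.map fun p ↦ (((Q p).eval (eig p) : heckeField G) : ℂ)⁻¹ •
            Polynomial.aeval (heckeAct N (heckeT N p))
              ((Q p).map (algebraMap (heckeField G) ℂ))).prod := by
  classical
  have hEnd : FiniteDimensional ℂ (S₂ N) := inferInstance
  set K := heckeField G
  have hG0 : G ≠ 0 := hG.ne_zero
  choose eig' heig' using fun p : Nat.Primes ↦ hG.eigenform (heckeT N p)
  have hmemK (p : Nat.Primes) : eig' p ∈ K :=
    IntermediateField.subset_adjoin _ _ ⟨heckeT N p, heig' p⟩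
  let eig (p : Nat.Primes) : K := ⟨eig' p, hmemK p⟩
  have hT (p : Nat.Primes) (hp : ¬ (p : ℕ) ∣ N) (f g : S₂ N) :
      pet g (heckeAct N (heckeT N p) f) = pet (heckeAct N (heckeT N p) g) f := by
    rw [heckeAct_heckeT]
    exact pet_heckeOp p.2 hp f g
  have hreal (p : Nat.Primes) (hp : ¬ (p : ℕ) ∣ N) : starRingEnd ℂ (eig' p) = eig' p := by
    have h1 := hT p hp G G
    rw [heig', pet_smul_left, pet_smul_right] at h1
    exact (mul_right_cancel₀ (fun h ↦ hG0 (eq_zero_of_pet_self h)) h1).symm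
  have hQ (p : Nat.Primes) : ∃ Q : K[X], ¬ (p : ℕ) ∣ N → Q.eval (eig p) ≠ 0 ∧ ∃ μ : ℕ,
      (heckeAct N (heckeT N p)).charpoly =
        ((Polynomial.X - Polynomial.C (eig p)) ^ μ * Q).map (algebraMap K ℂ) := by
    by_cases hp : (p : ℕ) ∣ N
    · exact ⟨0, fun h ↦ absurd hp h⟩
    obtain ⟨P₀, hP₀⟩ := exists_charpoly_heckeOp_eq p.2 hp
    have hmap : (P₀.map (algebraMap ℚ K)).map (algebraMap K ℂ) =
        (heckeAct N (heckeT N p)).charpoly := by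
      rw [Polynomial.map_map, ← IsScalarTower.algebraMap_eq, hP₀, heckeAct_heckeT]
    have hne : P₀.map (algebraMap ℚ K) ≠ 0 := by
      intro h
      rw [h, Polynomial.map_zero] at hmap
      exact (LinearMap.charpoly_monic _).ne_zero hmap.symm
    obtain ⟨Q, hQ, hdvd⟩ := Polynomial.exists_eq_pow_rootMultiplicity_mul_and_not_dvd _ hne (eig p)
    refine ⟨Q, fun _ ↦ ⟨fun h ↦ hdvd (Polynomial.dvd_iff_isRoot.mpr h),
      (P₀.map (algebraMap ℚ K)).rootMultiplicity (eig p), ?_⟩⟩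
    rw [← hQ, hmap]
  choose Q hQ using hQ
  obtain ⟨L, hLN, hL⟩ := exists_list_eigenforms (N := N) eig'
  set Y : Nat.Primes → Module.End ℂ (S₂ N) := fun p ↦
    (((Q p).eval (eig p) : K) : ℂ)⁻¹ • Polynomial.aeval (heckeAct N (heckeT N p))
      ((Q p).map (algebraMap K ℂ)) with hY
  -- the product of the operators `Y p` lies in the range of the Hecke algebra
  have hYmem (p : Nat.Primes) : Y p ∈ heckeSubalgebra N K := by
    have h1 : Y p = ((Q p).eval (eig p))⁻¹ • Polynomial.aeval (heckeAct N (heckeT N p)) (Q p) := by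
      rw [hY, ← Polynomial.aeval_map_algebraMap ℂ]
      simp only
      rw [← IntermediateField.coe_inv]
      rfl
    rw [h1]
    refine Subalgebra.smul_mem _ ?_ _
    have h2 : heckeAct N (heckeT N p) ∈ heckeSubalgebra N K :=
      ⟨_, heckeActTensor_tmul_one K (heckeT N p)⟩
    exact Algebra.adjoin_le (Set.singleton_subset_iff.mpr h2)
      (Polynomial.aeval_mem_adjoin_singleton K _)
  obtain ⟨t, ht⟩ : (L.map Y).prod ∈ heckeSubalgebra N K :=
    Subalgebra.list_prod_mem _ fun x hx ↦ by
      obtain ⟨p, -, rfl⟩ := List.mem_map.mp hx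
      exact hYmem p
  refine ⟨t, ?_, hEnd, L, eig, Q, fun p hp ↦ ⟨hLN p hp, heig' p, (hQ p (hLN p hp)).1,
    (hQ p (hLN p hp)).2⟩, ht⟩
  have hQ' (p : Nat.Primes) (hp : ¬ (p : ℕ) ∣ N) : ∃ μ : ℕ,
      (heckeAct N (heckeT N p)).charpoly =
        (Polynomial.X - Polynomial.C (eig' p)) ^ μ * (Q p).map (algebraMap K ℂ) := by
    obtain ⟨μ, hμ⟩ := (hQ p hp).2
    refine ⟨μ, ?_⟩
    rw [hμ, Polynomial.map_mul, Polynomial.map_pow, Polynomial.map_sub, Polynomial.map_X,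
      Polynomial.map_C]
    rfl
  -- each factor has image in an eigenspace
  have hYker (p : Nat.Primes) (hp : ¬ (p : ℕ) ∣ N) :
      (heckeAct N (heckeT N p) - eig' p • 1) * Y p = 0 := by
    obtain ⟨μ, hμ⟩ := hQ' p hp
    rw [hY]
    simp only
    rw [mul_smul_comm, sub_mul_aeval_eq_zero (hT p hp) (hreal p hp) hμ, smul_zero]
  have hcomm (p q : Nat.Primes) (hp : ¬ (p : ℕ) ∣ N) (hq : ¬ (q : ℕ) ∣ N) :
      Commute (heckeAct N (heckeT N p) - eig' p • 1) (Y q) := by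
    refine Commute.smul_right ?_ _
    have h1 : Commute (heckeAct N (heckeT N p) - eig' p • 1) (heckeAct N (heckeT N q)) := by
      refine Commute.sub_left ?_ ((Commute.one_left _).smul_left _)
      rw [heckeAct_heckeT, heckeAct_heckeT]
      exact heckeOp_comm p.2 q.2 hp hq
    have h2 := Algebra.adjoin_le
      (S := Subalgebra.centralizer ℂ {heckeAct N (heckeT N p) - eig' p • 1})
      (Set.singleton_subset_iff.mpr ((Subalgebra.mem_centralizer_iff ℂ).mpr fun x hx ↦ by
        rw [Set.mem_singleton_iff.mp hx]
        exact h1.eq))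
      (Polynomial.aeval_mem_adjoin_singleton ℂ (p := (Q q).map (algebraMap K ℂ))
        (heckeAct N (heckeT N q)))
    exact (Subalgebra.mem_centralizer_iff ℂ).mp h2 _ (Set.mem_singleton _)
  -- each factor preserves the product with `G`
  have hYpet (p : Nat.Primes) (hp : ¬ (p : ℕ) ∣ N) (f : S₂ N) : pet G (Y p f) = pet G f := by
    have h1 : ((Q p).map (algebraMap K ℂ)).eval (eig' p) = ((Q p).eval (eig p) : K) :=
      Polynomial.eval_map_apply (algebraMap K ℂ) (eig p)
    have h2 : (((Q p).eval (eig p) : K) : ℂ) ≠ 0 := by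
      exact_mod_cast (hQ p hp).1
    rw [hY, LinearMap.smul_apply, pet_smul_right, pet_aeval_eq (hT p hp) (hreal p hp) (heig' p), h1,
      inv_mul_cancel_left₀ h2]
  rw [ht]
  intro f
  constructor
  · refine eigenforms_le_span hG (mem_eigenforms.mpr fun p hp ↦ ?_) hreal (hL _ fun p hp ↦ ?_)
    · rw [← heckeAct_heckeT, heig']
    · have h1 := mul_list_prod_eq_zero hp (hYker p (hLN p hp))
        fun q hq ↦ hcomm p q (hLN p hp) (hLN q hq)
      rw [← heckeAct_heckeT]
      exact sub_eq_zero.mp (DFunLike.congr_fun h1 f)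
  · have h1 (L' : List Nat.Primes) (hL' : ∀ p ∈ L', ¬ (p : ℕ) ∣ N) :
        pet G ((L'.map Y).prod f) = pet G f := by
      induction L' with
      | nil => rfl
      | cons p L' ih =>
        rw [List.map_cons, List.prod_cons, Module.End.mul_apply,
          hYpet p (hL' p List.mem_cons_self), ih fun q hq ↦ hL' q (List.mem_cons_of_mem _ hq)]
    rw [← petLin_apply, map_sub, petLin_apply, petLin_apply, h1 L hLN, sub_self]
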